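/- **Setting.** Let $T\ge 1$, $a\in\mathbb R$, $q_1,\dots,q_T\ge 0$, $r_1,\dots,r_{T-1}\ge 0$, and rates $R_1,\dots,R_{T-1}\in\mathbb N=\{0,1,\dots\}$, $R_T=0$. Let $W_0$ be a random variable with a log-concave probability density $f$. The plant is $X_1=W_0$, $X_{t+1}=aX_t+U_t$ for $1\le t\le T-1$. A policy consists of encoders $\ell_t=\mathcal E_t(X_1,\dots,X_t)\in\{0,\dots,2^{R_t}-1\}$ and controllers $U_t=\mathcal D_t(\ell_1,\dots,\ell_t)\in\mathbb R$. It has *contiguous cells* if for every $t\le T-1$ and all values of $\ell_1,\dots,\ell_t$, the set of $w$ in the support $\{f>0\}$ for which $W_0=w$ produces these indices is an interval (possibly empty). Its cost is $$\bar J_T=\frac1T\,\mathbb E\Big[q_TX_T^2+\sum_{t=1}^{T-1}\big(q_tX_t^2+r_tU_t^2\big)\Big].$$ Put $s_{T+1}=0$, $s_T=q_T$, $s_t=q_t+\frac{s_{t+1}r_t}{s_{t+1}+r_t}a^2$, $k_t=\frac{s_{t+1}}{s_{t+1}+r_t}a$, $g_t=s_{t+1}a^2-s_t+q_t$ (so $g_T=0$),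 $\tilde g_t=a^{2(t-1)}g_t$, and assume $\tilde g_t>0$ for $1\le t\le T-1$. **Quantizers.** Let $N=2^{R_1+\dots+R_T}$. A regular multi-resolution scalar quantizer is given by last-stage levels $-\infty=p[0]<p[1]<\dots<p[N]=\infty$ whose cells $[p[\ell],p[\ell+1])$ (with $(-\infty,p[1])$ as the first) all have positive probability, and by reproduction points $c_t[m]$ for $1\le t\le T$, $0\le m<2^{R_1+\dots+R_t}$. The last-stage cell $\ell$ lies in the stage-$t$ cell $m_t[\ell]=\lfloor \ell\,2^{-(R_{t+1}+\dots+R_T)}\rfloor$; the stage-$t$ encoder sends the $R_t$ bits that single out the stage-$t$ cell of $W_0$ inside its stage-$(t-1)$ cell, and the description is $\hat W_t=c_t[m]$ if $W_0$ lies in stage-$t$ cell $m$ (and $\hat W_0=0$). The weighted distortion is $\bar D(p,c)=\sum_{t=1}^T\tilde g_t\,\mathbb E(W_0-\hat W_t)^2$. With $\alpha_\ell=\sum_t\tilde g_tc_t[m_t[\ell]]$ and $\beta_\ell=\sum_t\tilde g_tc_t[m_t[\ell]]^2$, consider the two conditions - (centroid) $c_t[m]=\mathbb E[W_0\mid W_0\in\text{stage-}t\text{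 cell }m]$ for all $t,m$; - (weighted nearest neighbor) for every cell $\ell$, $p[\ell]=\max_{i:\alpha_i<\alpha_\ell}\frac{\beta_\ell-\beta_i}{2(\alpha_\ell-\alpha_i)}$ if $\ell\ge1$, and $p[\ell+1]=\min_{i:\alpha_i>\alpha_\ell}\frac{\beta_\ell-\beta_i}{2(\alpha_\ell-\alpha_i)}$ if $\ell+1<N$. A *run of the generalized Lloyd–Max algorithm* starts from a partition $p^{(0)}$, and in iteration $n=0,1,\dots$ takes $c^{(n)}$ to be the centroids of $p^{(n)}$ and $p^{(n+1)}$ to be the weighted nearest neighbor partition of $c^{(n)}$; the run is required to be well defined, i.e. every $p^{(n)}$ is again a partition into $N$ cells of positive probability. Iteration $n$ returns $(p^{(n+1)},c^{(n)})$. The *LQR policy* of a quantizer $(p,c)$ transmits the quantizer index of $W_0=X_1$ at each time $t\le T-1$ and applies $U_t=-k_t\hat X_t$, where $\hat X_0=U_0=0$ and $\hat X_t=a\hat X_{t-1}+U_{t-1}+a^{t-1}(\hat W_t-\hat W_{t-1})$. **Theorem.** There is exactly one quantizer $(p^*,c^*)$ (a partition into $N$ cells of positive probability, with reproduction points) that satisfies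 both conditions. Its LQR policy has contiguous cells and attains the minimum of $\bar J_T$ over all policies with contiguous cells. Moreover, for every run of the generalized Lloyd–Max algorithm: 1. $p^{(n)}\to p^*$ and $c^{(n)}\to c^*$, and the cost of the LQR policy of $(p^{(n+1)},c^{(n)})$ converges to this minimum; 2. for every $\varepsilon>0$ there is $\eta_0>0$ such that for every accuracy threshold $0<\eta\le\eta_0$, the algorithm that stops as soon as the decrease of $\bar D$ from one iteration to the next is below $\eta$ stops after finitely many iterations, and the LQR policy of the quantizer that it returns has a cost within $\varepsilon$ of the minimum. -/

import Mathlib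

open MeasureTheory Filter Topology

namespace LQR

/-! ### Log-concave densities -/

/-- Log-concavity of a nonnegative function, in the multiplicative form that allows the value `0`
(that is, `log f = -∞`). -/
def IsLogConcave (f : ℝ → ℝ) : Prop :=
  (∀ x, 0 ≤ f x) ∧
    ∀ x y : ℝ, ∀ lam ∈ Set.Icc (0 : ℝ) 1,
      f x ^ lam * f y ^ (1 - lam) ≤ f (lam * x + (1 - lam) * y)

/-! ### Coding and control policies and the closed loop -/

/-- A causal policy: at time `t` the encoder maps `(X_1, …, X_t)` to an index of `R t` bits, and the
controller maps the indices `(ℓ_1, …, ℓ_t)` to the action `U_t`.  Entry `i` of a tuple indexed by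
`Fin t` belongs to time `i + 1`. -/
structure Policy (R : ℕ → ℕ) where
  enc : (t : ℕ) → (Fin t → ℝ) → Fin (2 ^ R t)
  dec : (t : ℕ) → ((i : Fin t) → Fin (2 ^ R ((i : ℕ) + 1))) → ℝ

namespace Policy

variable {R : ℕ → ℕ}

/-- The action `U_t` that the policy produces when the states up to time `t` are `x`. -/
def act (π : Policy R) (t : ℕ) (x : Fin t → ℝ) : ℝ :=
  π.dec t fun i => π.enc ((i : ℕ) + 1) fun j => x (Fin.castLE (Nat.succ_le_of_lt i.isLt) j)

/-- The state history `(X_1, …, X_t)` of the plant `X_{t+1} = a X_t + U_t`, `X_1 = w`. -/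
def hist (π : Policy R) (a w : ℝ) : (t : ℕ) → (Fin t → ℝ)
  | 0 => Fin.elim0
  | 1 => fun _ => w
  | t + 2 =>
      Fin.snoc (α := fun _ => ℝ) (hist π a w (t + 1))
        (a * hist π a w (t + 1) (Fin.last t) + π.act (t + 1) (hist π a w (t + 1)))

/-- The state `X_t`, with `X_0 = 0`. -/
def state (π : Policy R) (a w : ℝ) : ℕ → ℝ
  | 0 => 0
  | t + 1 => π.hist a w (t + 1) (Fin.last t)

/-- The transmitted index `ℓ_t`. -/
def msg (π : Policy R) (a w : ℝ) (t : ℕ) : Fin (2 ^ R t) := π.enc t (π.hist a w t)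

/-- The control action `U_t`. -/
def control (π : Policy R) (a w : ℝ) (t : ℕ) : ℝ := π.act t (π.hist a w t)

/-- Contiguous cells: for every time `t ≤ T - 1` and all values of the indices `ℓ_1, …, ℓ_t`, the
initial disturbances, within the support of the density `f`, that produce these indices form an
interval (possibly empty). -/
def Contiguous (π : Policy R) (f : ℝ → ℝ) (a : ℝ) (T : ℕ) : Prop :=
  ∀ t ∈ Finset.Icc 1 (T - 1), ∀ σ : (i : ℕ) → Fin (2 ^ R i),
    Set.OrdConnected {w : ℝ | w ∈ Function.support f ∧
      ∀ i ∈ Finset.Icc 1 t, π.msg a w i = σ i}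

/-- The average-stage LQ cost up to the horizon `T`. -/
noncomputable def cost (π : Policy R) {Ω : Type*} [MeasurableSpace Ω] (P : Measure Ω) (W : Ω → ℝ)
    (a : ℝ) (q r : ℕ → ℝ) (T : ℕ) : ℝ :=
  (1 / (T : ℝ)) * ∫ ω, (q T * π.state a (W ω) T ^ 2 +
    ∑ t ∈ Finset.Icc 1 (T - 1),
      (q t * π.state a (W ω) t ^ 2 + r t * π.control a (W ω) t ^ 2)) ∂P

end Policy

/-! ### Riccati recursion, gains and weights -/

/-- `riccatiBack a q r T j = s_{T-j}`. -/
noncomputable def riccatiBack (a : ℝ) (q r : ℕ → ℝ) (T : ℕ) : ℕ → ℝ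
  | 0 => q T
  | j + 1 =>
      q (T - (j + 1)) + riccatiBack a q r T j * r (T - (j + 1)) /
        (riccatiBack a q r T j + r (T - (j + 1))) * a ^ 2

/-- `s_t`, with `s_T = q_T` and `s_{T+1} = 0`. -/
noncomputable def riccati (a : ℝ) (q r : ℕ → ℝ) (T t : ℕ) : ℝ :=
  if t ≤ T then riccatiBack a q r T (T - t) else 0

/-- The LQR control gain `k_t`. -/
noncomputable def gain (a : ℝ) (q r : ℕ → ℝ) (T t : ℕ) : ℝ :=
  riccati a q r T (t + 1) / (riccati a q r T (t + 1) + r t) * a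

/-- The weight `g_t = s_{t+1} a² - s_t + q_t`. -/
noncomputable def gWeight (a : ℝ) (q r : ℕ → ℝ) (T t : ℕ) : ℝ :=
  riccati a q r T (t + 1) * a ^ 2 - riccati a q r T t + q t

/-- The weight `a^{2(t-1)} g_t` used by the quantizer design. -/
noncomputable def mrsqWeight (a : ℝ) (q r : ℕ → ℝ) (T t : ℕ) : ℝ :=
  a ^ (2 * (t - 1)) * gWeight a q r T t

/-! ### Regular multi-resolution scalar quantizers

A regular `T`-step quantizer is given by the partition levels `p 1 < … < p (N - 1)` of its last stage,
`N = 2 ^ (R 1 + … + R T)`, and the reproduction points `c t m` of stage `t ∈ {1, …, T}`,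
`m < 2 ^ (R 1 + … + R t)`.  The outermost levels are `-∞` and `+∞`; as the source lies in its support,
this is the same as putting them at the ends of the support.  Values of `p` and `c` at other arguments
are never used. -/

/-- `R 1 + … + R t`. -/
def cumRate (R : ℕ → ℕ) (t : ℕ) : ℕ := ∑ i ∈ Finset.Icc 1 t, R i

/-- `R (t+1) + … + R T`. -/
def tailRate (R : ℕ → ℕ) (T t : ℕ) : ℕ := ∑ i ∈ Finset.Ioc t T, R i

/-- The number of cells of the last stage. -/
def numCells (R : ℕ → ℕ) (T : ℕ) : ℕ := 2 ^ cumRate R T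

/-- The stage-`t` cell `m_t[ℓ] = ⌈(ℓ+1) 2^{-(R_{t+1}+…+R_T)}⌉ - 1` that contains the last-stage
cell `ℓ`, written as a floor. -/
def parent (R : ℕ → ℕ) (T t l : ℕ) : ℕ := l / 2 ^ tailRate R T t

/-- The cell `m` of stage `t`.  By nestedness its ends are the levels `m 2^{R_{t+1}+…+R_T}` and
`(m+1) 2^{R_{t+1}+…+R_T}` of the last stage. -/
def cell (R : ℕ → ℕ) (T : ℕ) (p : ℕ → ℝ) (t m : ℕ) : Set ℝ :=
  {w | (m = 0 ∨ p (m * 2 ^ tailRate R T t) ≤ w) ∧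
    (m + 1 = 2 ^ cumRate R t ∨ w < p ((m + 1) * 2 ^ tailRate R T t))}

/-- The index of the last-stage cell that contains `w`. -/
noncomputable def leafIndex (R : ℕ → ℕ) (T : ℕ) (p : ℕ → ℝ) (w : ℝ) : ℕ :=
  ((Finset.Icc 1 (numCells R T - 1)).filter fun k => p k ≤ w).card

/-- The encoder of stage `t`: the `R t` bits that single out the stage-`t` cell of `w` inside its
stage-`(t-1)` cell. -/
noncomputable def mrsqEnc (R : ℕ → ℕ) (T : ℕ) (p : ℕ → ℝ) (t : ℕ) (w : ℝ) : Fin (2 ^ R t) :=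
  ⟨parent R T t (leafIndex R T p w) % 2 ^ R t, Nat.mod_lt _ (by positivity)⟩

/-- Number of the stage-`t` cell with the indices `ℓ_1, …, ℓ_t` (entry `i` is `ℓ_{i+1}`). -/
def joinIndex (R : ℕ → ℕ) (l : ℕ → ℕ) : ℕ → ℕ
  | 0 => 0
  | t + 1 => joinIndex R l t * 2 ^ R (t + 1) + l t

/-- The decoder of stage `t`, with the convention that the description at time `0` is `0`. -/
def mrsqDec (R : ℕ → ℕ) (c : ℕ → ℕ → ℝ) (l : ℕ → ℕ) : ℕ → ℝ
  | 0 => 0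
  | t + 1 => c (t + 1) (joinIndex R l (t + 1))

/-- The quantization `Q_t(w)`. -/
noncomputable def quantize (R : ℕ → ℕ) (T : ℕ) (p : ℕ → ℝ) (c : ℕ → ℕ → ℝ) (t : ℕ) (w : ℝ) : ℝ :=
  mrsqDec R c (fun i => (mrsqEnc R T p (i + 1) w : ℕ)) t

/-- The weighted distortion `∑ g_t E (W - Q_t(W))²`. -/
noncomputable def distortion {Ω : Type*} [MeasurableSpace Ω] (P : Measure Ω) (W : Ω → ℝ)
    (R : ℕ → ℕ) (T : ℕ) (g : ℕ → ℝ) (p : ℕ → ℝ) (c : ℕ → ℕ → ℝ) : ℝ :=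
  ∑ t ∈ Finset.Icc 1 T, g t * ∫ ω, (W ω - quantize R T p c t (W ω)) ^ 2 ∂P

/-! ### The generalized Lloyd–Max algorithm -/

/-- Every last-stage cell has positive probability; in particular `p 1 < … < p (N - 1)`. -/
def IsPartition (f : ℝ → ℝ) (R : ℕ → ℕ) (T : ℕ) (p : ℕ → ℝ) : Prop :=
  ∀ l < numCells R T, 0 < ∫ x in cell R T p T l, f x

/-- The centroid condition, at every stage. -/
def IsCentroid (f : ℝ → ℝ) (R : ℕ → ℕ) (T : ℕ) (p : ℕ → ℝ) (c : ℕ → ℕ → ℝ) : Prop :=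
  ∀ t ∈ Finset.Icc 1 T, ∀ m < 2 ^ cumRate R t,
    c t m = (∫ x in cell R T p t m, x * f x) / ∫ x in cell R T p t m, f x

/-- `α_ℓ`. -/
def alphaSum (R : ℕ → ℕ) (T : ℕ) (g : ℕ → ℝ) (c : ℕ → ℕ → ℝ) (l : ℕ) : ℝ :=
  ∑ t ∈ Finset.Icc 1 T, g t * c t (parent R T t l)

/-- `β_ℓ`. -/
def betaSum (R : ℕ → ℕ) (T : ℕ) (g : ℕ → ℝ) (c : ℕ → ℕ → ℝ) (l : ℕ) : ℝ :=
  ∑ t ∈ Finset.Icc 1 T, g t * c t (parent R T t l) ^ 2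

/-- `(β_ℓ - β_i) / (2 (α_ℓ - α_i))`. -/
noncomputable def crossing (R : ℕ → ℕ) (T : ℕ) (g : ℕ → ℝ) (c : ℕ → ℕ → ℝ) (l i : ℕ) : ℝ :=
  (betaSum R T g c l - betaSum R T g c i) / (2 * (alphaSum R T g c l - alphaSum R T g c i))

/-- The weighted nearest neighbor condition: the lower end of each cell `ℓ` is the maximum of the
crossings with the `i` such that `α_i < α_ℓ`, and its upper end is the minimum of the crossings with
the `i` such that `α_i > α_ℓ` (the outermost ends are those of the support). -/
def IsWeightedNN (R : ℕ → ℕ) (T : ℕ) (g : ℕ → ℝ) (c : ℕ → ℕ → ℝ) (p : ℕ → ℝ) : Prop :=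
  (∀ l < numCells R T, 1 ≤ l →
    IsGreatest {b | ∃ i < numCells R T, alphaSum R T g c i < alphaSum R T g c l ∧
      b = crossing R T g c l i} (p l)) ∧
  (∀ l, l + 1 < numCells R T →
    IsLeast {b | ∃ i < numCells R T, alphaSum R T g c l < alphaSum R T g c i ∧
      b = crossing R T g c l i} (p (l + 1)))

/-- A run of the generalized Lloyd–Max algorithm from the initial partition `p 0`.  Iteration `n`
computes the centroids `c n` of the partition `p n`, and then the weighted nearest neighbor partition
`p (n + 1)` of `c n`; it returns `(p (n + 1), c n)`. -/
def IsGLMRun (f : ℝ → ℝ) (R : ℕ → ℕ) (T : ℕ) (g : ℕ → ℝ)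
    (p : ℕ → ℕ → ℝ) (c : ℕ → ℕ → ℕ → ℝ) : Prop :=
  ∀ n, IsPartition f R T (p n) ∧ IsCentroid f R T (p n) (c n) ∧ IsWeightedNN R T g (c n) (p (n + 1))

/-! ### The control policy built on a multi-resolution quantizer -/

/-- The state estimates computed from the descriptions `ŵ_t`:
`x̂_{t+1} = a x̂_t + u_t + a^t (ŵ_{t+1} - ŵ_t)` with `u_t = -k_t x̂_t` and `x̂_0 = 0`. -/
def estimate (a : ℝ) (k : ℕ → ℝ) (what : ℕ → ℝ) : ℕ → ℝ
  | 0 => 0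
  | t + 1 =>
      a * estimate a k what t + -k t * estimate a k what t + a ^ t * (what (t + 1) - what t)

/-- The LQR policy for the quantizer `(p, c)`: the encoder sends the quantizer index of `w_0 = x_1`,
and the controller decodes, updates the state estimate and applies `u_t = -k_t x̂_t`. -/
noncomputable def lqrPolicy (a : ℝ) (q r : ℕ → ℝ) (T : ℕ) (R : ℕ → ℕ) (p : ℕ → ℝ) (c : ℕ → ℕ → ℝ) :
    Policy R where
  enc t x := mrsqEnc R T p t (if h : 0 < t then x ⟨0, h⟩ else 0)
  dec t l :=
    -gain a q r T t *
      estimate a (gain a q r T)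
        (mrsqDec R c fun i => if h : i < t then (l ⟨i, h⟩ : ℕ) else 0) t

end LQR

/-! Completing squares with the Riccati recursion turns the cost of any policy into a constant plus
a multiple of the sum of (s_{t+1} + r_t) E(U_t + k_t X_t)². Since X_t - a^{t-1} W_0 is determined by
the transmitted indices, U_t + k_t X_t equals k_t a^{t-1} times W_0 minus an estimate computed from
these indices. The cost is thus an affine function of a weighted distortion (`Policy.cost_eq`).
Contiguous cells can be numbered along the line in agreement with the tree
(`Policy.Contiguous.exists_label`), so such a policy amounts to a monotone labeling with
reproduction points, and the LQR policy of a quantizer realizes exactly the distortion of that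
quantizer. What remains is a problem about quantizers.

Up to a common term, leaf l has at w the distortion β_l - 2 α_l w, which is a line. For fixed
reproduction points the best levels attain the lower envelope of these lines, and for fixed levels
the centroids are best. The gap between `levelCost` at the centroids and `envelopeCost` therefore
measures how far levels are from being stationary. A zero gap forces the levels to be strictly
ordered (`isStrictPartition_of_levelCost_eq`) and neighboring leaves to tie at their common level.

Uniqueness (`IsBalanced.le`) is a maximum principle. For a log-concave density, moving the ends of a
cell to the right by at most δ moves its centroid by at most δ. Let δ > 0 be the largest shift from
one balanced partition to another. At a level with this shift the balance equations force both
adjacent leaf centroids to move by exactly δ. The equality case makes the density on the shifted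
leaf proportional to that on the old one, so the other end of the leaf is shifted by δ as well. In
this way all levels are shifted by δ, with one common ratio of masses, whereas a shift to the right
enlarges the first cell and shrinks the last one.

For existence, the levels are confined to a compact box inside the support that nearest neighbor
steps preserve (`exists_isBox`, `IsBox.exists_nearest`). A minimizer in the box has gap zero,
because one more step could not improve it. Every competitor shares some box with this minimizer,
and uniqueness makes it optimal there too.

A run of the algorithm stays in one box, and its distortion decreases at each step by at least the
current gap, so the gap tends to zero. By compactness and uniqueness the gap is bounded below away
from the optimum (`IsOptimal.exists_gap`). This gives convergence, and also the stopping rule,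
because a small decrease certifies a small gap. -/

namespace LQR

/-! ### Log-concave functions -/

namespace IsLogConcave

variable {f : ℝ → ℝ}

theorem nonneg (hf : IsLogConcave f) (x : ℝ) : 0 ≤ f x := hf.1 x

theorem comp_neg (hf : IsLogConcave f) : IsLogConcave fun x => f (-x) := by
  refine ⟨fun x => hf.1 _, fun x y lam hlam => ?_⟩
  have := hf.2 (-x) (-y) lam hlam
  convert this using 2
  ring

theorem pos_of_mem_Icc (hf : IsLogConcave f) {x y z : ℝ} (hx : 0 < f x) (hy : 0 < f y)
    (hz : z ∈ Set.Icc x y) : 0 < f z := by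
  rcases eq_or_lt_of_le (hz.1.trans hz.2) with h | h
  · have : z = x := le_antisymm (h ▸ hz.2) hz.1
    rwa [this]
  · have h0 : 0 < y - x := sub_pos.2 h
    have := hf.2 y x ((z - x) / (y - x))
      ⟨div_nonneg (sub_nonneg.2 hz.1) h0.le, (div_le_one h0).2 (by linarith [hz.2])⟩
    have e : (z - x) / (y - x) * y + (1 - (z - x) / (y - x)) * x = z := by
      field_simp; ring
    rw [e] at this
    exact lt_of_lt_of_le (by positivity) this

/-- Superlevel sets of a log-concave function are intervals. -/
theorem measurable (hf : IsLogConcave f) : Measurable f := by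
  refine measurable_of_Ioi fun a => Set.OrdConnected.measurableSet ⟨?_⟩
  intro x hx y hy z hz
  simp only [Set.mem_preimage, Set.mem_Ioi] at *
  rcases lt_or_ge a 0 with ha | ha
  · exact ha.trans_le (hf.nonneg z)
  have hmin : a < min (f x) (f y) := lt_min hx hy
  have hm0 : 0 < min (f x) (f y) := ha.trans_lt hmin
  rcases eq_or_lt_of_le (hz.1.trans hz.2) with h | h
  · have : z = x := le_antisymm (h ▸ hz.2) hz.1
    rwa [this]
  · have h0 : 0 < y - x := sub_pos.2 h
    have hl0 : 0 ≤ (z - x) / (y - x) := div_nonneg (sub_nonneg.2 hz.1) h0.le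
    have hl1 : (z - x) / (y - x) ≤ 1 := (div_le_one h0).2 (by linarith [hz.2])
    have := hf.2 y x ((z - x) / (y - x)) ⟨hl0, hl1⟩
    have e : (z - x) / (y - x) * y + (1 - (z - x) / (y - x)) * x = z := by
      field_simp; ring
    rw [e] at this
    refine hmin.trans_le (le_trans ?_ this)
    calc min (f x) (f y) = min (f x) (f y) ^ ((z - x) / (y - x))
          * min (f x) (f y) ^ (1 - (z - x) / (y - x)) := by
          rw [← Real.rpow_add hm0]; simp
      _ ≤ _ := by
          exact mul_le_mul (Real.rpow_le_rpow hm0.le (min_le_right _ _) hl0)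
            (Real.rpow_le_rpow hm0.le (min_le_left _ _) (by linarith)) (by positivity)
            (Real.rpow_nonneg (hf.nonneg _) _)

/-- The likelihood ratio between a log-concave function and its translate is monotone. -/
theorem mul_shift_le (hf : IsLogConcave f) {x y δ : ℝ} (hδ : 0 ≤ δ) (hxy : x ≤ y) :
    f (y + δ) * f x ≤ f (x + δ) * f y := by
  rcases eq_or_lt_of_le (show x ≤ y + δ by linarith) with h | h
  · have h1 : δ = 0 := by linarith
    subst h1
    simp [mul_comm]
  have h0 : 0 < y + δ - x := sub_pos.2 h
  -- `x + δ` and `y` both lie between `x` and `y + δ`, with the two weights exchanged. In the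
  -- product of the two log-concavity inequalities the exponents therefore add up to one.
  set lam := δ / (y + δ - x) with hlam
  have hl0 : 0 ≤ lam := by positivity
  have hl1 : lam ≤ 1 := (div_le_one h0).2 (by linarith)
  have e0 : lam * (y + δ - x) = δ := by rw [hlam]; field_simp
  have h1 := hf.2 (y + δ) x lam ⟨hl0, hl1⟩
  have h2 := hf.2 (y + δ) x (1 - lam) ⟨by linarith, by linarith⟩
  have e1 : lam * (y + δ) + (1 - lam) * x = x + δ := by linarith
  have e2 : (1 - lam) * (y + δ) + (1 - (1 - lam)) * x = y := by linarith
  rw [e1] at h1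
  rw [e2, sub_sub_cancel] at h2
  rcases eq_or_lt_of_le (hf.nonneg (y + δ)) with h3 | h3
  · rw [← h3]; simpa using mul_nonneg (hf.nonneg _) (hf.nonneg _)
  rcases eq_or_lt_of_le (hf.nonneg x) with h4 | h4
  · rw [← h4]; simpa using mul_nonneg (hf.nonneg _) (hf.nonneg _)
  have h5 := mul_le_mul h1 h2 (by positivity) (hf.nonneg _)
  have e3 : f (y + δ) ^ lam * f x ^ (1 - lam) * (f (y + δ) ^ (1 - lam) * f x ^ lam)
      = f (y + δ) * f x := by
    calc _ = (f (y + δ) ^ lam * f (y + δ) ^ (1 - lam)) * (f x ^ lam * f x ^ (1 - lam)) := by ring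
      _ = _ := by rw [← Real.rpow_add h3, ← Real.rpow_add h4]; simp
  rwa [e3] at h5

/-- A positive log-concave function is continuous on open intervals. -/
theorem continuousAt (hf : IsLogConcave f) {x y z : ℝ} (hx : 0 < f x) (hy : 0 < f y)
    (hz : z ∈ Set.Ioo x y) : ContinuousAt f z := by
  have hpos : ∀ w ∈ Set.Ioo x y, 0 < f w := fun w hw =>
    hf.pos_of_mem_Icc hx hy (Set.Ioo_subset_Icc_self hw)
  have hconc : ConcaveOn ℝ (Set.Ioo x y) fun w => Real.log (f w) := by
    refine ⟨convex_Ioo x y, fun u hu v hv a b ha hb hab => ?_⟩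
    have hb' : b = 1 - a := by linarith
    subst hb'
    have h := hf.2 u v a ⟨ha, by linarith⟩
    have hu' := hpos u hu
    have hv' := hpos v hv
    have h' := Real.log_le_log (by positivity) h
    rw [Real.log_mul (by positivity) (by positivity), Real.log_rpow hu', Real.log_rpow hv'] at h'
    simpa [smul_eq_mul] using h'
  have hc := (hconc.continuousOn isOpen_Ioo).continuousAt (isOpen_Ioo.mem_nhds hz)
  have he : f =ᶠ[𝓝 z] fun w => Real.exp (Real.log (f w)) := by
    filter_upwards [isOpen_Ioo.mem_nhds hz] with w hw
    rw [Real.exp_log (hpos w hw)]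
  exact (Real.continuous_exp.continuousAt.comp hc).congr he.symm

theorem exists_pos (hf : IsLogConcave f) (h1 : ∫ x, f x = 1) : ∃ x, 0 < f x := by
  by_contra! h
  have : f = fun _ => 0 := funext fun x => le_antisymm (h x) (hf.nonneg x)
  rw [this] at h1
  simp at h1

/-- An integrable log-concave function has an exponentially decaying right tail. -/
theorem exists_tail (hf : IsLogConcave f) (hint : Integrable f) (h1 : ∫ x, f x = 1) :
    ∃ x₁ κ C : ℝ, 0 < κ ∧ ∀ x, x₁ ≤ x → f x ≤ C * Real.exp (-κ * x) := by
  obtain ⟨x₀, h0⟩ := hf.exists_pos h1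
  -- Otherwise `f` stays above a positive constant on a half-line and is not integrable.
  obtain ⟨x₁, h01, hlt⟩ : ∃ x₁, x₀ < x₁ ∧ f x₁ < f x₀ := by
    by_contra! h
    have hc : IntegrableOn (fun _ : ℝ => f x₀) (Set.Ioi x₀) := by
      refine Integrable.mono' (hint.integrableOn (s := Set.Ioi x₀))
        aestronglyMeasurable_const ?_
      filter_upwards [ae_restrict_mem measurableSet_Ioi] with x hx
      rw [Real.norm_of_nonneg h0.le]
      exact h x hx
    rw [integrableOn_const_iff] at hc
    rcases hc with hc | hc
    · exact h0.ne' (by simpa using hc)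
    · simp at hc
  rcases eq_or_lt_of_le (hf.nonneg x₁) with hz | hz
  -- Once `f` has dropped to zero it cannot become positive again, so the constant 0 serves with any
  -- rate.
  · refine ⟨x₁, 1, 0, one_pos, fun x hx => ?_⟩
    rw [zero_mul]
    by_contra! hpos
    have := hf.pos_of_mem_Icc h0 hpos (z := x₁) ⟨h01.le, hx⟩
    exact this.ne hz
  · set κ := (Real.log (f x₀) - Real.log (f x₁)) / (x₁ - x₀) with hκ
    have hd : 0 < x₁ - x₀ := sub_pos.2 h01
    refine ⟨x₁, κ, f x₀ * Real.exp (κ * x₀), div_pos (sub_pos.2 (Real.log_lt_log hz hlt)) hd,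
      fun x hx => ?_⟩
    rcases eq_or_lt_of_le (hf.nonneg x) with hx0 | hx0
    · rw [← hx0]; positivity
    have hxd : 0 < x - x₀ := by linarith
    -- `x₁` is a convex combination of `x₀` and `x`, so to the right of `x₁` the logarithm of `f`
    -- lies below the extended chord through `x₀` and `x₁`, whose slope is `-κ`.
    have h := hf.2 x x₀ ((x₁ - x₀) / (x - x₀)) ⟨by positivity, (div_le_one hxd).2 (by linarith)⟩
    have e : (x₁ - x₀) / (x - x₀) * x + (1 - (x₁ - x₀) / (x - x₀)) * x₀ = x₁ := by
      field_simp; ring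
    rw [e] at h
    have h' := Real.log_le_log (by positivity) h
    rw [Real.log_mul (by positivity) (by positivity), Real.log_rpow hx0, Real.log_rpow h0] at h'
    have h2 : Real.log (f x) ≤ Real.log (f x₀) - κ * (x - x₀) := by
      have h3 : (x₁ - x₀) / (x - x₀) * (Real.log (f x) - Real.log (f x₀))
          ≤ Real.log (f x₁) - Real.log (f x₀) := by linarith
      rw [div_mul_eq_mul_div, div_le_iff₀ hxd] at h3
      have h4 : κ * (x₁ - x₀) = Real.log (f x₀) - Real.log (f x₁) := by
        rw [hκ]; field_simp
      have h5 : (x₁ - x₀) * (Real.log (f x) - Real.log (f x₀))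
          ≤ (x₁ - x₀) * (-(κ * (x - x₀))) := by
        refine h3.trans (le_of_eq ?_)
        rw [← neg_sub, ← h4]; ring
      have := le_of_mul_le_mul_left h5 hd
      linarith
    calc f x = Real.exp (Real.log (f x)) := (Real.exp_log hx0).symm
      _ ≤ Real.exp (Real.log (f x₀) - κ * (x - x₀)) := Real.exp_le_exp.2 h2
      _ = f x₀ * Real.exp (κ * x₀) * Real.exp (-κ * x) := by
        rw [show Real.log (f x₀) - κ * (x - x₀) = Real.log (f x₀) + κ * x₀ + -κ * x by ring,
          Real.exp_add, Real.exp_add, Real.exp_log h0]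

theorem exists_integrableOn_Ioi_sq (hf : IsLogConcave f) (hint : Integrable f)
    (h1 : ∫ x, f x = 1) : ∃ b, IntegrableOn (fun x => x ^ 2 * f x) (Set.Ioi b) := by
  obtain ⟨x₁, κ, C, hκ, h⟩ := hf.exists_tail hint h1
  refine ⟨x₁, ?_⟩
  have hi : IntegrableOn (fun x : ℝ => x ^ 2 * Real.exp (-κ * x)) (Set.Ioi x₁) := by
    -- Half of the decay rate is spent on absorbing the square.
    refine integrable_of_isBigO_exp_neg (b := κ / 2) (by positivity) (by fun_prop) ?_
    have ho := (isLittleO_pow_exp_pos_mul_atTop 2 (show 0 < κ / 2 by positivity)).isBigO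
    have := ho.mul (Asymptotics.isBigO_refl (fun x : ℝ => Real.exp (-κ * x)) atTop)
    refine this.congr_right fun x => ?_
    rw [← Real.exp_add]
    congr 1
    ring
  refine Integrable.mono' (hi.const_mul C)
    (((measurable_id.pow_const 2).mul hf.measurable).aestronglyMeasurable) ?_
  filter_upwards [ae_restrict_mem measurableSet_Ioi] with x hx
  rw [Real.norm_of_nonneg (mul_nonneg (sq_nonneg _) (hf.nonneg x))]
  have := mul_le_mul_of_nonneg_left (h x (le_of_lt hx)) (sq_nonneg x)
  linarith

/-- The right tail decays exponentially, the left tail is the right tail of the reflected density,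
and the square is bounded in between. This is why the source needs no moment assumption. -/
theorem integrable_sq_mul (hf : IsLogConcave f) (hint : Integrable f) (h1 : ∫ x, f x = 1) :
    Integrable fun x => x ^ 2 * f x := by
  obtain ⟨b, hb⟩ := hf.exists_integrableOn_Ioi_sq hint h1
  obtain ⟨b', hb'⟩ := hf.comp_neg.exists_integrableOn_Ioi_sq hint.comp_neg
    ((integral_neg_eq_self f volume).trans h1)
  have hb'' : IntegrableOn (fun x => x ^ 2 * f x) (Set.Iio (-b')) := by
    have := (Measure.measurePreserving_neg (volume : Measure ℝ)).integrableOn_comp_preimage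
      (Homeomorph.neg ℝ).measurableEmbedding (f := fun x => x ^ 2 * f x) (s := Set.Iio (-b'))
    have e : (Neg.neg : ℝ → ℝ) ⁻¹' Set.Iio (-b') = Set.Ioi b' := by
      ext x
      change -x < -b' ↔ b' < x
      exact neg_lt_neg_iff
    rw [← this, e]
    refine hb'.congr_fun (fun x _ => ?_) measurableSet_Ioi
    simp
  have hmid : IntegrableOn (fun x => x ^ 2 * f x) (Set.Icc (-b') b) := by
    refine Integrable.mono' ((hint.integrableOn (s := Set.Icc (-b') b)).const_mul
      (b' ^ 2 + b ^ 2)) (((measurable_id.pow_const 2).mul hf.measurable).aestronglyMeasurable) ?_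
    filter_upwards [ae_restrict_mem measurableSet_Icc] with x hx
    rw [Real.norm_of_nonneg (mul_nonneg (sq_nonneg _) (hf.nonneg x))]
    refine mul_le_mul_of_nonneg_right ?_ (hf.nonneg x)
    rcases le_total 0 x with h | h
    · nlinarith [hx.2, sq_nonneg b']
    · nlinarith [hx.1, sq_nonneg b]
  rw [← integrableOn_univ]
  refine ((hb.union hb'').union hmid).mono_set fun x _ => ?_
  by_cases h2 : b < x
  · exact Or.inl (Or.inl h2)
  by_cases h3 : x < -b'
  · exact Or.inl (Or.inr h3)
  · exact Or.inr ⟨not_lt.1 h3, not_lt.1 h2⟩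

end IsLogConcave

/-- A log-concave probability density. -/
structure IsLogConcaveDensity (f : ℝ → ℝ) : Prop where
  logConcave : IsLogConcave f
  integrable : Integrable f
  integral_eq_one : ∫ x, f x = 1

namespace IsLogConcaveDensity

variable {f : ℝ → ℝ}

theorem of_map_eq {Ω : Type*} [MeasurableSpace Ω] (P : Measure Ω) [IsProbabilityMeasure P]
    {W : Ω → ℝ} (hWmeas : Measurable W) (hf : IsLogConcave f)
    (hW : P.map W = volume.withDensity fun x => ENNReal.ofReal (f x)) :
    IsLogConcaveDensity f := by
  have h : ∫⁻ x, ENNReal.ofReal (f x) = 1 := by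
    have h1 : (P.map W) Set.univ = 1 := by
      rw [Measure.map_apply hWmeas MeasurableSet.univ]; simp
    rw [hW, withDensity_apply _ MeasurableSet.univ] at h1
    simpa using h1
  refine ⟨hf, ⟨hf.measurable.aestronglyMeasurable, ?_⟩, ?_⟩
  · rw [hasFiniteIntegral_iff_ofReal (Eventually.of_forall hf.nonneg), h]
    exact ENNReal.one_lt_top
  · rw [integral_eq_lintegral_of_nonneg_ae (Eventually.of_forall hf.nonneg)
      hf.measurable.aestronglyMeasurable, h]
    simp

theorem nonneg (hf : IsLogConcaveDensity f) (x : ℝ) : 0 ≤ f x := hf.logConcave.nonneg x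

theorem integrable_sq_mul (hf : IsLogConcaveDensity f) : Integrable fun x => x ^ 2 * f x :=
  hf.logConcave.integrable_sq_mul hf.integrable hf.integral_eq_one

theorem integrable_mul (hf : IsLogConcaveDensity f) : Integrable fun x => x * f x := by
  refine Integrable.mono' (hf.integrable.add hf.integrable_sq_mul)
    ((measurable_id.mul hf.logConcave.measurable).aestronglyMeasurable) (ae_of_all _ fun x => ?_)
  have h : |x| ≤ 1 + x ^ 2 := abs_le.2 ⟨by nlinarith [sq_nonneg (x + 1)], by nlinarith [sq_nonneg (x - 1)]⟩
  have := mul_le_mul_of_nonneg_right h (hf.nonneg x)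
  simp only [norm_mul, Real.norm_eq_abs, abs_of_nonneg (hf.nonneg x), Pi.add_apply]
  linarith

end IsLogConcaveDensity

/-! ### Centroids and likelihood ratios -/

section LikelihoodRatio

variable {f g : ℝ → ℝ}

/-- The comparison of the means of `f` and `g` is symmetrized into a double integral. Its integrand
has a sign as soon as `g / f` is monotone, since both factors then change sign together. -/
theorem integral_prod_likelihoodRatio (hf : Integrable f) (hg : Integrable g)
    (hf1 : Integrable fun x => x * f x) (hg1 : Integrable fun x => x * g x) :
    Integrable (fun z : ℝ × ℝ => (z.2 - z.1) * (g z.1 * f z.2 - g z.2 * f z.1))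
        (volume.prod volume) ∧
      ∫ z : ℝ × ℝ, (z.2 - z.1) * (g z.1 * f z.2 - g z.2 * f z.1) ∂(volume.prod volume)
        = 2 * ((∫ x, g x) * (∫ x, x * f x) - (∫ x, x * g x) * ∫ x, f x) := by
  have i1 := hg.mul_prod hf1
  have i2 := hf.mul_prod hg1
  have i3 := hg1.mul_prod hf
  have i4 := hf1.mul_prod hg
  have e : (fun z : ℝ × ℝ => (z.2 - z.1) * (g z.1 * f z.2 - g z.2 * f z.1))
      = fun z => g z.1 * (z.2 * f z.2) - f z.1 * (z.2 * g z.2) - z.1 * g z.1 * f z.2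
        + z.1 * f z.1 * g z.2 := by
    funext z; ring
  rw [e]
  refine ⟨((i1.sub i2).sub i3).add i4, ?_⟩
  have j1 := integral_add ((i1.sub i2).sub i3) i4
  have j2 := integral_sub (i1.sub i2) i3
  have j3 := integral_sub i1 i2
  simp only [Pi.sub_apply] at j1 j2 j3
  have k1 := integral_prod_mul (μ := volume) (ν := volume) g fun x => x * f x
  have k2 := integral_prod_mul (μ := volume) (ν := volume) f fun x => x * g x
  have k3 := integral_prod_mul (μ := volume) (ν := volume) (fun x => x * g x) f
  have k4 := integral_prod_mul (μ := volume) (ν := volume) (fun x => x * f x) g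
  rw [j1, j2, j3, k1, k2, k3, k4]
  ring

/-- Chebyshev's inequality: a smaller likelihood ratio gives a smaller mean. -/
theorem mom_mul_le_of_likelihoodRatio (hf : Integrable f) (hg : Integrable g)
    (hf1 : Integrable fun x => x * f x) (hg1 : Integrable fun x => x * g x)
    (h : ∀ x y, x ≤ y → g y * f x ≤ g x * f y) :
    (∫ x, x * g x) * ∫ x, f x ≤ (∫ x, g x) * ∫ x, x * f x := by
  obtain ⟨-, h2⟩ := integral_prod_likelihoodRatio hf hg hf1 hg1
  have h3 : 0 ≤ ∫ z : ℝ × ℝ, (z.2 - z.1) * (g z.1 * f z.2 - g z.2 * f z.1)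
      ∂(volume.prod volume) := by
    refine integral_nonneg fun z => ?_
    rcases le_total z.1 z.2 with hz | hz
    · exact mul_nonneg (sub_nonneg.2 hz) (sub_nonneg.2 (h _ _ hz))
    · refine mul_nonneg_of_nonpos_of_nonpos (sub_nonpos.2 hz) (sub_nonpos.2 ?_)
      exact h _ _ hz
  linarith

/-- Equality case of Chebyshev's inequality: a nonnegative integrand with integral zero vanishes
almost everywhere, and integrating out one of the two variables leaves the proportionality. -/
theorem ae_proportional_of_likelihoodRatio (hf : Integrable f) (hg : Integrable g)
    (hf1 : Integrable fun x => x * f x) (hg1 : Integrable fun x => x * g x)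
    (h : ∀ x y, x ≤ y → g y * f x ≤ g x * f y)
    (heq : (∫ x, x * g x) * ∫ x, f x = (∫ x, g x) * ∫ x, x * f x) :
    ∀ᵐ x, (∫ y, f y) * g x = (∫ y, g y) * f x := by
  obtain ⟨h1, h2⟩ := integral_prod_likelihoodRatio hf hg hf1 hg1
  have h3 : 0 ≤ fun z : ℝ × ℝ => (z.2 - z.1) * (g z.1 * f z.2 - g z.2 * f z.1) := by
    intro z
    rcases le_total z.1 z.2 with hz | hz
    · exact mul_nonneg (sub_nonneg.2 hz) (sub_nonneg.2 (h _ _ hz))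
    · refine mul_nonneg_of_nonpos_of_nonpos (sub_nonpos.2 hz) (sub_nonpos.2 ?_)
      exact h _ _ hz
  rw [heq, sub_self, mul_zero, integral_eq_zero_iff_of_nonneg h3 h1] at h2
  have h4 := Measure.ae_ae_of_ae_prod h2
  filter_upwards [h4] with x hx
  have h5 : ∀ᵐ y, f y * g x = g y * f x := by
    filter_upwards [hx, Measure.ae_ne volume x] with y hy hne
    have : y - x ≠ 0 := sub_ne_zero.2 hne
    have := (mul_eq_zero.1 hy).resolve_left this
    linarith
  rw [← integral_mul_const, ← integral_mul_const]
  exact integral_congr_ae h5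

end LikelihoodRatio

/-- The probability of a set. -/
noncomputable def mass (f : ℝ → ℝ) (A : Set ℝ) : ℝ := ∫ x in A, f x

/-- The first moment on a set. -/
noncomputable def mom (f : ℝ → ℝ) (A : Set ℝ) : ℝ := ∫ x in A, x * f x

/-- The centroid of a set. -/
noncomputable def cen (f : ℝ → ℝ) (A : Set ℝ) : ℝ := mom f A / mass f A

/-- `B` lies to the left of the translate `A + δ` in the strong set order. -/
def ShiftLE (δ : ℝ) (B A : Set ℝ) : Prop :=
  ∀ x ∈ A, ∀ y ∈ B, x + δ ≤ y → x + δ ∈ B ∧ y - δ ∈ A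

namespace IsLogConcaveDensity

variable {f : ℝ → ℝ}

theorem mass_nonneg (hf : IsLogConcaveDensity f) (A : Set ℝ) : 0 ≤ mass f A :=
  integral_nonneg fun x => hf.nonneg x

theorem mass_mono (hf : IsLogConcaveDensity f) {A B : Set ℝ} (h : A ⊆ B) :
    mass f A ≤ mass f B :=
  setIntegral_mono_set hf.integrable.integrableOn (ae_of_all _ hf.nonneg) (ae_of_all _ h)

theorem mass_univ (hf : IsLogConcaveDensity f) : mass f Set.univ = 1 := by
  simp [mass, hf.integral_eq_one]

theorem mass_compl (hf : IsLogConcaveDensity f) {A : Set ℝ} (hA : MeasurableSet A) :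
    mass f Aᶜ = 1 - mass f A := by
  rw [mass, mass, setIntegral_compl hA hf.integrable, hf.integral_eq_one]

theorem exists_mem_pos_of_mass_pos {A : Set ℝ} (hA : MeasurableSet A)
    (h : 0 < mass f A) : ∃ x ∈ A, 0 < f x := by
  by_contra! hn
  exact absurd (setIntegral_nonpos hA hn) (not_le.2 h)

/-- A positive mass forces `u < cen A` for sets to the right of `u`. -/
theorem lt_cen (hf : IsLogConcaveDensity f) {A : Set ℝ} (hA : MeasurableSet A) {u : ℝ}
    (hu : ∀ x ∈ A, u ≤ x) (h : 0 < mass f A) : u < cen f A := by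
  rw [cen, lt_div_iff₀ h, ← sub_pos]
  have e : mom f A - u * mass f A = ∫ x in A, (x - u) * f x := by
    rw [mom, mass, ← integral_const_mul, ← integral_sub hf.integrable_mul.integrableOn
      (hf.integrable.integrableOn.const_mul u)]
    congr 1; ext x; ring
  have hi : IntegrableOn (fun x => (x - u) * f x) A := by
    have := (hf.integrable_mul.sub (hf.integrable.const_mul u)).integrableOn (s := A)
    refine this.congr_fun (fun x _ => ?_) hA
    simp only [Pi.sub_apply]; ring
  rw [e]
  have hnn : ∀ᵐ x ∂(volume.restrict A), 0 ≤ (x - u) * f x := by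
    filter_upwards [ae_restrict_mem hA] with x hx
    exact mul_nonneg (sub_nonneg.2 (hu x hx)) (hf.nonneg x)
  refine lt_of_le_of_ne (integral_nonneg_of_ae hnn) fun h0 => ?_
  have h1 := (integral_eq_zero_iff_of_nonneg_ae hnn hi).1 h0.symm
  have h2 : f =ᵐ[volume.restrict A] 0 := by
    filter_upwards [h1, ae_restrict_of_ae (Measure.ae_ne volume u)] with x hx hne
    exact (mul_eq_zero.1 hx).resolve_left (sub_ne_zero.2 hne)
  have h3 : mass f A = 0 := by rw [mass, integral_congr_ae h2]; simp
  exact h.ne' h3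

theorem cen_lt (hf : IsLogConcaveDensity f) {A : Set ℝ} (hA : MeasurableSet A) {v : ℝ}
    (hv : ∀ x ∈ A, x ≤ v) (h : 0 < mass f A) : cen f A < v := by
  rw [cen, div_lt_iff₀ h, ← sub_pos]
  have e : v * mass f A - mom f A = ∫ x in A, (v - x) * f x := by
    rw [mom, mass, ← integral_const_mul, ← integral_sub
      (hf.integrable.integrableOn.const_mul v) hf.integrable_mul.integrableOn]
    congr 1; ext x; ring
  have hi : IntegrableOn (fun x => (v - x) * f x) A := by
    have := ((hf.integrable.const_mul v).sub hf.integrable_mul).integrableOn (s := A)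
    refine this.congr_fun (fun x _ => ?_) hA
    simp only [Pi.sub_apply]; ring
  rw [e]
  have hnn : ∀ᵐ x ∂(volume.restrict A), 0 ≤ (v - x) * f x := by
    filter_upwards [ae_restrict_mem hA] with x hx
    exact mul_nonneg (sub_nonneg.2 (hv x hx)) (hf.nonneg x)
  refine lt_of_le_of_ne (integral_nonneg_of_ae hnn) fun h0 => ?_
  have h1 := (integral_eq_zero_iff_of_nonneg_ae hnn hi).1 h0.symm
  have h2 : f =ᵐ[volume.restrict A] 0 := by
    filter_upwards [h1, ae_restrict_of_ae (Measure.ae_ne volume v)] with x hx hne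
    exact (mul_eq_zero.1 hx).resolve_left (sub_ne_zero.2 hne.symm)
  have h3 : mass f A = 0 := by rw [mass, integral_congr_ae h2]; simp
  exact h.ne' h3

section Shift

variable {A B : Set ℝ} {δ : ℝ}

/-- The strong set order takes care of the indicators and `mul_shift_le` of the density, so
Chebyshev's inequality applies to restricted densities. -/
theorem indicator_likelihoodRatio (hf : IsLogConcaveDensity f) (hδ : 0 ≤ δ)
    (hAB : ShiftLE δ B A) (x y : ℝ) (hxy : x ≤ y) :
    B.indicator f (y + δ) * A.indicator f x ≤ B.indicator f (x + δ) * A.indicator f y := by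
  have hnn : 0 ≤ B.indicator f (x + δ) * A.indicator f y :=
    mul_nonneg (Set.indicator_nonneg (fun _ _ => hf.nonneg _) _)
      (Set.indicator_nonneg (fun _ _ => hf.nonneg _) _)
  by_cases hx : x ∈ A
  · by_cases hy : y + δ ∈ B
    · obtain ⟨h1, h2⟩ := hAB x hx (y + δ) hy (by linarith)
      rw [add_sub_cancel_right] at h2
      rw [Set.indicator_of_mem hx, Set.indicator_of_mem hy, Set.indicator_of_mem h1,
        Set.indicator_of_mem h2]
      exact hf.logConcave.mul_shift_le hδ hxy
    · rw [Set.indicator_of_notMem hy, zero_mul]; exact hnn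
  · rw [Set.indicator_of_notMem hx, mul_zero]; exact hnn

theorem shift_moments (hf : IsLogConcaveDensity f) (hA : MeasurableSet A) (hB : MeasurableSet B)
    (δ : ℝ) :
    Integrable (A.indicator f) ∧ Integrable (fun x => B.indicator f (x + δ)) ∧
    Integrable (fun x => x * A.indicator f x) ∧
    Integrable (fun x => x * B.indicator f (x + δ)) ∧
    ∫ x, A.indicator f x = mass f A ∧ ∫ x, B.indicator f (x + δ) = mass f B ∧
    ∫ x, x * A.indicator f x = mom f A ∧
    ∫ x, x * B.indicator f (x + δ) = mom f B - δ * mass f B := by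
  have e1 : ∀ C : Set ℝ, (fun x => x * C.indicator f x) = C.indicator fun x => x * f x := by
    intro C; funext x
    by_cases h : x ∈ C <;> simp [h]
  have iA := hf.integrable.indicator hA
  have iB := hf.integrable.indicator hB
  have iA1 := hf.integrable_mul.indicator hA
  have iB1 := hf.integrable_mul.indicator hB
  have e2 : (fun x => x * B.indicator f (x + δ))
      = fun x => (fun u => u * B.indicator f u - δ * B.indicator f u) (x + δ) := by
    funext x; ring
  have iB2 : Integrable fun u => u * B.indicator f u - δ * B.indicator f u := by
    refine Integrable.sub ?_ (iB.const_mul δ)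
    rw [e1]; exact iB1
  refine ⟨iA, iB.comp_add_right δ, by rw [e1]; exact iA1, ?_, integral_indicator hA, ?_, ?_, ?_⟩
  · rw [e2]; exact iB2.comp_add_right δ
  · rw [integral_add_right_eq_self (fun x => B.indicator f x), integral_indicator hB, mass]
  · rw [e1, integral_indicator hA, mom]
  · rw [e2, integral_add_right_eq_self (fun u => u * B.indicator f u - δ * B.indicator f u),
      integral_sub (by rw [e1]; exact iB1) (iB.const_mul δ), integral_const_mul, e1,
      integral_indicator hB, integral_indicator hB, mom, mass]

/-- Translating a set by `δ` moves its centroid by at most `δ`. -/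
theorem cen_le_add (hf : IsLogConcaveDensity f) (hδ : 0 ≤ δ) (hA : MeasurableSet A)
    (hB : MeasurableSet B) (hAB : ShiftLE δ B A) (hmA : 0 < mass f A) (hmB : 0 < mass f B) :
    cen f B ≤ cen f A + δ := by
  obtain ⟨i1, i2, i3, i4, e1, e2, e3, e4⟩ := hf.shift_moments hA hB δ
  have h := mom_mul_le_of_likelihoodRatio i1 i2 i3 i4 (hf.indicator_likelihoodRatio hδ hAB)
  rw [e1, e2, e3, e4] at h
  rw [cen, cen, div_add' _ _ _ hmA.ne', div_le_div_iff₀ hmB hmA]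
  linarith

/-- The equality case of `cen_le_add`, on which uniqueness rests. -/
theorem ae_proportional_of_cen_eq (hf : IsLogConcaveDensity f) (hδ : 0 ≤ δ)
    (hA : MeasurableSet A) (hB : MeasurableSet B) (hAB : ShiftLE δ B A) (hmA : 0 < mass f A)
    (hmB : 0 < mass f B) (heq : cen f B = cen f A + δ) :
    ∀ᵐ x, mass f A * B.indicator f (x + δ) = mass f B * A.indicator f x := by
  obtain ⟨i1, i2, i3, i4, e1, e2, e3, e4⟩ := hf.shift_moments hA hB δ
  have h := ae_proportional_of_likelihoodRatio i1 i2 i3 i4 (hf.indicator_likelihoodRatio hδ hAB)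
  rw [e1, e2, e3, e4] at h
  refine h ?_
  rw [cen, cen, div_add' _ _ _ hmA.ne', div_eq_div_iff hmB.ne' hmA.ne'] at heq
  linarith

theorem cen_mono (hf : IsLogConcaveDensity f) (hA : MeasurableSet A)
    (hB : MeasurableSet B) (hAB : ∀ x ∈ A, ∀ y ∈ B, x ≤ y → x ∈ B ∧ y ∈ A)
    (hmA : 0 < mass f A) (hmB : 0 < mass f B) : cen f B ≤ cen f A := by
  have := hf.cen_le_add (δ := 0) le_rfl hA hB (by simpa [ShiftLE] using hAB) hmA hmB
  simpa using this

end Shift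

end IsLogConcaveDensity

/-! ### Points inside the support -/

/-- A point with positive probability on both sides. -/
def IsInner (f : ℝ → ℝ) (x : ℝ) : Prop := 0 < mass f (Set.Iio x) ∧ 0 < mass f (Set.Ici x)

namespace IsLogConcaveDensity

variable {f : ℝ → ℝ}

theorem isInner_of_mem_Icc (hf : IsLogConcaveDensity f) {x y z : ℝ} (hx : IsInner f x)
    (hy : IsInner f y) (hz : z ∈ Set.Icc x y) : IsInner f z :=
  ⟨hx.1.trans_le (hf.mass_mono (Set.Iio_subset_Iio hz.1)),
    hy.2.trans_le (hf.mass_mono (Set.Ici_subset_Ici.2 hz.2))⟩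

theorem mass_Iio_add_Ici (hf : IsLogConcaveDensity f) (x : ℝ) :
    mass f (Set.Iio x) + mass f (Set.Ici x) = 1 := by
  have := hf.mass_compl (measurableSet_Iio (a := x))
  rw [Set.compl_Iio] at this
  linarith

theorem mass_Ico (hf : IsLogConcaveDensity f) {x y : ℝ} (h : x ≤ y) :
    mass f (Set.Ico x y) = mass f (Set.Iio y) - mass f (Set.Iio x) := by
  rw [mass, mass, mass, ← setIntegral_sdiff measurableSet_Iio hf.integrable.integrableOn
    (Set.Iio_subset_Iio h)]
  congr 2
  ext z; simp

theorem IsInner.exists_lt_pos {x : ℝ} (h : IsInner f x) : ∃ u < x, 0 < f u :=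
  exists_mem_pos_of_mass_pos measurableSet_Iio h.1

theorem IsInner.exists_gt_pos (h : IsInner f x) : ∃ v > x, 0 < f v := by
  have : mass f (Set.Ioi x) = mass f (Set.Ici x) := integral_Ici_eq_integral_Ioi.symm
  exact exists_mem_pos_of_mass_pos measurableSet_Ioi (this ▸ h.2)

theorem pos_of_isInner (hf : IsLogConcaveDensity f) {x : ℝ} (h : IsInner f x) : 0 < f x := by
  obtain ⟨u, hu, hu'⟩ := IsInner.exists_lt_pos h
  obtain ⟨v, hv, hv'⟩ := IsInner.exists_gt_pos h
  exact hf.logConcave.pos_of_mem_Icc hu' hv' ⟨hu.le, le_of_lt hv⟩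

theorem continuousAt_of_isInner (hf : IsLogConcaveDensity f) {x : ℝ} (h : IsInner f x) :
    ContinuousAt f x := by
  obtain ⟨u, hu, hu'⟩ := IsInner.exists_lt_pos h
  obtain ⟨v, hv, hv'⟩ := IsInner.exists_gt_pos h
  exact hf.logConcave.continuousAt hu' hv' ⟨hu, hv⟩

/-- A nonempty open interval on which `f` is positive has positive mass. -/
theorem mass_pos_of_Ioo_subset (hf : IsLogConcaveDensity f) {A : Set ℝ} {u v : ℝ}
    (huv : u < v) (hA : Set.Ioo u v ⊆ A) (hpos : ∀ x ∈ Set.Ioo u v, 0 < f x) : 0 < mass f A := by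
  refine lt_of_lt_of_le ?_ (hf.mass_mono hA)
  rw [mass, setIntegral_pos_iff_support_of_nonneg_ae (ae_of_all _ hf.nonneg)
    hf.integrable.integrableOn]
  have : Function.support f ∩ Set.Ioo u v = Set.Ioo u v :=
    Set.inter_eq_right.2 fun x hx => (hpos x hx).ne'
  rw [this, Real.volume_Ioo]
  simpa using huv

theorem mass_pos_of_isInner (hf : IsLogConcaveDensity f) {A : Set ℝ} {u v : ℝ}
    (hu : IsInner f u) (hv : IsInner f v) (huv : u < v) (hA : Set.Ioo u v ⊆ A) :
    0 < mass f A :=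
  hf.mass_pos_of_Ioo_subset huv hA fun _ hx =>
    hf.pos_of_isInner (hf.isInner_of_mem_Icc hu hv (Set.Ioo_subset_Icc_self hx))

/-- Points slightly to the left and right of an inner point are inner. -/
theorem eventually_isInner (hf : IsLogConcaveDensity f) {x : ℝ} (h : IsInner f x) :
    ∀ᶠ y in 𝓝 x, IsInner f y := by
  obtain ⟨u, hu, hu'⟩ := IsInner.exists_lt_pos h
  obtain ⟨v, hv, hv'⟩ := IsInner.exists_gt_pos h
  filter_upwards [Ioo_mem_nhds hu hv] with y hy
  have hpos : ∀ w ∈ Set.Icc u v, 0 < f w := fun w hw => hf.logConcave.pos_of_mem_Icc hu' hv' hw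
  exact ⟨hf.mass_pos_of_Ioo_subset hy.1 (fun z hz => hz.2)
      fun z hz => hpos z ⟨hz.1.le, hz.2.le.trans hy.2.le⟩,
    hf.mass_pos_of_Ioo_subset hy.2 (fun z hz => hz.1.le)
      fun z hz => hpos z ⟨hy.1.le.trans hz.1.le, hz.2.le⟩⟩

end IsLogConcaveDensity

/-! ### Cells between two levels -/

/-- The points between the levels `j` and `k`, where level `0` is `-∞` and level `N` is `∞`. -/
def slab (N : ℕ) (p : ℕ → ℝ) (j k : ℕ) : Set ℝ :=
  {w | (j = 0 ∨ p j ≤ w) ∧ (k = N ∨ w < p k)}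

/-- Weakly ordered levels inside the support. -/
structure IsWeakPartition (f : ℝ → ℝ) (N : ℕ) (p : ℕ → ℝ) : Prop where
  mono : ∀ j k, 1 ≤ j → j ≤ k → k < N → p j ≤ p k
  inner : ∀ j, 1 ≤ j → j < N → IsInner f (p j)

/-- The centroid of the cell between the levels `j` and `k`, extended continuously to degenerate
cells. -/
noncomputable def slabCen (f : ℝ → ℝ) (N : ℕ) (p : ℕ → ℝ) (j k : ℕ) : ℝ :=
  if mass f (slab N p j k) = 0 then p j else cen f (slab N p j k)

theorem measurableSet_slab (N : ℕ) (p : ℕ → ℝ) (j k : ℕ) : MeasurableSet (slab N p j k) := by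
  have e : slab N p j k = ({w | j = 0} ∪ Set.Ici (p j)) ∩ ({w | k = N} ∪ Set.Iio (p k)) := by
    ext w; simp [slab]
  rw [e]
  exact ((MeasurableSet.const _).union measurableSet_Ici).inter
    ((MeasurableSet.const _).union measurableSet_Iio)

theorem slab_congr {N : ℕ} {p p' : ℕ → ℝ} (h : ∀ l ∈ Finset.Icc 1 (N - 1), p l = p' l) {j k : ℕ}
    (hj : j < N) (hk : k ≤ N) (hk0 : 0 < k) : slab N p j k = slab N p' j k := by
  ext w
  have h1 : (j = 0 ∨ p j ≤ w) ↔ (j = 0 ∨ p' j ≤ w) := by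
    rcases Nat.eq_zero_or_pos j with h0 | h0
    · simp [h0]
    · rw [h j (Finset.mem_Icc.2 ⟨h0, by omega⟩)]
  have h2 : (k = N ∨ w < p k) ↔ (k = N ∨ w < p' k) := by
    rcases eq_or_ne k N with h0 | h0
    · simp [h0]
    · rw [h k (Finset.mem_Icc.2 ⟨hk0, by omega⟩)]
  simp only [slab, Set.mem_ofPred_eq, h1, h2]

theorem exists_mem_Ioo_of_ae {P : ℝ → Prop} (h : ∀ᵐ x, P x) {u v : ℝ} (huv : u < v) :
    ∃ x ∈ Set.Ioo u v, P x := by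
  by_contra! hn
  have h0 : volume {x | ¬ P x} = 0 := h
  have h1 : volume (Set.Ioo u v) = 0 := measure_mono_null (fun x hx => hn x hx) h0
  rw [Real.volume_Ioo] at h1
  simp at h1
  linarith

/-- Together with `eq_zero_of_frequently`, this carries an almost everywhere identity on a cell over
to an end of the cell, where the functions are continuous. -/
theorem frequently_nhdsLT_of_ae {P : ℝ → Prop} (h : ∀ᵐ x, P x) (x : ℝ) :
    ∃ᶠ y in 𝓝[<] x, P y := by
  intro hn
  obtain ⟨u, hu, hs⟩ := (mem_nhdsLT_iff_exists_Ioo_subset).1 hn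
  obtain ⟨y, hy, hy'⟩ := exists_mem_Ioo_of_ae h hu
  exact hs hy hy'

theorem frequently_nhdsGT_of_ae {P : ℝ → Prop} (h : ∀ᵐ x, P x) (x : ℝ) :
    ∃ᶠ y in 𝓝[>] x, P y := by
  intro hn
  obtain ⟨u, hu, hs⟩ := (mem_nhdsGT_iff_exists_Ioo_subset).1 hn
  obtain ⟨y, hy, hy'⟩ := exists_mem_Ioo_of_ae h hu
  exact hs hy hy'

theorem eq_zero_of_frequently {φ : ℝ → ℝ} {x : ℝ} {F : Filter ℝ} (hF : F ≤ 𝓝 x)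
    (hφ : ContinuousAt φ x) (h : ∃ᶠ y in F, φ y = 0) : φ x = 0 := by
  by_contra hne
  exact h ((hφ.mono_left hF).eventually_ne hne)

section Slab

variable {f : ℝ → ℝ} {N : ℕ} {p p' : ℕ → ℝ}

/-- Levels are inner points, so a cell that reaches `-∞` or `∞` always has mass. Only cells between
two finite levels can collapse. -/
theorem IsWeakPartition.mass_slab_pos (hf : IsLogConcaveDensity f) (hp : IsWeakPartition f N p)
    {j k : ℕ} (hjk : j < k) (hk : k ≤ N) (h : j = 0 ∨ k = N ∨ p j < p k) :
    0 < mass f (slab N p j k) := by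
  rcases Nat.eq_zero_or_pos j with hj | hj
  · rcases eq_or_ne k N with hkN | hkN
    · have : slab N p j k = Set.univ := by ext w; simp [slab, hj, hkN]
      rw [this, hf.mass_univ]; exact one_pos
    · refine (hp.inner k (by omega) (by omega)).1.trans_le (hf.mass_mono fun w hw => ?_)
      exact ⟨Or.inl hj, Or.inr hw⟩
  · rcases eq_or_ne k N with hkN | hkN
    · refine (hp.inner j hj (by omega)).2.trans_le (hf.mass_mono fun w hw => ?_)
      exact ⟨Or.inr hw, Or.inl hkN⟩
    · have hlt : p j < p k := by
        rcases h with h | h | h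
        · omega
        · exact absurd h hkN
        · exact h
      exact hf.mass_pos_of_isInner (hp.inner j hj (by omega)) (hp.inner k (by omega) (by omega))
        hlt fun w hw => ⟨Or.inr hw.1.le, Or.inr hw.2⟩

theorem mass_slab_of_eq {j k : ℕ} (hj : j ≠ 0) (hk : k ≠ N) (h : p k ≤ p j) :
    mass f (slab N p j k) = 0 := by
  have : slab N p j k = ∅ := by
    ext w
    simp only [slab, Set.mem_ofPred_eq, hj, hk, false_or, Set.mem_empty_iff_false, iff_false]
    intro hw
    linarith [hw.1, hw.2]
  simp [this, mass]

theorem slabCen_of_eq {j k : ℕ} (hj : j ≠ 0) (hk : k ≠ N) (h : p k ≤ p j) :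
    slabCen f N p j k = p j := by
  rw [slabCen, if_pos (mass_slab_of_eq hj hk h)]

theorem slabCen_of_pos {j k : ℕ} (h : 0 < mass f (slab N p j k)) :
    slabCen f N p j k = cen f (slab N p j k) := by
  rw [slabCen, if_neg h.ne']

theorem IsWeakPartition.le_slabCen (hf : IsLogConcaveDensity f) {j k : ℕ} (hj : j ≠ 0) :
    p j ≤ slabCen f N p j k := by
  unfold slabCen
  split_ifs with h
  · exact le_rfl
  · exact (hf.lt_cen (measurableSet_slab N p j k) (fun w hw => hw.1.resolve_left hj)
      (lt_of_le_of_ne (hf.mass_nonneg _) (Ne.symm h))).le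

theorem IsWeakPartition.lt_slabCen (hf : IsLogConcaveDensity f) {j k : ℕ} (hj : j ≠ 0)
    (h : 0 < mass f (slab N p j k)) : p j < slabCen f N p j k := by
  rw [slabCen_of_pos h]
  exact hf.lt_cen (measurableSet_slab N p j k) (fun w hw => hw.1.resolve_left hj) h

theorem slabCen_lt (hf : IsLogConcaveDensity f) {j k : ℕ} (hk : k ≠ N)
    (h : 0 < mass f (slab N p j k)) : slabCen f N p j k < p k := by
  rw [slabCen_of_pos h]
  exact hf.cen_lt (measurableSet_slab N p j k) (fun w hw => (hw.2.resolve_left hk).le) h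

theorem IsWeakPartition.slabCen_le (hf : IsLogConcaveDensity f) (hp : IsWeakPartition f N p)
    {j k : ℕ} (hjk : j < k) (hk : k < N) : slabCen f N p j k ≤ p k := by
  by_cases h : mass f (slab N p j k) = 0
  · rw [slabCen, if_pos h]
    have hj : j ≠ 0 := fun h0 =>
      (hp.mass_slab_pos hf hjk hk.le (Or.inl h0)).ne' h
    exact hp.mono j k (by omega) hjk.le hk
  · exact (slabCen_lt hf hk.ne (lt_of_le_of_ne (hf.mass_nonneg _) (Ne.symm h))).le

/-- Upper bounds on the shifts of the two ends suffice for the strong set order. The ends need not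
be shifted by the same amount, which is what a maximum principle requires. -/
theorem shiftLE_slab {δ : ℝ} {j k : ℕ} (hj : j ≠ 0 → p' j ≤ p j + δ)
    (hk : k ≠ N → p' k ≤ p k + δ) : ShiftLE δ (slab N p' j k) (slab N p j k) := by
  rintro x ⟨hx1, hx2⟩ y ⟨hy1, hy2⟩ hxy
  refine ⟨⟨?_, ?_⟩, ⟨?_, ?_⟩⟩
  · by_cases h : j = 0
    · exact Or.inl h
    · exact Or.inr (by linarith [hj h, hx1.resolve_left h])
  · by_cases h : k = N
    · exact Or.inl h
    · exact Or.inr (by linarith [hy2.resolve_left h])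
  · by_cases h : j = 0
    · exact Or.inl h
    · exact Or.inr (by linarith [hx1.resolve_left h])
  · by_cases h : k = N
    · exact Or.inl h
    · exact Or.inr (by linarith [hy2.resolve_left h, hk h])

end Slab

/-! ### The tree of cells -/

section Tree

variable {R : ℕ → ℕ} {T : ℕ}

theorem cumRate_add_tailRate {t : ℕ} (ht : t ≤ T) :
    cumRate R t + tailRate R T t = cumRate R T := by
  unfold cumRate tailRate
  rw [← Finset.sum_union]
  · congr 1; ext i; simp only [Finset.mem_union, Finset.mem_Icc, Finset.mem_Ioc]; omega
  · rw [Finset.disjoint_left]; intro i; simp only [Finset.mem_Icc, Finset.mem_Ioc]; omega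

theorem pow_mul_pow_eq_numCells {t : ℕ} (ht : t ≤ T) :
    2 ^ cumRate R t * 2 ^ tailRate R T t = numCells R T := by
  rw [← pow_add, cumRate_add_tailRate ht, numCells]

theorem numCells_pos : 0 < numCells R T := by unfold numCells; positivity

theorem tailRate_self : tailRate R T T = 0 := by simp [tailRate]

/-- First leaf of the stage-`t` cell of leaf `l`. -/
def blockLo (R : ℕ → ℕ) (T t l : ℕ) : ℕ := parent R T t l * 2 ^ tailRate R T t

/-- One past the last leaf of the stage-`t` cell of leaf `l`. -/
def blockHi (R : ℕ → ℕ) (T t l : ℕ) : ℕ := (parent R T t l + 1) * 2 ^ tailRate R T t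

theorem blockLo_le (t l : ℕ) : blockLo R T t l ≤ l := Nat.div_mul_le_self _ _

theorem lt_blockHi (t l : ℕ) : l < blockHi R T t l := by
  unfold blockHi parent
  exact (Nat.div_lt_iff_lt_mul (by positivity)).1 (Nat.lt_succ_self _)

theorem blockLo_lt_blockHi (t l : ℕ) : blockLo R T t l < blockHi R T t l :=
  (blockLo_le t l).trans_lt (lt_blockHi t l)

theorem parent_lt {t l : ℕ} (ht : t ≤ T) (hl : l < numCells R T) :
    parent R T t l < 2 ^ cumRate R t := by
  unfold parent
  rw [Nat.div_lt_iff_lt_mul (by positivity), pow_mul_pow_eq_numCells ht]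
  exact hl

theorem blockHi_le {t l : ℕ} (ht : t ≤ T) (hl : l < numCells R T) :
    blockHi R T t l ≤ numCells R T := by
  rw [← pow_mul_pow_eq_numCells ht]
  exact Nat.mul_le_mul_right _ (parent_lt ht hl)

theorem parent_mono (t : ℕ) {i l : ℕ} (h : i ≤ l) : parent R T t i ≤ parent R T t l :=
  Nat.div_le_div_right h

theorem blockHi_le_blockLo {t i l : ℕ} (h : i ≤ l) (hne : parent R T t i ≠ parent R T t l) :
    blockHi R T t i ≤ blockLo R T t l :=
  Nat.mul_le_mul_right _ (Nat.succ_le_of_lt (lt_of_le_of_ne (parent_mono t h) hne))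

theorem parent_eq_of_mem {t i l : ℕ} (h1 : blockLo R T t l ≤ i) (h2 : i < blockHi R T t l) :
    parent R T t i = parent R T t l := by
  unfold parent blockLo blockHi at *
  exact Nat.div_eq_of_lt_le h1 h2

theorem parent_of_tailRate_eq_zero {t : ℕ} (h : tailRate R T t = 0) (l : ℕ) :
    parent R T t l = l := by simp [parent, h]

theorem tailRate_anti {t t' : ℕ} (h : t ≤ t') : tailRate R T t' ≤ tailRate R T t :=
  Finset.sum_le_sum_of_subset (Finset.Ioc_subset_Ioc_left h)

theorem parent_parent {t t' : ℕ} (h : t ≤ t') (l : ℕ) :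
    parent R T t l = parent R T t' l / 2 ^ (tailRate R T t - tailRate R T t') := by
  unfold parent
  rw [Nat.div_div_eq_div_mul, ← pow_add, Nat.add_sub_cancel' (tailRate_anti h)]

theorem parent_eq_of_le {t t' i l : ℕ} (h : t ≤ t') (he : parent R T t' i = parent R T t' l) :
    parent R T t i = parent R T t l := by
  rw [parent_parent h, parent_parent h, he]

theorem cell_eq_slab {p : ℕ → ℝ} {t m : ℕ} (ht : t ≤ T) :
    cell R T p t m = slab (numCells R T) p (m * 2 ^ tailRate R T t)
      ((m + 1) * 2 ^ tailRate R T t) := by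
  ext w
  have h1 : m * 2 ^ tailRate R T t = 0 ↔ m = 0 := by simp
  have h2 : (m + 1) * 2 ^ tailRate R T t = numCells R T ↔ m + 1 = 2 ^ cumRate R t := by
    rw [← pow_mul_pow_eq_numCells ht]
    exact ⟨fun h => Nat.eq_of_mul_eq_mul_right (by positivity) h, fun h => by rw [h]⟩
  simp only [cell, slab, Set.mem_ofPred_eq, h1, h2]

theorem cell_leaf_eq_slab {p : ℕ → ℝ} {l : ℕ} :
    cell R T p T l = slab (numCells R T) p l (l + 1) := by
  rw [cell_eq_slab le_rfl, tailRate_self]; simp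

end Tree

/-- The centroids of a partition, extended continuously to degenerate cells. -/
noncomputable def cenBook (f : ℝ → ℝ) (R : ℕ → ℕ) (T : ℕ) (p : ℕ → ℝ) (t m : ℕ) : ℝ :=
  slabCen f (numCells R T) p (m * 2 ^ tailRate R T t) ((m + 1) * 2 ^ tailRate R T t)

/-- The weighted distortion of leaf `l` at `w`, without the part that all leaves share. -/
noncomputable def leafLine (R : ℕ → ℕ) (T : ℕ) (g : ℕ → ℝ) (c : ℕ → ℕ → ℝ) (l : ℕ) (w : ℝ) : ℝ :=
  betaSum R T g c l - 2 * alphaSum R T g c l * w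

/-- Neighboring leaves have the same weighted distortion at their common level. -/
def IsBalanced (R : ℕ → ℕ) (T : ℕ) (g : ℕ → ℝ) (c : ℕ → ℕ → ℝ) (p : ℕ → ℝ) : Prop :=
  ∀ l, 1 ≤ l → l < numCells R T → leafLine R T g c (l - 1) (p l) = leafLine R T g c l (p l)

/-- Nonnegative weights such that, unless there is only one leaf, some stage of positive weight
resolves all leaves. -/
structure IsWeight (R : ℕ → ℕ) (T : ℕ) (g : ℕ → ℝ) : Prop where
  nonneg : ∀ t ∈ Finset.Icc 1 T, 0 ≤ g t
  exists_leaf : 1 < numCells R T → ∃ t ∈ Finset.Icc 1 T, 0 < g t ∧ tailRate R T t = 0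

/-- Each stage contributes a difference of two squared errors, factored. Stages in which the two
leaves share a cell drop out, and in the others the sign depends on the side of the midpoint of the
two reproduction points on which `y` lies. -/
theorem leafLine_sub (R : ℕ → ℕ) (T : ℕ) (g : ℕ → ℝ) (c : ℕ → ℕ → ℝ) (i l : ℕ) (y : ℝ) :
    leafLine R T g c i y - leafLine R T g c l y =
      ∑ t ∈ Finset.Icc 1 T, g t * ((c t (parent R T t l) - c t (parent R T t i)) *
        (2 * y - c t (parent R T t l) - c t (parent R T t i))) := by
  unfold leafLine alphaSum betaSum
  rw [mul_assoc, mul_assoc, Finset.sum_mul, Finset.sum_mul, Finset.mul_sum, Finset.mul_sum,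
    ← Finset.sum_sub_distrib, ← Finset.sum_sub_distrib, ← Finset.sum_sub_distrib]
  refine Finset.sum_congr rfl fun t _ => ?_
  ring

/-! ### Order of the centroids and of the slopes -/

section CenBook

variable {f : ℝ → ℝ} {R : ℕ → ℕ} {T : ℕ} {p : ℕ → ℝ} {g : ℕ → ℝ}

theorem cenBook_parent (t l : ℕ) : cenBook f R T p t (parent R T t l) =
    slabCen f (numCells R T) p (blockLo R T t l) (blockHi R T t l) := rfl

theorem cenBook_leaf {t : ℕ} (h : tailRate R T t = 0) (l : ℕ) :
    cenBook f R T p t (parent R T t l) = slabCen f (numCells R T) p l (l + 1) := by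
  simp [cenBook, parent, h]

theorem cenBook_le_level (hf : IsLogConcaveDensity f) (hp : IsWeakPartition f (numCells R T) p)
    {t l k : ℕ} (hk : blockHi R T t l ≤ k) (hkN : k < numCells R T) :
    cenBook f R T p t (parent R T t l) ≤ p k := by
  rw [cenBook_parent]
  have h := blockLo_lt_blockHi (R := R) (T := T) t l
  exact (hp.slabCen_le hf h (by omega)).trans (hp.mono _ _ (by omega) hk hkN)

theorem level_le_cenBook (hf : IsLogConcaveDensity f) (hp : IsWeakPartition f (numCells R T) p)
    {t l k : ℕ} (hk : k ≤ blockLo R T t l) (hk0 : 1 ≤ k) (hl : l < numCells R T) :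
    p k ≤ cenBook f R T p t (parent R T t l) := by
  rw [cenBook_parent]
  have h := blockLo_le (R := R) (T := T) t l
  exact (hp.mono _ _ hk0 hk (by omega)).trans (IsWeakPartition.le_slabCen hf (by omega))

theorem cenBook_mono (hf : IsLogConcaveDensity f) (hp : IsWeakPartition f (numCells R T) p)
    (t : ℕ) {i l : ℕ} (h : i ≤ l) (hl : l < numCells R T) :
    cenBook f R T p t (parent R T t i) ≤ cenBook f R T p t (parent R T t l) := by
  by_cases he : parent R T t i = parent R T t l
  · rw [he]
  · have h1 := blockHi_le_blockLo h he
    have h2 := blockLo_le (R := R) (T := T) t l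
    have h3 := lt_blockHi (R := R) (T := T) t i
    exact (cenBook_le_level hf hp le_rfl (by omega)).trans
      (level_le_cenBook hf hp h1 (by omega) hl)

theorem alphaSum_mono (hf : IsLogConcaveDensity f) (hp : IsWeakPartition f (numCells R T) p)
    (hg : IsWeight R T g) {i l : ℕ} (h : i ≤ l) (hl : l < numCells R T) :
    alphaSum R T g (cenBook f R T p) i ≤ alphaSum R T g (cenBook f R T p) l :=
  Finset.sum_le_sum fun t ht =>
    mul_le_mul_of_nonneg_left (cenBook_mono hf hp t h hl) (hg.nonneg t ht)

/-- Strictly ordered levels inside the support. -/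
structure IsStrictPartition (f : ℝ → ℝ) (N : ℕ) (p : ℕ → ℝ) : Prop extends
    IsWeakPartition f N p where
  lt_succ : ∀ j, 1 ≤ j → j + 1 < N → p j < p (j + 1)

theorem IsStrictPartition.mass_pos (hf : IsLogConcaveDensity f) {N : ℕ}
    (hp : IsStrictPartition f N p) {j k : ℕ} (hjk : j < k) (hk : k ≤ N) :
    0 < mass f (slab N p j k) := by
  refine hp.toIsWeakPartition.mass_slab_pos hf hjk hk ?_
  by_cases h0 : j = 0
  · exact Or.inl h0
  by_cases hN : k = N
  · exact Or.inr (Or.inl hN)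
  exact Or.inr (Or.inr ((hp.lt_succ j (by omega) (by omega)).trans_le
    (hp.mono _ _ (by omega) (by omega) (by omega))))

/-- All stages are weakly monotone. Strictness comes from a stage of positive weight that resolves
the leaves, where a level separates the two centroids. -/
theorem alphaSum_strictMono (hf : IsLogConcaveDensity f)
    (hp : IsStrictPartition f (numCells R T) p)
    (hg : IsWeight R T g) {i l : ℕ} (h : i < l) (hl : l < numCells R T) :
    alphaSum R T g (cenBook f R T p) i < alphaSum R T g (cenBook f R T p) l := by
  obtain ⟨t₀, ht₀, hgt, ht0⟩ := hg.exists_leaf (by omega)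
  refine Finset.sum_lt_sum (fun t ht => mul_le_mul_of_nonneg_left
    (cenBook_mono hf hp.toIsWeakPartition t h.le hl) (hg.nonneg t ht))
    ⟨t₀, ht₀, mul_lt_mul_of_pos_left ?_ hgt⟩
  rw [cenBook_leaf ht0, cenBook_leaf ht0]
  calc _ < p (i + 1) := slabCen_lt hf (by omega) (hp.mass_pos hf (by omega) (by omega))
    _ ≤ p l := hp.mono _ _ (by omega) (by omega) (by omega)
    _ < _ := IsWeakPartition.lt_slabCen hf (by omega) (hp.mass_pos hf (by omega) (by omega))

end CenBook

/-! ### Uniqueness of balanced partitions -/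

section Uniqueness

variable {f : ℝ → ℝ} {R : ℕ → ℕ} {T : ℕ} {p p' : ℕ → ℝ} {g : ℕ → ℝ}

theorem slabCen_le_add (hf : IsLogConcaveDensity f) {N : ℕ} (hp : IsStrictPartition f N p)
    (hp' : IsStrictPartition f N p') {δ : ℝ} (hδ : 0 ≤ δ)
    (h : ∀ l, 1 ≤ l → l < N → p' l ≤ p l + δ) {j k : ℕ} (hjk : j < k) (hk : k ≤ N) :
    slabCen f N p' j k ≤ slabCen f N p j k + δ := by
  rw [slabCen_of_pos (hp.mass_pos hf hjk hk), slabCen_of_pos (hp'.mass_pos hf hjk hk)]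
  exact hf.cen_le_add hδ (measurableSet_slab _ _ _ _) (measurableSet_slab _ _ _ _)
    (shiftLE_slab (fun h0 => h _ (by omega) (by omega)) (fun h0 => h _ (by omega) (by omega)))
    (hp.mass_pos hf hjk hk) (hp'.mass_pos hf hjk hk)

/-- At a level where the shift is maximal, both adjacent leaf centroids are shifted by the same
amount. -/
theorem leaf_slabCen_eq_add (hf : IsLogConcaveDensity f) (hg : IsWeight R T g)
    (hp : IsStrictPartition f (numCells R T) p) (hp' : IsStrictPartition f (numCells R T) p')
    (hb : IsBalanced R T g (cenBook f R T p) p) (hb' : IsBalanced R T g (cenBook f R T p') p')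
    {δ : ℝ} (hδ : 0 ≤ δ) (h : ∀ l, 1 ≤ l → l < numCells R T → p' l ≤ p l + δ)
    {l : ℕ} (hl1 : 1 ≤ l) (hl : l < numCells R T) (he : p' l = p l + δ) :
    slabCen f (numCells R T) p' (l - 1) (l - 1 + 1)
        = slabCen f (numCells R T) p (l - 1) (l - 1 + 1) + δ ∧
      slabCen f (numCells R T) p' l (l + 1) = slabCen f (numCells R T) p l (l + 1) + δ := by
  have hw := hp.toIsWeakPartition
  have hw' := hp'.toIsWeakPartition
  -- Since the level `l` has the full shift and no centroid moves further, the upper centroid comes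
  -- closer to the level (or keeps its distance) and the lower one recedes (or keeps its distance).
  have key : ∀ t ∈ Finset.Icc 1 T, parent R T t (l - 1) ≠ parent R T t l →
      0 ≤ cenBook f R T p' t (parent R T t l) - p' l ∧
      cenBook f R T p' t (parent R T t l) - p' l ≤ cenBook f R T p t (parent R T t l) - p l ∧
      0 ≤ p l - cenBook f R T p t (parent R T t (l - 1)) ∧
      p l - cenBook f R T p t (parent R T t (l - 1))
        ≤ p' l - cenBook f R T p' t (parent R T t (l - 1)) := by
    intro t ht hne
    have htT := (Finset.mem_Icc.1 ht).2
    have h1 := blockHi_le_blockLo (R := R) (T := T) (show l - 1 ≤ l by omega) hne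
    have h2 := blockLo_le (R := R) (T := T) t l
    have h3 := lt_blockHi (R := R) (T := T) t (l - 1)
    have a1 := level_le_cenBook hf hw' (t := t) (l := l) (k := l) (by omega) hl1 hl
    have a2 := cenBook_le_level hf hw (t := t) (l := l - 1) (k := l) (by omega) hl
    have a3 := slabCen_le_add hf hp hp' hδ h (blockLo_lt_blockHi t l) (blockHi_le htT hl)
    have a4 := slabCen_le_add hf hp hp' hδ h (blockLo_lt_blockHi t (l - 1))
      (blockHi_le htT (show l - 1 < _ by omega))
    rw [← cenBook_parent, ← cenBook_parent] at a3 a4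
    refine ⟨by linarith, by linarith, by linarith, by linarith⟩
  have hs := leafLine_sub R T g (cenBook f R T p) (l - 1) l (p l)
  have hs' := leafLine_sub R T g (cenBook f R T p') (l - 1) l (p' l)
  rw [hb l hl1 hl, sub_self] at hs
  rw [hb' l hl1 hl, sub_self] at hs'
  -- With distances u above and v below the level, the stage term is v² - u². By `key` it can only
  -- grow from `p` to `p'`. Both weighted sums vanish by balance, so no term of positive weight
  -- grows.
  have hnn : ∀ t ∈ Finset.Icc 1 T, 0 ≤
      g t * ((cenBook f R T p' t (parent R T t l) - cenBook f R T p' t (parent R T t (l - 1))) *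
        (2 * p' l - cenBook f R T p' t (parent R T t l)
          - cenBook f R T p' t (parent R T t (l - 1))))
      - g t * ((cenBook f R T p t (parent R T t l) - cenBook f R T p t (parent R T t (l - 1))) *
        (2 * p l - cenBook f R T p t (parent R T t l)
          - cenBook f R T p t (parent R T t (l - 1)))) := by
    intro t ht
    rw [← mul_sub]
    refine mul_nonneg (hg.nonneg t ht) ?_
    by_cases hne : parent R T t (l - 1) = parent R T t l
    · rw [hne]; simp
    · obtain ⟨k1, k2, k3, k4⟩ := key t ht hne
      nlinarith
  obtain ⟨t₀, ht₀, hgt, ht0⟩ := hg.exists_leaf (by omega)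
  have hz := (Finset.sum_eq_zero_iff_of_nonneg hnn).1
    (by rw [Finset.sum_sub_distrib, ← hs, ← hs', sub_self]) t₀ ht₀
  rw [← mul_sub] at hz
  have hz' := (mul_eq_zero.1 hz).resolve_left hgt.ne'
  have hne : parent R T t₀ (l - 1) ≠ parent R T t₀ l := by
    rw [parent_of_tailRate_eq_zero ht0, parent_of_tailRate_eq_zero ht0]; omega
  obtain ⟨k1, k2, k3, k4⟩ := key t₀ ht₀ hne
  rw [← cenBook_leaf (f := f) ht0, ← cenBook_leaf (f := f) ht0, ← cenBook_leaf (f := f) ht0,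
    ← cenBook_leaf (f := f) ht0]
  have q1 : cenBook f R T p' t₀ (parent R T t₀ l) - p' l
      = cenBook f R T p t₀ (parent R T t₀ l) - p l := by
    by_contra hc
    have := lt_of_le_of_ne k2 hc
    nlinarith
  have q2 : p l - cenBook f R T p t₀ (parent R T t₀ (l - 1))
      = p' l - cenBook f R T p' t₀ (parent R T t₀ (l - 1)) := by
    by_contra hc
    have := lt_of_le_of_ne k4 hc
    nlinarith
  constructor <;> linarith

theorem leaf_ae_proportional (hf : IsLogConcaveDensity f) {N : ℕ} (hp : IsStrictPartition f N p)
    (hp' : IsStrictPartition f N p') {δ : ℝ} (hδ : 0 ≤ δ)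
    (h : ∀ l, 1 ≤ l → l < N → p' l ≤ p l + δ) {l : ℕ} (hl : l < N)
    (he : slabCen f N p' l (l + 1) = slabCen f N p l (l + 1) + δ) :
    ∀ᵐ x, mass f (slab N p l (l + 1)) * (slab N p' l (l + 1)).indicator f (x + δ)
      = mass f (slab N p' l (l + 1)) * (slab N p l (l + 1)).indicator f x := by
  have m := hp.mass_pos hf (Nat.lt_succ_self l) hl
  have m' := hp'.mass_pos hf (Nat.lt_succ_self l) hl
  rw [slabCen_of_pos m, slabCen_of_pos m'] at he
  exact hf.ae_proportional_of_cen_eq hδ (measurableSet_slab _ _ _ _) (measurableSet_slab _ _ _ _)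
    (shiftLE_slab (fun h0 => h _ (by omega) (by omega)) (fun h0 => h _ (by omega) (by omega)))
    m m' he

end Uniqueness

/-! ### Spreading a maximal shift to all levels -/

section Uniqueness

variable {f : ℝ → ℝ} {R : ℕ → ℕ} {T : ℕ} {p p' : ℕ → ℝ} {g : ℕ → ℝ}

section Leaf

variable {N : ℕ} {δ : ℝ} {l : ℕ}

/-- Proportional densities vanish together. If the new end fell short of the full shift, then just
to the left of the old end the old density would be positive and the translated new one zero. -/
theorem level_right_eq_add (hf : IsLogConcaveDensity f) (hp : IsStrictPartition f N p)
    (hp' : IsStrictPartition f N p') (hl : l + 1 < N) (h : p' (l + 1) ≤ p (l + 1) + δ)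
    (hae : ∀ᵐ x, mass f (slab N p l (l + 1)) * (slab N p' l (l + 1)).indicator f (x + δ)
      = mass f (slab N p' l (l + 1)) * (slab N p l (l + 1)).indicator f x) :
    p' (l + 1) = p (l + 1) + δ := by
  by_contra hne
  have hlt : p' (l + 1) - δ < p (l + 1) := by linarith [lt_of_le_of_ne h hne]
  have e1 : ∀ᶠ x in 𝓝[<] p (l + 1), IsInner f x :=
    nhdsWithin_le_nhds (hf.eventually_isInner (hp.inner (l + 1) (by omega) hl))
  have e2 : ∀ᶠ x in 𝓝[<] p (l + 1), p' (l + 1) - δ < x :=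
    nhdsWithin_le_nhds (eventually_gt_nhds hlt)
  have e3 : ∀ᶠ x in 𝓝[<] p (l + 1), l = 0 ∨ p l ≤ x := by
    by_cases h0 : l = 0
    · exact Eventually.of_forall fun _ => Or.inl h0
    · filter_upwards [nhdsWithin_le_nhds (eventually_gt_nhds (hp.lt_succ l (by omega) hl))]
        with x hx using Or.inr (le_of_lt hx)
  obtain ⟨x, hx, ⟨⟨h1, h2⟩, h3⟩, h4⟩ := ((frequently_nhdsLT_of_ae hae (p (l + 1))).and_eventually
    (((e1.and e2).and e3).and self_mem_nhdsWithin)).exists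
  have hm : x ∈ slab N p l (l + 1) := ⟨h3, Or.inr h4⟩
  have hm' : x + δ ∉ slab N p' l (l + 1) := fun hh => by
    have := hh.2.resolve_left hl.ne
    linarith
  rw [Set.indicator_of_notMem hm', Set.indicator_of_mem hm, mul_zero] at hx
  exact (mul_pos (hp'.mass_pos hf (Nat.lt_succ_self l) hl.le) (hf.pos_of_isInner h1)).ne hx

theorem level_left_eq_add (hf : IsLogConcaveDensity f) (hp : IsStrictPartition f N p)
    (hp' : IsStrictPartition f N p') (hl1 : 1 ≤ l) (hl : l < N) (h : p' l ≤ p l + δ)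
    (hae : ∀ᵐ x, mass f (slab N p l (l + 1)) * (slab N p' l (l + 1)).indicator f (x + δ)
      = mass f (slab N p' l (l + 1)) * (slab N p l (l + 1)).indicator f x) :
    p' l = p l + δ := by
  by_contra hne
  have hlt : p' l - δ < p l := by linarith [lt_of_le_of_ne h hne]
  have hc : Tendsto (fun x => x + δ) (𝓝 (p' l - δ)) (𝓝 (p' l)) := by
    have : Tendsto (fun x => x + δ) (𝓝 (p' l - δ)) (𝓝 (p' l - δ + δ)) :=
      (continuous_id.add continuous_const).tendsto _
    rwa [sub_add_cancel] at this
  have e1 : ∀ᶠ x in 𝓝[>] (p' l - δ), IsInner f (x + δ) :=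
    nhdsWithin_le_nhds (hc.eventually (hf.eventually_isInner (hp'.inner l hl1 hl)))
  have e2 : ∀ᶠ x in 𝓝[>] (p' l - δ), x < p l := nhdsWithin_le_nhds (eventually_lt_nhds hlt)
  have e3 : ∀ᶠ x in 𝓝[>] (p' l - δ), l + 1 = N ∨ x + δ < p' (l + 1) := by
    by_cases h0 : l + 1 = N
    · exact Eventually.of_forall fun _ => Or.inl h0
    · filter_upwards [nhdsWithin_le_nhds (hc.eventually
        (eventually_lt_nhds (hp'.lt_succ l hl1 (by omega))))] with x hx using Or.inr hx
  obtain ⟨x, hx, ⟨⟨h1, h2⟩, h3⟩, h4⟩ := ((frequently_nhdsGT_of_ae hae (p' l - δ)).and_eventually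
    (((e1.and e2).and e3).and self_mem_nhdsWithin)).exists
  have h4' : p' l - δ < x := h4
  have hm : x + δ ∈ slab N p' l (l + 1) := ⟨Or.inr (by linarith), h3⟩
  have hm' : x ∉ slab N p l (l + 1) := fun hh => by
    have := hh.1.resolve_left (by omega)
    linarith
  rw [Set.indicator_of_mem hm, Set.indicator_of_notMem hm', mul_zero] at hx
  exact (mul_pos (hp.mass_pos hf (Nat.lt_succ_self l) hl) (hf.pos_of_isInner h1)).ne' hx

theorem continuousAt_density_add (hf : IsLogConcaveDensity f) {x : ℝ} (h : IsInner f (x + δ)) :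
    ContinuousAt (fun y => f (y + δ)) x :=
  ContinuousAt.comp (g := f) (f := fun y => y + δ) (hf.continuousAt_of_isInner h)
    (continuous_id.add continuous_const).continuousAt

/-- The density is continuous at inner points, so the proportionality extends to the end of the
leaf. There it can be compared with that of the next leaf, which yields a common ratio. -/
theorem density_right_eq (hf : IsLogConcaveDensity f) (hp : IsStrictPartition f N p)
    (hp' : IsStrictPartition f N p') (hl : l + 1 < N) (h : p' (l + 1) = p (l + 1) + δ)
    (hae : ∀ᵐ x, mass f (slab N p l (l + 1)) * (slab N p' l (l + 1)).indicator f (x + δ)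
      = mass f (slab N p' l (l + 1)) * (slab N p l (l + 1)).indicator f x) :
    mass f (slab N p l (l + 1)) * f (p (l + 1) + δ)
      = mass f (slab N p' l (l + 1)) * f (p (l + 1)) := by
  have i := hp.inner (l + 1) (by omega) hl
  have i' := hp'.inner (l + 1) (by omega) hl
  have e1 : ∀ᶠ x in 𝓝[<] p (l + 1), l = 0 ∨ p l ≤ x := by
    by_cases h0 : l = 0
    · exact Eventually.of_forall fun _ => Or.inl h0
    · filter_upwards [nhdsWithin_le_nhds (eventually_gt_nhds (hp.lt_succ l (by omega) hl))]
        with x hx using Or.inr (le_of_lt hx)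
  have e2 : ∀ᶠ x in 𝓝[<] p (l + 1), l = 0 ∨ p' l ≤ x + δ := by
    by_cases h0 : l = 0
    · exact Eventually.of_forall fun _ => Or.inl h0
    · have : p' l - δ < p (l + 1) := by linarith [hp'.lt_succ l (by omega) hl]
      filter_upwards [nhdsWithin_le_nhds (eventually_gt_nhds this)] with x hx
      exact Or.inr (by linarith)
  rw [h] at i'
  refine sub_eq_zero.1 (eq_zero_of_frequently (F := 𝓝[<] p (l + 1)) nhdsWithin_le_nhds
    (φ := fun x => mass f (slab N p l (l + 1)) * f (x + δ)
      - mass f (slab N p' l (l + 1)) * f x)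
    ((continuousAt_const.mul (continuousAt_density_add hf i')).sub
      (continuousAt_const.mul (hf.continuousAt_of_isInner i))) ?_)
  refine ((frequently_nhdsLT_of_ae hae (p (l + 1))).and_eventually
    ((e1.and e2).and self_mem_nhdsWithin)).mono ?_
  rintro x ⟨hx, ⟨h1, h2⟩, h3⟩
  have h3' : x < p (l + 1) := h3
  rw [Set.indicator_of_mem (show x ∈ slab N p l (l + 1) from ⟨h1, Or.inr h3⟩),
    Set.indicator_of_mem (show x + δ ∈ slab N p' l (l + 1) from ⟨h2, Or.inr (by linarith)⟩)] at hx
  exact sub_eq_zero.2 hx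

theorem density_left_eq (hf : IsLogConcaveDensity f) (hp : IsStrictPartition f N p)
    (hp' : IsStrictPartition f N p') (hl1 : 1 ≤ l) (hl : l < N) (h : p' l = p l + δ)
    (hae : ∀ᵐ x, mass f (slab N p l (l + 1)) * (slab N p' l (l + 1)).indicator f (x + δ)
      = mass f (slab N p' l (l + 1)) * (slab N p l (l + 1)).indicator f x) :
    mass f (slab N p l (l + 1)) * f (p l + δ) = mass f (slab N p' l (l + 1)) * f (p l) := by
  have i := hp.inner l hl1 hl
  have i' := hp'.inner l hl1 hl
  have e1 : ∀ᶠ x in 𝓝[>] p l, l + 1 = N ∨ x < p (l + 1) := by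
    by_cases h0 : l + 1 = N
    · exact Eventually.of_forall fun _ => Or.inl h0
    · filter_upwards [nhdsWithin_le_nhds (eventually_lt_nhds (hp.lt_succ l hl1 (by omega)))]
        with x hx using Or.inr hx
  have e2 : ∀ᶠ x in 𝓝[>] p l, l + 1 = N ∨ x + δ < p' (l + 1) := by
    by_cases h0 : l + 1 = N
    · exact Eventually.of_forall fun _ => Or.inl h0
    · have : p l < p' (l + 1) - δ := by linarith [hp'.lt_succ l hl1 (by omega)]
      filter_upwards [nhdsWithin_le_nhds (eventually_lt_nhds this)] with x hx
      exact Or.inr (by linarith)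
  rw [h] at i'
  refine sub_eq_zero.1 (eq_zero_of_frequently (F := 𝓝[>] p l) nhdsWithin_le_nhds
    (φ := fun x => mass f (slab N p l (l + 1)) * f (x + δ)
      - mass f (slab N p' l (l + 1)) * f x)
    ((continuousAt_const.mul (continuousAt_density_add hf i')).sub
      (continuousAt_const.mul (hf.continuousAt_of_isInner i))) ?_)
  refine ((frequently_nhdsGT_of_ae hae (p l)).and_eventually
    ((e1.and e2).and self_mem_nhdsWithin)).mono ?_
  rintro x ⟨hx, ⟨h1, h2⟩, h3⟩
  have h3' : p l < x := h3
  rw [Set.indicator_of_mem (show x ∈ slab N p l (l + 1) from ⟨Or.inr h3'.le, h1⟩),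
    Set.indicator_of_mem (show x + δ ∈ slab N p' l (l + 1) from ⟨Or.inr (by linarith), h2⟩)] at hx
  exact sub_eq_zero.2 hx

end Leaf

/-- Maximum principle: a positive maximal shift would be a rigid translation of all levels with a
common ratio of masses, which the first and the last cell rule out. -/
theorem IsBalanced.le (hf : IsLogConcaveDensity f) (hg : IsWeight R T g)
    (hp : IsStrictPartition f (numCells R T) p) (hp' : IsStrictPartition f (numCells R T) p')
    (hb : IsBalanced R T g (cenBook f R T p) p) (hb' : IsBalanced R T g (cenBook f R T p') p') :
    ∀ l, 1 ≤ l → l < numCells R T → p' l ≤ p l := by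
  by_contra! hcon
  obtain ⟨l₁, hl₁, hl₁N, hlt⟩ := hcon
  obtain ⟨l₀, hl₀, hmax⟩ := Finset.exists_max_image (Finset.Icc 1 (numCells R T - 1))
    (fun l => p' l - p l) ⟨l₁, Finset.mem_Icc.2 ⟨hl₁, by omega⟩⟩
  set N := numCells R T with hN
  set δ := p' l₀ - p l₀ with hδ
  have hδ0 : 0 < δ := by
    have := hmax l₁ (Finset.mem_Icc.2 ⟨hl₁, by omega⟩)
    linarith
  have hle : ∀ l, 1 ≤ l → l < N → p' l ≤ p l + δ := fun l h1 h2 => by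
    have := hmax l (Finset.mem_Icc.2 ⟨h1, by omega⟩)
    linarith
  have hprop : ∀ l, 1 ≤ l → l < N → p' l = p l + δ →
      (∀ᵐ x, mass f (slab N p (l - 1) (l - 1 + 1))
          * (slab N p' (l - 1) (l - 1 + 1)).indicator f (x + δ)
        = mass f (slab N p' (l - 1) (l - 1 + 1))
          * (slab N p (l - 1) (l - 1 + 1)).indicator f x) ∧
      ∀ᵐ x, mass f (slab N p l (l + 1)) * (slab N p' l (l + 1)).indicator f (x + δ)
        = mass f (slab N p' l (l + 1)) * (slab N p l (l + 1)).indicator f x := by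
    intro l h1 h2 he
    obtain ⟨a1, a2⟩ := leaf_slabCen_eq_add hf hg hp hp' hb hb' hδ0.le hle h1 h2 he
    exact ⟨leaf_ae_proportional hf hp hp' hδ0.le hle (by omega) a1,
      leaf_ae_proportional hf hp hp' hδ0.le hle h2 a2⟩
  have hl₀' := Finset.mem_Icc.1 hl₀
  have h0 : p' l₀ = p l₀ + δ := by rw [hδ]; ring
  -- From the level `l₀` of maximal shift, equality passes to the next level through the leaf in
  -- between, first to the right and then to the left.
  have hup : ∀ l, l₀ ≤ l → l < N → p' l = p l + δ := by
    intro l hl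
    induction l, hl using Nat.le_induction with
    | base => exact fun _ => h0
    | succ l hl ih =>
      intro hlN
      exact level_right_eq_add hf hp hp' hlN (hle _ (by omega) hlN)
        (hprop l (by omega) (by omega) (ih (by omega))).2
  have hdown : ∀ d, d < l₀ → p' (l₀ - d) = p (l₀ - d) + δ := by
    intro d
    induction d with
    | zero => exact fun _ => h0
    | succ d ih =>
      intro hd
      have := (hprop (l₀ - d) (by omega) (by omega) (ih (by omega))).1
      rw [show l₀ - d - 1 = l₀ - (d + 1) by omega] at this
      exact level_left_eq_add hf hp hp' (by omega) (by omega) (hle _ (by omega) (by omega)) this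
  have hall : ∀ l, 1 ≤ l → l < N → p' l = p l + δ := by
    intro l h1 h2
    rcases le_total l₀ l with h | h
    · exact hup l h h2
    · have := hdown (l₀ - l) (by omega)
      rwa [Nat.sub_sub_self h] at this
  have hN2 : 1 < N := by omega
  -- the proportionality constant is the same on all leaves
  have hκ : ∀ l, l < N → mass f (slab N p' l (l + 1)) * mass f (slab N p 0 1)
      = mass f (slab N p' 0 1) * mass f (slab N p l (l + 1)) := by
    intro l
    induction l with
    | zero => intro _; simp
    | succ l ih =>
      intro hl
      have ih' := ih (by omega)
      have hae := hprop (l + 1) (by omega) hl (hall _ (by omega) hl)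
      rw [Nat.add_sub_cancel] at hae
      have h1 := density_right_eq hf hp hp' hl (hall _ (by omega) hl) hae.1
      have h2 := density_left_eq hf hp hp' (by omega) hl (hall _ (by omega) hl) hae.2
      have hpos : 0 < f (p (l + 1)) := hf.pos_of_isInner (hp.inner _ (by omega) hl)
      have hpos' : 0 < f (p (l + 1) + δ) := by
        rw [← hall _ (by omega) hl]; exact hf.pos_of_isInner (hp'.inner _ (by omega) hl)
      have hm := hp.mass_pos hf (Nat.lt_succ_self l) (by omega)
      refine mul_left_cancel₀ (mul_pos hpos hm).ne' ?_
      calc f (p (l + 1)) * mass f (slab N p l (l + 1)) *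
            (mass f (slab N p' (l + 1) (l + 1 + 1)) * mass f (slab N p 0 1))
          = (mass f (slab N p' (l + 1) (l + 1 + 1)) * f (p (l + 1))) *
            (mass f (slab N p l (l + 1)) * mass f (slab N p 0 1)) := by ring
        _ = mass f (slab N p (l + 1) (l + 1 + 1)) * mass f (slab N p 0 1) *
            (mass f (slab N p l (l + 1)) * f (p (l + 1) + δ)) := by rw [← h2]; ring
        _ = f (p (l + 1)) * mass f (slab N p (l + 1) (l + 1 + 1)) *
            (mass f (slab N p' l (l + 1)) * mass f (slab N p 0 1)) := by rw [h1]; ring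
        _ = _ := by rw [ih']; ring
  have hlast := hκ (N - 1) (by omega)
  rw [show N - 1 + 1 = N by omega] at hlast
  have e0 : ∀ P : ℕ → ℝ, slab N P 0 1 = Set.Iio (P 1) := fun P => by
    ext w; simp [slab, hN2.ne]
  have eN : ∀ P : ℕ → ℝ, slab N P (N - 1) N = Set.Ici (P (N - 1)) := fun P => by
    ext w; simp [slab, show N - 1 ≠ 0 by omega]
  rw [e0, e0, eN, eN] at hlast
  -- Moving to the right, the first cell gains mass and the last one loses it, so their ratios of
  -- new to old mass cannot agree as `hlast` requires.
  have hmass : ∀ l, 1 ≤ l → l < N → mass f (Set.Iio (p l)) < mass f (Set.Iio (p' l)) := by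
    intro l h1 h2
    have hlt' : p l < p' l := by rw [hall l h1 h2]; linarith
    have := hf.mass_pos_of_isInner (hp.inner l h1 h2) (hp'.inner l h1 h2) hlt'
      (Set.Ioo_subset_Ico_self)
    rw [hf.mass_Ico hlt'.le] at this
    linarith
  have m1 := hmass 1 le_rfl hN2
  have m2 := hmass (N - 1) (by omega) (by omega)
  have s1 := hf.mass_Iio_add_Ici (p (N - 1))
  have s2 := hf.mass_Iio_add_Ici (p' (N - 1))
  have n1 := (hp.inner 1 le_rfl hN2).1
  have n2 := (hp'.inner (N - 1) (by omega) (by omega)).2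
  nlinarith

/-- There is at most one balanced partition. -/
theorem IsBalanced.unique (hf : IsLogConcaveDensity f) (hg : IsWeight R T g)
    (hp : IsStrictPartition f (numCells R T) p) (hp' : IsStrictPartition f (numCells R T) p')
    (hb : IsBalanced R T g (cenBook f R T p) p) (hb' : IsBalanced R T g (cenBook f R T p') p')
    {l : ℕ} (h1 : 1 ≤ l) (hl : l < numCells R T) : p' l = p l :=
  le_antisymm (IsBalanced.le hf hg hp hp' hb hb' l h1 hl)
    (IsBalanced.le hf hg hp' hp hb' hb l h1 hl)

end Uniqueness

/-! ### The weighted distortion as a function of levels and reproduction points -/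

section SlabIntegral

variable {f : ℝ → ℝ} {N : ℕ} {p : ℕ → ℝ}

theorem IsWeakPartition.setIntegral_slab_add (hp : IsWeakPartition f N p) {h : ℝ → ℝ}
    (hh : Integrable h) {j k m : ℕ} (hjk : j < k) (hkm : k < m) (hm : m ≤ N) :
    ∫ x in slab N p j m, h x = (∫ x in slab N p j k, h x) + ∫ x in slab N p k m, h x := by
  rw [← setIntegral_union ?_ (measurableSet_slab _ _ _ _) hh.integrableOn hh.integrableOn]
  · congr 2
    ext w
    simp only [slab, Set.mem_ofPred_eq, Set.mem_union]
    constructor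
    · rintro ⟨h1, h2⟩
      rcases lt_or_ge w (p k) with hw | hw
      · exact Or.inl ⟨h1, Or.inr hw⟩
      · exact Or.inr ⟨Or.inr hw, h2⟩
    · rintro (⟨h1, h2⟩ | ⟨h1, h2⟩)
      · refine ⟨h1, ?_⟩
        by_cases hN : m = N
        · exact Or.inl hN
        · exact Or.inr ((h2.resolve_left (by omega)).trans_le
            (hp.mono k m (by omega) hkm.le (by omega)))
      · refine ⟨?_, h2⟩
        by_cases h0 : j = 0
        · exact Or.inl h0
        · exact Or.inr ((hp.mono j k (by omega) hjk.le (by omega)).trans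
            (h1.resolve_left (by omega)))
  · rw [Set.disjoint_left]
    rintro w ⟨-, h2⟩ ⟨h3, -⟩
    linarith [h2.resolve_left (by omega), h3.resolve_left (by omega)]

theorem IsWeakPartition.setIntegral_slab (hp : IsWeakPartition f N p) {h : ℝ → ℝ}
    (hh : Integrable h) {j k : ℕ} (hjk : j < k) (hk : k ≤ N) :
    ∫ x in slab N p j k, h x = ∑ l ∈ Finset.Ico j k, ∫ x in slab N p l (l + 1), h x := by
  induction k, hjk using Nat.le_induction with
  | base => simp
  | succ k hjk ih =>
    rw [hp.setIntegral_slab_add hh (by omega) (Nat.lt_succ_self k) hk,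
      Finset.sum_Ico_succ_top (by omega), ih (by omega)]

theorem slab_zero_self (p : ℕ → ℝ) : slab N p 0 N = Set.univ := by ext w; simp [slab]

theorem IsWeakPartition.integral_eq_sum (hp : IsWeakPartition f N p) {h : ℝ → ℝ}
    (hh : Integrable h) (hN : 0 < N) :
    ∫ x, h x = ∑ l ∈ Finset.range N, ∫ x in slab N p l (l + 1), h x := by
  rw [Finset.range_eq_Ico, ← hp.setIntegral_slab hh hN le_rfl, slab_zero_self]
  simp

end SlabIntegral

theorem sum_range_mul_eq {M : Type*} [AddCommMonoid M] (φ : ℕ → M) (A B : ℕ) :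
    ∑ l ∈ Finset.range (A * B), φ l
      = ∑ m ∈ Finset.range A, ∑ l ∈ Finset.Ico (m * B) ((m + 1) * B), φ l := by
  induction A with
  | zero => simp
  | succ A ih =>
    rw [Finset.sum_range_succ, ← ih, Finset.range_eq_Ico, Finset.range_eq_Ico,
      Finset.sum_Ico_consecutive _ (Nat.zero_le _) (Nat.mul_le_mul_right _ (Nat.le_succ A))]

/-- The weighted distortion of levels `p` and reproduction points `c`, up to a constant. -/
noncomputable def levelCost (f : ℝ → ℝ) (R : ℕ → ℕ) (T : ℕ) (g : ℕ → ℝ) (p : ℕ → ℝ)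
    (c : ℕ → ℕ → ℝ) : ℝ :=
  ∑ l ∈ Finset.range (numCells R T),
    (betaSum R T g c l * mass f (slab (numCells R T) p l (l + 1))
      - 2 * alphaSum R T g c l * mom f (slab (numCells R T) p l (l + 1)))

/-- The pointwise smallest weighted distortion. -/
noncomputable def leafMin (R : ℕ → ℕ) (T : ℕ) (g : ℕ → ℝ) (c : ℕ → ℕ → ℝ) (w : ℝ) : ℝ :=
  (Finset.range (numCells R T)).inf' (Finset.nonempty_range_iff.2 numCells_pos.ne')
    fun l => leafLine R T g c l w

/-- The expected pointwise smallest weighted distortion. -/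
noncomputable def envelopeCost (f : ℝ → ℝ) (R : ℕ → ℕ) (T : ℕ) (g : ℕ → ℝ)
    (c : ℕ → ℕ → ℝ) : ℝ := ∫ w, leafMin R T g c w * f w

section Cost

variable {f : ℝ → ℝ} {R : ℕ → ℕ} {T : ℕ} {p : ℕ → ℝ} {g : ℕ → ℝ} {c : ℕ → ℕ → ℝ}

theorem leafMin_le {l : ℕ} (hl : l < numCells R T) (w : ℝ) :
    leafMin R T g c w ≤ leafLine R T g c l w :=
  Finset.inf'_le _ (Finset.mem_range.2 hl)

theorem exists_leafMin_eq (w : ℝ) :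
    ∃ l < numCells R T, leafMin R T g c w = leafLine R T g c l w := by
  obtain ⟨l, hl, h⟩ := Finset.exists_mem_eq_inf'
    (Finset.nonempty_range_iff.2 (numCells_pos (R := R) (T := T)).ne')
    fun l => leafLine R T g c l w
  exact ⟨l, Finset.mem_range.1 hl, h⟩

theorem continuous_leafLine (l : ℕ) : Continuous (leafLine R T g c l) := by
  unfold leafLine; fun_prop

theorem continuous_leafMin : Continuous (leafMin R T g c) :=
  Continuous.finset_inf'_apply _ fun l _ => continuous_leafLine l

theorem integrable_leafLine_mul (hf : IsLogConcaveDensity f) (l : ℕ) :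
    Integrable fun w => leafLine R T g c l w * f w := by
  have := (hf.integrable.const_mul (betaSum R T g c l)).sub
    (hf.integrable_mul.const_mul (2 * alphaSum R T g c l))
  refine this.congr (ae_of_all _ fun w => ?_)
  simp only [Pi.sub_apply, leafLine]; ring

theorem abs_leafMin_le (w : ℝ) :
    |leafMin R T g c w| ≤ ∑ l ∈ Finset.range (numCells R T), |leafLine R T g c l w| := by
  obtain ⟨l, hl, h⟩ := exists_leafMin_eq (R := R) (T := T) (g := g) (c := c) w
  rw [h]
  exact Finset.single_le_sum (f := fun l => |leafLine R T g c l w|) (fun _ _ => abs_nonneg _)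
    (Finset.mem_range.2 hl)

theorem integrable_leafMin_mul (hf : IsLogConcaveDensity f) :
    Integrable fun w => leafMin R T g c w * f w := by
  refine Integrable.mono' (integrable_finsetSum (Finset.range (numCells R T)) fun l _ =>
    (integrable_leafLine_mul (R := R) (T := T) (g := g) (c := c) hf l).norm)
    ((continuous_leafMin.measurable.mul hf.logConcave.measurable).aestronglyMeasurable)
    (ae_of_all _ fun w => ?_)
  simp only [norm_mul, Real.norm_eq_abs, ← Finset.sum_mul]
  exact mul_le_mul_of_nonneg_right (abs_leafMin_le w) (abs_nonneg _)

theorem setIntegral_leafLine (hf : IsLogConcaveDensity f) (l : ℕ) (A : Set ℝ) :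
    ∫ w in A, leafLine R T g c l w * f w
      = betaSum R T g c l * mass f A - 2 * alphaSum R T g c l * mom f A := by
  rw [mass, mom, ← integral_const_mul, ← integral_const_mul, ← integral_sub
    (hf.integrable.integrableOn.const_mul _) (hf.integrable_mul.integrableOn.const_mul _)]
  congr 1; ext w; simp only [leafLine]; ring

/-- The excess over the envelope is a sum of nonnegative integrals over the cells. It vanishes only
if each leaf attains the minimum almost everywhere on its own cell, as far as the density is
positive. -/
theorem levelCost_sub_envelopeCost (hf : IsLogConcaveDensity f)
    (hp : IsWeakPartition f (numCells R T) p) :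
    levelCost f R T g p c - envelopeCost f R T g c = ∑ l ∈ Finset.range (numCells R T),
      ∫ w in slab (numCells R T) p l (l + 1),
        (leafLine R T g c l w - leafMin R T g c w) * f w := by
  rw [envelopeCost, hp.integral_eq_sum (integrable_leafMin_mul hf) numCells_pos, levelCost,
    ← Finset.sum_sub_distrib]
  refine Finset.sum_congr rfl fun l _ => ?_
  rw [← setIntegral_leafLine hf, ← integral_sub (integrable_leafLine_mul hf l).integrableOn
    (integrable_leafMin_mul hf).integrableOn]
  congr 1; ext w; ring

theorem leafLine_sub_leafMin_nonneg (hf : IsLogConcaveDensity f) {l : ℕ}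
    (hl : l < numCells R T) (w : ℝ) :
    0 ≤ (leafLine R T g c l w - leafMin R T g c w) * f w :=
  mul_nonneg (sub_nonneg.2 (leafMin_le hl w)) (hf.nonneg w)

theorem envelopeCost_le (hf : IsLogConcaveDensity f)
    (hp : IsWeakPartition f (numCells R T) p) :
    envelopeCost f R T g c ≤ levelCost f R T g p c := by
  rw [← sub_nonneg, levelCost_sub_envelopeCost hf hp]
  exact Finset.sum_nonneg fun l hl => integral_nonneg fun w =>
    leafLine_sub_leafMin_nonneg hf (Finset.mem_range.1 hl) w

/-- Levels that separate the leaves optimally attain the envelope. -/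
theorem levelCost_eq_envelopeCost (hf : IsLogConcaveDensity f)
    (hp : IsWeakPartition f (numCells R T) p)
    (h : ∀ l < numCells R T, ∀ w, (l = 0 ∨ p l < w) → (l + 1 = numCells R T ∨ w < p (l + 1)) →
      ∀ i < numCells R T, leafLine R T g c l w ≤ leafLine R T g c i w) :
    levelCost f R T g p c = envelopeCost f R T g c := by
  rw [← sub_eq_zero, levelCost_sub_envelopeCost hf hp]
  refine Finset.sum_eq_zero fun l hl => ?_
  refine (setIntegral_congr_ae (g := fun _ => (0 : ℝ)) (measurableSet_slab _ _ _ _) ?_).trans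
    (by simp)
  filter_upwards [Measure.ae_ne volume (p l)] with w hne hw
  have hl' := Finset.mem_range.1 hl
  obtain ⟨i, hi, he⟩ := exists_leafMin_eq (R := R) (T := T) (g := g) (c := c) w
  have := h l hl' w (hw.1.imp_right fun h => lt_of_le_of_ne h hne.symm) hw.2 i hi
  rw [le_antisymm (he ▸ this) (leafMin_le hl' w), sub_self, zero_mul]

theorem leafLine_eq_leafMin_ae (hf : IsLogConcaveDensity f)
    (hp : IsWeakPartition f (numCells R T) p)
    (h : levelCost f R T g p c = envelopeCost f R T g c) {l : ℕ} (hl : l < numCells R T) :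
    ∀ᵐ w, w ∈ slab (numCells R T) p l (l + 1) →
      (leafLine R T g c l w - leafMin R T g c w) * f w = 0 := by
  rw [← sub_eq_zero, levelCost_sub_envelopeCost hf hp] at h
  have h0 := (Finset.sum_eq_zero_iff_of_nonneg fun l hl => integral_nonneg fun w =>
    leafLine_sub_leafMin_nonneg hf (Finset.mem_range.1 hl) w).1 h l (Finset.mem_range.2 hl)
  have hi : Integrable fun w => (leafLine R T g c l w - leafMin R T g c w) * f w := by
    refine ((integrable_leafLine_mul (R := R) (T := T) (g := g) (c := c) hf l).sub
      (integrable_leafMin_mul (R := R) (T := T) (g := g) (c := c) hf)).congr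
        (ae_of_all _ fun w => ?_)
    simp only [Pi.sub_apply]; ring
  rw [integral_eq_zero_iff_of_nonneg (fun w => leafLine_sub_leafMin_nonneg hf hl w)
    hi.integrableOn] at h0
  exact (ae_restrict_iff' (measurableSet_slab _ _ _ _)).1 h0

/-- Leaf `l` attains the minimum almost everywhere on its cell. As the cell is nondegenerate, its
left end is approached from inside, and continuity gives optimality there. -/
theorem leafLine_level_left_le (hf : IsLogConcaveDensity f)
    (hp : IsWeakPartition f (numCells R T) p)
    (h : levelCost f R T g p c = envelopeCost f R T g c) {l : ℕ} (hl1 : 1 ≤ l)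
    (hl : l < numCells R T) (hlt : l + 1 = numCells R T ∨ p l < p (l + 1)) {i : ℕ}
    (hi : i < numCells R T) : leafLine R T g c l (p l) ≤ leafLine R T g c i (p l) := by
  have e1 : ∀ᶠ x in 𝓝[>] p l, IsInner f x :=
    nhdsWithin_le_nhds (hf.eventually_isInner (hp.inner l hl1 hl))
  have e2 : ∀ᶠ x in 𝓝[>] p l, l + 1 = numCells R T ∨ x < p (l + 1) := by
    rcases hlt with h0 | h0
    · exact Eventually.of_forall fun _ => Or.inl h0
    · filter_upwards [nhdsWithin_le_nhds (eventually_lt_nhds h0)] with x hx using Or.inr hx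
  have h0 := eq_zero_of_frequently (x := p l) (F := 𝓝[>] p l) nhdsWithin_le_nhds
    (φ := fun w => leafLine R T g c l w - leafMin R T g c w)
    ((continuous_leafLine l).sub continuous_leafMin).continuousAt
    (((frequently_nhdsGT_of_ae (leafLine_eq_leafMin_ae hf hp h hl) (p l)).and_eventually
      ((e1.and e2).and self_mem_nhdsWithin)).mono fun x ⟨hx, ⟨h1, h2⟩, h3⟩ =>
        (mul_eq_zero.1 (hx ⟨Or.inr (le_of_lt h3), h2⟩)).resolve_right (hf.pos_of_isInner h1).ne')
  have := leafMin_le (g := g) (c := c) hi (p l)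
  linarith

theorem leafLine_level_right_le (hf : IsLogConcaveDensity f)
    (hp : IsWeakPartition f (numCells R T) p)
    (h : levelCost f R T g p c = envelopeCost f R T g c) {l : ℕ}
    (hl : l + 1 < numCells R T) (hlt : l = 0 ∨ p l < p (l + 1)) {i : ℕ}
    (hi : i < numCells R T) :
    leafLine R T g c l (p (l + 1)) ≤ leafLine R T g c i (p (l + 1)) := by
  have e1 : ∀ᶠ x in 𝓝[<] p (l + 1), IsInner f x :=
    nhdsWithin_le_nhds (hf.eventually_isInner (hp.inner (l + 1) (by omega) hl))
  have e2 : ∀ᶠ x in 𝓝[<] p (l + 1), l = 0 ∨ p l ≤ x := by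
    rcases hlt with h0 | h0
    · exact Eventually.of_forall fun _ => Or.inl h0
    · filter_upwards [nhdsWithin_le_nhds (eventually_gt_nhds h0)] with x hx using Or.inr (le_of_lt hx)
  have h0 := eq_zero_of_frequently (x := p (l + 1)) (F := 𝓝[<] p (l + 1)) nhdsWithin_le_nhds
    (φ := fun w => leafLine R T g c l w - leafMin R T g c w)
    ((continuous_leafLine l).sub continuous_leafMin).continuousAt
    (((frequently_nhdsLT_of_ae (leafLine_eq_leafMin_ae hf hp h (show l < numCells R T by omega))
      (p (l + 1))).and_eventually
      ((e1.and e2).and self_mem_nhdsWithin)).mono fun x ⟨hx, ⟨h1, h2⟩, h3⟩ =>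
        (mul_eq_zero.1 (hx ⟨h2, Or.inr h3⟩)).resolve_right (hf.pos_of_isInner h1).ne')
  have := leafMin_le (g := g) (c := c) hi (p (l + 1))
  linarith

/-! ### Optimality of centroids -/

/-- On a null cell both sides vanish, so the conventional centroid does no harm. -/
theorem mom_eq_slabCen_mul_mass (hf : IsLogConcaveDensity f) (N j k : ℕ) :
    mom f (slab N p j k) = slabCen f N p j k * mass f (slab N p j k) := by
  unfold slabCen
  split_ifs with h
  · rw [h, mul_zero, mom]
    have h0 : ∀ᵐ x ∂(volume.restrict (slab N p j k)), f x = 0 :=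
      (integral_eq_zero_iff_of_nonneg hf.nonneg hf.integrable.integrableOn).1 h
    rw [integral_congr_ae (g := fun _ => (0 : ℝ)) (by filter_upwards [h0] with x hx; simp [hx])]
    simp
  · rw [cen, div_mul_cancel₀ _ h]

/-- Collecting the leaves of each stage cell decouples the reproduction points: each one enters a
quadratic of its own, minimized at its centroid. -/
theorem levelCost_eq_sum (hf : IsLogConcaveDensity f) (hp : IsWeakPartition f (numCells R T) p)
    (c : ℕ → ℕ → ℝ) :
    levelCost f R T g p c = ∑ t ∈ Finset.Icc 1 T, g t * ∑ m ∈ Finset.range (2 ^ cumRate R t),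
      (c t m ^ 2 - 2 * c t m * cenBook f R T p t m) * mass f (cell R T p t m) := by
  have h1 : levelCost f R T g p c = ∑ t ∈ Finset.Icc 1 T, g t *
      ∑ l ∈ Finset.range (numCells R T),
        (c t (parent R T t l) ^ 2 * mass f (slab (numCells R T) p l (l + 1))
          - 2 * c t (parent R T t l) * mom f (slab (numCells R T) p l (l + 1))) := by
    simp only [Finset.mul_sum]
    rw [Finset.sum_comm, levelCost]
    refine Finset.sum_congr rfl fun l _ => ?_
    rw [alphaSum, betaSum, Finset.mul_sum, Finset.sum_mul, Finset.sum_mul,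
      ← Finset.sum_sub_distrib]
    exact Finset.sum_congr rfl fun t _ => by ring
  rw [h1]
  refine Finset.sum_congr rfl fun t ht => ?_
  have htT := (Finset.mem_Icc.1 ht).2
  congr 1
  rw [← pow_mul_pow_eq_numCells htT, sum_range_mul_eq, pow_mul_pow_eq_numCells htT]
  refine Finset.sum_congr rfl fun m hm => ?_
  have hm' : m + 1 ≤ 2 ^ cumRate R t := Finset.mem_range.1 hm
  have hlt : m * 2 ^ tailRate R T t < (m + 1) * 2 ^ tailRate R T t :=
    Nat.mul_lt_mul_of_pos_right (Nat.lt_succ_self m) (by positivity)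
  have hle : (m + 1) * 2 ^ tailRate R T t ≤ numCells R T := by
    rw [← pow_mul_pow_eq_numCells htT]; exact Nat.mul_le_mul_right _ hm'
  have e0 := hp.setIntegral_slab hf.integrable hlt hle
  have e1 := hp.setIntegral_slab hf.integrable_mul hlt hle
  have e2 := mom_eq_slabCen_mul_mass (p := p) hf (numCells R T) (m * 2 ^ tailRate R T t)
    ((m + 1) * 2 ^ tailRate R T t)
  rw [cell_eq_slab htT, sub_mul, mul_assoc _ (cenBook f R T p t m), cenBook, ← e2, mass, e0, mom,
    e1, Finset.mul_sum, Finset.mul_sum, ← Finset.sum_sub_distrib]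
  refine Finset.sum_congr rfl fun l hl => ?_
  have : parent R T t l = m := by
    obtain ⟨h1, h2⟩ := Finset.mem_Ico.1 hl
    exact Nat.div_eq_of_lt_le h1 h2
  rw [this, mass, mom]

theorem levelCost_sub_cenBook (hf : IsLogConcaveDensity f)
    (hp : IsWeakPartition f (numCells R T) p) (c : ℕ → ℕ → ℝ) :
    levelCost f R T g p c - levelCost f R T g p (cenBook f R T p) =
      ∑ t ∈ Finset.Icc 1 T, g t * ∑ m ∈ Finset.range (2 ^ cumRate R t),
        (c t m - cenBook f R T p t m) ^ 2 * mass f (cell R T p t m) := by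
  rw [levelCost_eq_sum hf hp, levelCost_eq_sum hf hp, ← Finset.sum_sub_distrib]
  refine Finset.sum_congr rfl fun t _ => ?_
  rw [← mul_sub, ← Finset.sum_sub_distrib]
  congr 1
  exact Finset.sum_congr rfl fun m _ => by ring

theorem levelCost_cenBook_le (hf : IsLogConcaveDensity f) (hg : IsWeight R T g)
    (hp : IsWeakPartition f (numCells R T) p) (c : ℕ → ℕ → ℝ) :
    levelCost f R T g p (cenBook f R T p) ≤ levelCost f R T g p c := by
  rw [← sub_nonneg, levelCost_sub_cenBook hf hp]
  exact Finset.sum_nonneg fun t ht => mul_nonneg (hg.nonneg t ht)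
    (Finset.sum_nonneg fun m _ => mul_nonneg (sq_nonneg _) (hf.mass_nonneg _))

end Cost

/-! ### Optimal levels do not collapse -/

section Collapse

variable {f : ℝ → ℝ} {R : ℕ → ℕ} {T : ℕ} {p : ℕ → ℝ} {g : ℕ → ℝ}

theorem blockLo_mono {t t' : ℕ} (h : t ≤ t') (l : ℕ) : blockLo R T t l ≤ blockLo R T t' l := by
  unfold blockLo
  rw [parent_parent h, ← Nat.add_sub_cancel' (tailRate_anti (R := R) (T := T) h), pow_add,
    mul_comm (2 ^ tailRate R T t'), ← mul_assoc, Nat.add_sub_cancel_left]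
  exact Nat.mul_le_mul_right _ (Nat.div_mul_le_self _ _)

theorem blockHi_anti {t t' : ℕ} (h : t ≤ t') (l : ℕ) : blockHi R T t' l ≤ blockHi R T t l := by
  unfold blockHi
  rw [parent_parent h, ← Nat.add_sub_cancel' (tailRate_anti (R := R) (T := T) h), pow_add,
    mul_comm (2 ^ tailRate R T t'), ← mul_assoc, Nat.add_sub_cancel_left]
  exact Nat.mul_le_mul_right _ ((Nat.div_lt_iff_lt_mul (by positivity)).1 (Nat.lt_succ_self _))

/-- A leaf whose reproduction points are at `x` wherever they differ from those of another leaf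
is better than that leaf at `x`. -/
theorem leafLine_lt_of_eq_or {c : ℕ → ℕ → ℝ} (hg : IsWeight R T g) {i l : ℕ} {x : ℝ}
    (h : ∀ t ∈ Finset.Icc 1 T, parent R T t i = parent R T t l ∨ c t (parent R T t i) = x)
    {t₀ : ℕ} (ht₀ : t₀ ∈ Finset.Icc 1 T) (hgt : 0 < g t₀) (h1 : c t₀ (parent R T t₀ i) = x)
    (h2 : c t₀ (parent R T t₀ l) ≠ x) : leafLine R T g c i x < leafLine R T g c l x := by
  rw [← sub_pos, leafLine_sub]
  refine Finset.sum_pos' (fun t ht => mul_nonneg (hg.nonneg t ht) ?_) ⟨t₀, ht₀, mul_pos hgt ?_⟩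
  · rcases h t ht with h | h
    · rw [h]; simp
    · rw [h]; nlinarith [sq_nonneg (x - c t (parent R T t l))]
  · rw [h1]
    have : 0 < (x - c t₀ (parent R T t₀ l)) ^ 2 := by
      have := sub_ne_zero.2 h2.symm
      positivity
    nlinarith

/-- Suppose that exactly the levels `j, …, k` coincide at `x`, with `j < k`. The leaves `j - 1` and
`k` on both sides are nondegenerate, hence optimal at `x`. The leaves in between are empty, and
their collapsed stage cells have the reproduction point `x`, which is ideal for the source value
`x`. One of these empty leaves agrees with `j - 1` or with `k` in all stages except those in which
it reproduces `x`, and so it is strictly better at `x`. This is a contradiction. -/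
theorem isStrictPartition_of_levelCost_eq (hf : IsLogConcaveDensity f) (hg : IsWeight R T g)
    (hp : IsWeakPartition f (numCells R T) p)
    (h : levelCost f R T g p (cenBook f R T p) = envelopeCost f R T g (cenBook f R T p)) :
    IsStrictPartition f (numCells R T) p := by
  refine ⟨hp, fun i hi1 hi => ?_⟩
  by_contra hcon
  set N := numCells R T with hN
  set x := p i with hx
  have hxi : p (i + 1) = x := le_antisymm (not_lt.1 hcon) (hp.mono _ _ hi1 (Nat.le_succ i) hi)
  -- the levels `j, …, k` are those at `x`
  have hexj : ∃ j, 1 ≤ j ∧ p j = x := ⟨i, hi1, rfl⟩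
  classical
  obtain ⟨hj1, hjx⟩ := Nat.find_spec hexj
  have hjmin : ∀ m, m < Nat.find hexj → 1 ≤ m → p m ≠ x := fun m hm h1 h2 =>
    Nat.find_min hexj hm ⟨h1, h2⟩
  have hji : Nat.find hexj ≤ i := Nat.find_min' hexj ⟨hi1, rfl⟩
  generalize Nat.find hexj = j at hj1 hjx hjmin hji
  obtain ⟨k, hik, hkN, hkx, hkmax⟩ : ∃ k, i + 1 ≤ k ∧ k < N ∧ p k = x ∧
      ∀ m, k < m → m < N → p m ≠ x := by
    have hS : ((Finset.Ico (i + 1) N).filter fun m => p m = x).Nonempty :=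
      ⟨i + 1, Finset.mem_filter.2 ⟨Finset.mem_Ico.2 ⟨le_rfl, hi⟩, hxi⟩⟩
    obtain ⟨h1, h2⟩ := Finset.mem_filter.1 (Finset.max'_mem _ hS)
    obtain ⟨h3, h4⟩ := Finset.mem_Ico.1 h1
    refine ⟨_, h3, h4, h2, fun m hm hmN hmx => ?_⟩
    have := Finset.le_max' ((Finset.Ico (i + 1) N).filter fun m => p m = x) m (Finset.mem_filter.2
      ⟨Finset.mem_Ico.2 ⟨h3.trans hm.le, hmN⟩, hmx⟩)
    exact absurd this (not_le.2 hm)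
  have hpx : ∀ m, j ≤ m → m ≤ k → p m = x := fun m h1 h2 =>
    le_antisymm (hkx ▸ hp.mono m k (by omega) h2 hkN) (hjx ▸ hp.mono j m hj1 h1 (by omega))
  have hjl : j - 1 = 0 ∨ p (j - 1) < p (j - 1 + 1) := by
    by_cases h0 : j - 1 = 0
    · exact Or.inl h0
    · rw [show j - 1 + 1 = j by omega]
      refine Or.inr (lt_of_le_of_ne (hp.mono _ _ (by omega) (by omega) (by omega)) ?_)
      rw [hjx]; exact hjmin _ (by omega) (by omega)
  have hkr : k + 1 = N ∨ p k < p (k + 1) := by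
    by_cases h0 : k + 1 = N
    · exact Or.inl h0
    · refine Or.inr (lt_of_le_of_ne (hp.mono _ _ (by omega) (by omega) (by omega)) ?_)
      rw [hkx]; exact (hkmax _ (by omega) (by omega)).symm
  have hoptj : ∀ m < N, leafLine R T g (cenBook f R T p) (j - 1) x
      ≤ leafLine R T g (cenBook f R T p) m x := by
    intro m hm
    have := leafLine_level_right_le hf hp h (l := j - 1) (by omega) hjl hm
    rwa [show j - 1 + 1 = j by omega, hjx] at this
  have hoptk : ∀ m < N, leafLine R T g (cenBook f R T p) k x
      ≤ leafLine R T g (cenBook f R T p) m x := by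
    intro m hm
    have := leafLine_level_left_le hf hp h (l := k) (by omega) hkN hkr hm
    rwa [hkx] at this
  have hdeg : ∀ t m, j ≤ blockLo R T t m → blockHi R T t m ≤ k →
      cenBook f R T p t (parent R T t m) = x := by
    intro t m h1 h2
    have h3 := blockLo_lt_blockHi (R := R) (T := T) t m
    rw [cenBook_parent, slabCen_of_eq (by omega) (by omega)
      (by rw [hpx _ (by omega) h2, hpx _ h1 (by omega)]), hpx _ h1 (by omega)]
  obtain ⟨t₀, ht₀, hgt, ht0⟩ := hg.exists_leaf (by omega)
  have hj0 : cenBook f R T p t₀ (parent R T t₀ (j - 1)) < x := by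
    rw [cenBook_leaf ht0]
    have := slabCen_lt (f := f) (p := p) hf (show j - 1 + 1 ≠ N by omega)
      (hp.mass_slab_pos hf (Nat.lt_succ_self _) (by omega)
        (hjl.imp_right fun h => Or.inr h))
    rwa [show p (j - 1 + 1) = x by rw [show j - 1 + 1 = j by omega, hjx]] at this
  have hk0 : x < cenBook f R T p t₀ (parent R T t₀ k) := by
    rw [cenBook_leaf ht0]
    have := IsWeakPartition.lt_slabCen (f := f) (p := p) hf (show k ≠ 0 by omega)
      (hp.mass_slab_pos hf (Nat.lt_succ_self _) (by omega) (Or.inr hkr))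
    rwa [hkx] at this
  have hleaf : ∀ m, j ≤ m → m < k → cenBook f R T p t₀ (parent R T t₀ m) = x := by
    intro m h1 h2
    refine hdeg t₀ m ?_ ?_
    · simpa [blockLo, parent, ht0] using h1
    · simpa [blockHi, parent, ht0] using h2
  -- the coarsest stage that separates the two sides of `x`
  have hexs : ∃ s, s ∈ Finset.Icc 1 T ∧ parent R T s (j - 1) ≠ parent R T s k := by
    refine ⟨t₀, ht₀, ?_⟩
    rw [parent_of_tailRate_eq_zero ht0, parent_of_tailRate_eq_zero ht0]; omega
  obtain ⟨hsT, hs⟩ := Nat.find_spec hexs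
  have hsmin : ∀ t ∈ Finset.Icc 1 T, t < Nat.find hexs →
      parent R T t (j - 1) = parent R T t k := fun t ht hts =>
    not_not.1 fun hc => Nat.find_min hexs hts ⟨ht, hc⟩
  generalize Nat.find hexs = s at hsT hs hsmin
  have hbetween : ∀ t ∈ Finset.Icc 1 T, t < s → ∀ m, j - 1 ≤ m → m ≤ k →
      parent R T t m = parent R T t (j - 1) ∧ parent R T t m = parent R T t k := by
    intro t ht hts m h1 h2
    have e := hsmin t ht hts
    have a1 := parent_mono (R := R) (T := T) t h1
    have a2 := parent_mono (R := R) (T := T) t h2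
    omega
  have hek : blockHi R T s (j - 1) ≤ k :=
    (blockHi_le_blockLo (by omega) hs).trans (blockLo_le _ _)
  have hej : j - 1 < blockHi R T s (j - 1) := lt_blockHi _ _
  rcases Nat.lt_or_ge j (blockHi R T s (j - 1)) with he | he
  -- The stage-`s` cell of `j - 1` contains empty leaves, and its last leaf `e - 1` is one of them.
  -- A finer cell of `e - 1` either contains `j - 1` or lies within `j, …, e - 1` and is collapsed.
  · set e := blockHi R T s (j - 1) with hedef
    have hpar : parent R T s (e - 1) = parent R T s (j - 1) :=
      parent_eq_of_mem ((blockLo_le _ _).trans (by omega)) (by omega)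
    refine absurd (hoptj (e - 1) (by omega)) (not_le.2 (leafLine_lt_of_eq_or hg ?_ ht₀ hgt
      (hleaf _ (by omega) (by omega)) hj0.ne))
    intro t ht
    rcases Nat.lt_or_ge t s with hts | hts
    · exact Or.inl (hbetween t ht hts _ (by omega) (by omega)).1
    · by_cases hpe : parent R T t (j - 1) = parent R T t (e - 1)
      · exact Or.inl hpe.symm
      · refine Or.inr (hdeg t _ ?_ ?_)
        · have a1 := blockHi_le_blockLo (show j - 1 ≤ e - 1 by omega) hpe
          have a2 := lt_blockHi (R := R) (T := T) t (j - 1)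
          omega
        · have a1 := blockHi_anti (R := R) (T := T) hts (e - 1)
          have a2 : blockHi R T s (e - 1) = e :=
            congrArg (fun q => (q + 1) * 2 ^ tailRate R T s) hpar
          omega
  -- Now a new stage-`s` cell begins at `j`. The empty leaf `j` competes with `k`: from stage `s`
  -- on, its cells start at `j` and either contain `k` or are collapsed.
  · have hej' : blockHi R T s (j - 1) = j := by omega
    refine absurd (hoptk j (by omega)) (not_le.2 (leafLine_lt_of_eq_or hg ?_ ht₀ hgt
      (hleaf _ le_rfl (by omega)) hk0.ne'))
    intro t ht
    rcases Nat.lt_or_ge t s with hts | hts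
    · exact Or.inl (hbetween t ht hts _ (by omega) (by omega)).2
    · by_cases hpe : parent R T t j = parent R T t k
      · exact Or.inl hpe
      · refine Or.inr (hdeg t _ ?_ ?_)
        · have a1 := blockLo_mono (R := R) (T := T) hts j
          have a2 : parent R T s (j - 1) ≠ parent R T s j := by
            intro hc
            have a3 := lt_blockHi (R := R) (T := T) s j
            unfold blockHi at a3 hej'
            rw [← hc] at a3
            omega
          have a3 := blockHi_le_blockLo (show j - 1 ≤ j by omega) a2
          omega
        · exact (blockHi_le_blockLo (by omega) hpe).trans (blockLo_le _ _)

theorem isBalanced_of_levelCost_eq (hf : IsLogConcaveDensity f)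
    (hp : IsStrictPartition f (numCells R T) p)
    (h : levelCost f R T g p (cenBook f R T p) = envelopeCost f R T g (cenBook f R T p)) :
    IsBalanced R T g (cenBook f R T p) p := by
  intro l hl1 hl
  refine le_antisymm ?_ ?_
  · have := leafLine_level_right_le hf hp.toIsWeakPartition h (l := l - 1) (by omega) ?_ hl
    · rwa [show l - 1 + 1 = l by omega] at this
    · by_cases h0 : l - 1 = 0
      · exact Or.inl h0
      · exact Or.inr (hp.lt_succ _ (by omega) (by omega))
  · refine leafLine_level_left_le hf hp.toIsWeakPartition h hl1 hl ?_ (by omega)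
    by_cases h0 : l + 1 = numCells R T
    · exact Or.inl h0
    · exact Or.inr (hp.lt_succ _ (by omega) (by omega))

end Collapse

/-! ### Continuity in the levels -/

theorem continuous_setIntegral_Iio {h : ℝ → ℝ} (hh : Integrable h) :
    Continuous fun x => ∫ y in Set.Iio x, h y := by
  have e : (fun x => ∫ y in Set.Iio x, h y) = fun x => (∫ y in Set.Iic 0, h y) + ∫ y in (0)..x, h y := by
    funext x
    rw [← integral_Iic_eq_integral_Iio, ← intervalIntegral.integral_Iic_sub_Iic hh.integrableOn
      hh.integrableOn]
    ring
  rw [e]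
  exact continuous_const.add (intervalIntegral.continuous_primitive
    (fun a b => hh.intervalIntegrable) 0)

section Continuity

variable {f : ℝ → ℝ} {N : ℕ}

theorem continuousOn_setIntegral_slab {h : ℝ → ℝ} (hh : Integrable h) {j k : ℕ} (hjk : j < k)
    (hk : k ≤ N) :
    ContinuousOn (fun p => ∫ x in slab N p j k, h x) {p | IsWeakPartition f N p} := by
  have hc : ∀ l, Continuous fun p : ℕ → ℝ => ∫ x in Set.Iio (p l), h x := fun l =>
    (continuous_setIntegral_Iio hh).comp (continuous_apply l)
  have h0 : ∀ k, 0 < k → k ≤ N →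
      ContinuousOn (fun p => ∫ x in slab N p 0 k, h x) {p | IsWeakPartition f N p} := by
    intro k hk0 hk
    by_cases hkN : k = N
    · have : (fun p : ℕ → ℝ => ∫ x in slab N p 0 k, h x) = fun _ => ∫ x, h x := by
        funext p; rw [hkN, slab_zero_self]; simp
      rw [this]; exact continuousOn_const
    · have : (fun p : ℕ → ℝ => ∫ x in slab N p 0 k, h x) = fun p => ∫ x in Set.Iio (p k), h x := by
        funext p; congr 2; ext w; simp [slab, hkN]
      rw [this]; exact (hc k).continuousOn
  by_cases hj : j = 0
  · rw [hj]; exact h0 k (by omega) hk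
  · refine ((h0 k (by omega) hk).sub (h0 j (by omega) (by omega))).congr fun p hp => ?_
    rw [Pi.sub_apply, IsWeakPartition.setIntegral_slab_add hp hh (show 0 < j by omega) hjk hk]
    ring

/-- Where the cell has mass, the centroid is a quotient of continuous functions. At a collapsed cell
it is squeezed between the two ends. -/
theorem continuousOn_slabCen (hf : IsLogConcaveDensity f) {j k : ℕ} (hjk : j < k) (hk : k ≤ N) :
    ContinuousOn (fun p => slabCen f N p j k) {p | IsWeakPartition f N p} := by
  have hmass : ContinuousOn (fun p => mass f (slab N p j k)) {p | IsWeakPartition f N p} :=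
    continuousOn_setIntegral_slab hf.integrable hjk hk
  have hmom : ContinuousOn (fun p => mom f (slab N p j k)) {p | IsWeakPartition f N p} :=
    continuousOn_setIntegral_slab hf.integrable_mul hjk hk
  intro p hp
  by_cases h : mass f (slab N p j k) = 0
  · have hj : j ≠ 0 := fun h0 =>
      (IsWeakPartition.mass_slab_pos hf hp hjk hk (Or.inl h0)).ne' h
    have hkN : k ≠ N := fun h0 =>
      (IsWeakPartition.mass_slab_pos hf hp hjk hk (Or.inr (Or.inl h0))).ne' h
    have hjk' : p k ≤ p j := not_lt.1 fun h0 =>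
      (IsWeakPartition.mass_slab_pos hf hp hjk hk (Or.inr (Or.inr h0))).ne' h
    have hpe : p j = p k := le_antisymm (hp.mono j k (by omega) hjk.le (by omega)) hjk'
    rw [ContinuousWithinAt, slabCen_of_eq hj hkN hjk']
    refine tendsto_of_tendsto_of_tendsto_of_le_of_le'
      ((continuous_apply j).continuousWithinAt.tendsto (s := {p | IsWeakPartition f N p}))
      (by
        have := (continuous_apply k).continuousWithinAt.tendsto (s := {p | IsWeakPartition f N p})
          (x := p)
        rwa [← hpe] at this)
      ?_ ?_
    · exact Eventually.of_forall fun q => IsWeakPartition.le_slabCen hf hj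
    · filter_upwards [self_mem_nhdsWithin] with q hq
      exact IsWeakPartition.slabCen_le hf hq hjk (by omega)
  · refine ((hmom p hp).div (hmass p hp) h).congr_of_eventuallyEq ?_ ?_
    · filter_upwards [(hmass p hp).eventually_ne h] with q hq
      simp only [slabCen, if_neg hq, cen, Pi.div_apply]
    · simp only [slabCen, if_neg h, cen, Pi.div_apply]

variable {R : ℕ → ℕ} {T : ℕ} {g : ℕ → ℝ}

theorem continuousOn_cenBook (hf : IsLogConcaveDensity f) {t m : ℕ} (ht : t ≤ T)
    (hm : m < 2 ^ cumRate R t) :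
    ContinuousOn (fun p => cenBook f R T p t m) {p | IsWeakPartition f (numCells R T) p} := by
  refine continuousOn_slabCen hf
    (Nat.mul_lt_mul_of_pos_right (Nat.lt_succ_self m) (by positivity)) ?_
  rw [← pow_mul_pow_eq_numCells ht]
  exact Nat.mul_le_mul_right _ hm

theorem continuousOn_alphaSum (hf : IsLogConcaveDensity f) {l : ℕ} (hl : l < numCells R T) :
    ContinuousOn (fun p => alphaSum R T g (cenBook f R T p) l)
      {p | IsWeakPartition f (numCells R T) p} :=
  continuousOn_finsetSum _ fun _ ht => continuousOn_const.mul
    (continuousOn_cenBook hf (Finset.mem_Icc.1 ht).2 (parent_lt (Finset.mem_Icc.1 ht).2 hl))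

theorem continuousOn_betaSum (hf : IsLogConcaveDensity f) {l : ℕ} (hl : l < numCells R T) :
    ContinuousOn (fun p => betaSum R T g (cenBook f R T p) l)
      {p | IsWeakPartition f (numCells R T) p} :=
  continuousOn_finsetSum _ fun _ ht => continuousOn_const.mul
    ((continuousOn_cenBook hf (Finset.mem_Icc.1 ht).2
      (parent_lt (Finset.mem_Icc.1 ht).2 hl)).pow 2)

theorem continuousOn_levelCost (hf : IsLogConcaveDensity f) :
    ContinuousOn (fun p => levelCost f R T g p (cenBook f R T p))
      {p | IsWeakPartition f (numCells R T) p} := by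
  refine continuousOn_finsetSum _ fun l hl => ?_
  have hl' := Finset.mem_range.1 hl
  exact ((continuousOn_betaSum hf hl').mul
    (continuousOn_setIntegral_slab hf.integrable (Nat.lt_succ_self l) hl')).sub
    ((continuousOn_const.mul (continuousOn_alphaSum hf hl')).mul
    (continuousOn_setIntegral_slab hf.integrable_mul (Nat.lt_succ_self l) hl'))

/-- Dominated convergence. Compactness bounds the slopes and intercepts of all leaf lines uniformly,
and the first absolute moment is finite. -/
theorem continuousOn_envelopeCost (hf : IsLogConcaveDensity f) {S : Set (ℕ → ℝ)}
    (hS : IsCompact S) (hSw : S ⊆ {p | IsWeakPartition f (numCells R T) p}) :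
    ContinuousOn (fun p => envelopeCost f R T g (cenBook f R T p)) S := by
  have hA : ∀ l, ∃ A, ∀ p ∈ S, l < numCells R T →
      |alphaSum R T g (cenBook f R T p) l| ≤ A := fun l => by
    by_cases hl : l < numCells R T
    · obtain ⟨A, hA⟩ := hS.exists_bound_of_continuousOn
        ((continuousOn_alphaSum (g := g) hf hl).mono hSw)
      exact ⟨A, fun p hp _ => hA p hp⟩
    · exact ⟨0, fun _ _ h => absurd h hl⟩
  have hB : ∀ l, ∃ B, ∀ p ∈ S, l < numCells R T →
      |betaSum R T g (cenBook f R T p) l| ≤ B := fun l => by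
    by_cases hl : l < numCells R T
    · obtain ⟨B, hB⟩ := hS.exists_bound_of_continuousOn
        ((continuousOn_betaSum (g := g) hf hl).mono hSw)
      exact ⟨B, fun p hp _ => hB p hp⟩
    · exact ⟨0, fun _ _ h => absurd h hl⟩
  choose A hA using hA
  choose B hB using hB
  refine continuousOn_of_dominated (bound := fun w =>
      ∑ l ∈ Finset.range (numCells R T), (B l * f w + 2 * A l * ‖w * f w‖)) ?_ ?_ ?_ ?_
  · exact fun p _ => (integrable_leafMin_mul hf).aestronglyMeasurable
  · intro p hp
    refine ae_of_all _ fun w => ?_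
    rw [norm_mul, Real.norm_of_nonneg (hf.nonneg w)]
    refine (mul_le_mul_of_nonneg_right (abs_leafMin_le w) (hf.nonneg w)).trans ?_
    rw [Finset.sum_mul]
    refine Finset.sum_le_sum fun l hl => ?_
    have hl' := Finset.mem_range.1 hl
    rw [norm_mul, Real.norm_of_nonneg (hf.nonneg w), ← mul_assoc, ← add_mul]
    refine mul_le_mul_of_nonneg_right ?_ (hf.nonneg w)
    refine (abs_sub _ _).trans (add_le_add (hB l p hp hl') ?_)
    rw [abs_mul, abs_mul, abs_two]
    exact mul_le_mul_of_nonneg_right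
      (mul_le_mul_of_nonneg_left (hA l p hp hl') (by norm_num)) (abs_nonneg w)
  · exact integrable_finsetSum _ fun l _ =>
      (hf.integrable.const_mul _).add (hf.integrable_mul.norm.const_mul _)
  · refine ae_of_all _ fun w => ContinuousOn.mul ?_ continuousOn_const
    refine ContinuousOn.finset_inf'_apply _ fun l hl => ?_
    have hl' := Finset.mem_range.1 hl
    exact ((continuousOn_betaSum hf hl').mono hSw).sub
      ((continuousOn_const.mul ((continuousOn_alphaSum hf hl').mono hSw)).mul continuousOn_const)

end Continuity

/-! ### Invariant boxes -/

namespace IsLogConcaveDensity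

variable {f : ℝ → ℝ}

theorem exists_gt_cen (hf : IsLogConcaveDensity f) {A : Set ℝ} (hA : MeasurableSet A)
    (h : 0 < mass f A) : ∃ x, cen f A < x ∧ 0 < f x := by
  by_contra! hn
  have hz : ∀ x ∈ A \ (A ∩ Set.Iic (cen f A)), f x = 0 := fun x hx =>
    le_antisymm (hn x (not_le.1 fun hle => hx.2 ⟨hx.1, hle⟩)) (hf.nonneg x)
  have e0 : mass f A = mass f (A ∩ Set.Iic (cen f A)) :=
    setIntegral_eq_of_subset_of_forall_sdiff_eq_zero hA Set.inter_subset_left hz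
  have e1 : mom f A = mom f (A ∩ Set.Iic (cen f A)) :=
    setIntegral_eq_of_subset_of_forall_sdiff_eq_zero hA Set.inter_subset_left
      fun x hx => by rw [hz x hx, mul_zero]
  have := hf.cen_lt (hA.inter measurableSet_Iic) (v := cen f A) (fun x hx => hx.2) (e0 ▸ h)
  change mom f _ / mass f _ < _ at this
  rw [← e0, ← e1] at this
  exact lt_irrefl _ this

theorem exists_lt_cen (hf : IsLogConcaveDensity f) {A : Set ℝ} (hA : MeasurableSet A)
    (h : 0 < mass f A) : ∃ x, x < cen f A ∧ 0 < f x := by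
  by_contra! hn
  have hz : ∀ x ∈ A \ (A ∩ Set.Ici (cen f A)), f x = 0 := fun x hx =>
    le_antisymm (hn x (not_le.1 fun hle => hx.2 ⟨hx.1, hle⟩)) (hf.nonneg x)
  have e0 : mass f A = mass f (A ∩ Set.Ici (cen f A)) :=
    setIntegral_eq_of_subset_of_forall_sdiff_eq_zero hA Set.inter_subset_left hz
  have e1 : mom f A = mom f (A ∩ Set.Ici (cen f A)) :=
    setIntegral_eq_of_subset_of_forall_sdiff_eq_zero hA Set.inter_subset_left
      fun x hx => by rw [hz x hx, mul_zero]
  have := hf.lt_cen (hA.inter measurableSet_Ici) (u := cen f A) (fun x hx => hx.2) (e0 ▸ h)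
  change _ < mom f _ / mass f _ at this
  rw [← e0, ← e1] at this
  exact lt_irrefl _ this

theorem isInner_cen (hf : IsLogConcaveDensity f) {A : Set ℝ} (hA : MeasurableSet A)
    (h : 0 < mass f A) : IsInner f (cen f A) := by
  obtain ⟨x, hx, hx'⟩ := hf.exists_lt_cen hA h
  obtain ⟨y, hy, hy'⟩ := hf.exists_gt_cen hA h
  have hpos : ∀ w ∈ Set.Icc x y, 0 < f w := fun w hw => hf.logConcave.pos_of_mem_Icc hx' hy' hw
  exact ⟨hf.mass_pos_of_Ioo_subset hx (fun z hz => hz.2)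
      fun z hz => hpos z ⟨hz.1.le, hz.2.le.trans hy.le⟩,
    hf.mass_pos_of_Ioo_subset hy (fun z hz => hz.1.le)
      fun z hz => hpos z ⟨hx.le.trans hz.1.le, hz.2.le⟩⟩

theorem isInner_cen_univ (hf : IsLogConcaveDensity f) : IsInner f (cen f Set.univ) :=
  hf.isInner_cen MeasurableSet.univ (by rw [hf.mass_univ]; exact one_pos)

/-- A barrier for upper levels: the midpoint of `K` and the centroid of the tail from `y` does not
exceed `y`. -/
theorem exists_add_cen_Ici_le (hf : IsLogConcaveDensity f) {M K : ℝ} (hM : IsInner f M)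
    (hK : IsInner f K) : ∃ y, IsInner f y ∧ M ≤ y ∧ K + cen f (Set.Ici y) ≤ 2 * y := by
  by_cases hall : ∀ x, M ≤ x → IsInner f x
  -- The support is unbounded above. The distance from `y` to the centroid of its tail does not
  -- exceed the one at `M`, so it is enough that `y - K` exceeds the latter.
  · set y := max M (K + (cen f (Set.Ici M) - M)) with hy
    have hMy : M ≤ y := le_max_left _ _
    refine ⟨y, hall y hMy, hMy, ?_⟩
    have h := hf.cen_le_add (δ := y - M) (sub_nonneg.2 hMy) measurableSet_Ici measurableSet_Ici
      (A := Set.Ici M) (B := Set.Ici y) (fun x hx w hw _ => by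
        simp only [Set.mem_Ici] at *
        constructor <;> linarith) hM.2 (hall y hMy).2
    have : K + (cen f (Set.Ici M) - M) ≤ y := le_max_right _ _
    linarith
  · push Not at hall
    obtain ⟨b, hMb, hb⟩ := hall
    have hbdd : BddAbove {x | IsInner f x} := ⟨b, fun x hx => le_of_not_ge fun hbx =>
      hb (hf.isInner_of_mem_Icc hM hx ⟨hMb, hbx⟩)⟩
    obtain ⟨K', hK', hKK'⟩ := ((((hf.eventually_isInner hK).filter_mono
      nhdsWithin_le_nhds).and self_mem_nhdsWithin : ∀ᶠ x in 𝓝[>] K, IsInner f x ∧ x ∈ Set.Ioi K)).exists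
    have h1 : K < sSup {x | IsInner f x} := lt_of_lt_of_le hKK' (le_csSup hbdd hK')
    -- The support ends at the supremum, which also bounds the tail centroid. A point beyond the
    -- midpoint of `K` and the supremum works.
    obtain ⟨y₀, hy₀, hlt⟩ := exists_lt_of_lt_csSup ⟨M, hM⟩
      (show (sSup {x | IsInner f x} + K) / 2 < sSup {x | IsInner f x} by linarith)
    have hin : IsInner f (max M y₀) := by
      rcases max_choice M y₀ with h | h <;> rw [h]
      · exact hM
      · exact hy₀
    refine ⟨max M y₀, hin, le_max_left _ _, ?_⟩
    have h2 := le_csSup hbdd (hf.isInner_cen measurableSet_Ici hin.2)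
    have h3 : y₀ ≤ max M y₀ := le_max_right _ _
    linarith

theorem exists_le_add_cen_Iio (hf : IsLogConcaveDensity f) {M K : ℝ} (hM : IsInner f M)
    (hK : IsInner f K) : ∃ z, IsInner f z ∧ z ≤ M ∧ 2 * z ≤ K + cen f (Set.Iio z) := by
  by_cases hall : ∀ x, x ≤ M → IsInner f x
  · set z := min M (K - (M - cen f (Set.Iio M))) with hz
    have hzM : z ≤ M := min_le_left _ _
    refine ⟨z, hall z hzM, hzM, ?_⟩
    have h := hf.cen_le_add (δ := M - z) (sub_nonneg.2 hzM) measurableSet_Iio measurableSet_Iio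
      (A := Set.Iio z) (B := Set.Iio M) (fun x hx w hw _ => by
        simp only [Set.mem_Iio] at *
        constructor <;> linarith) (hall z hzM).1 hM.1
    have : z ≤ K - (M - cen f (Set.Iio M)) := min_le_right _ _
    linarith
  · push Not at hall
    obtain ⟨b, hMb, hb⟩ := hall
    have hbdd : BddBelow {x | IsInner f x} := ⟨b, fun x hx => le_of_not_ge fun hbx =>
      hb (hf.isInner_of_mem_Icc hx hM ⟨hbx, hMb⟩)⟩
    obtain ⟨K', hK', hKK'⟩ := ((((hf.eventually_isInner hK).filter_mono
      nhdsWithin_le_nhds).and self_mem_nhdsWithin : ∀ᶠ x in 𝓝[<] K, IsInner f x ∧ x ∈ Set.Iio K)).exists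
    have h1 : sInf {x | IsInner f x} < K := lt_of_le_of_lt (csInf_le hbdd hK') hKK'
    obtain ⟨z₀, hz₀, hlt⟩ := exists_lt_of_csInf_lt ⟨M, hM⟩
      (show sInf {x | IsInner f x} < (sInf {x | IsInner f x} + K) / 2 by linarith)
    have hin : IsInner f (min M z₀) := by
      rcases min_choice M z₀ with h | h <;> rw [h]
      · exact hM
      · exact hz₀
    refine ⟨min M z₀, hin, min_le_left _ _, ?_⟩
    have h2 := csInf_le hbdd (hf.isInner_cen measurableSet_Iio hin.1)
    have h3 : min M z₀ ≤ z₀ := min_le_right _ _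
    linarith

end IsLogConcaveDensity

/-- Bounds on the levels that weighted nearest neighbor steps preserve. -/
structure IsBox (f : ℝ → ℝ) (N : ℕ) (z y : ℕ → ℝ) : Prop where
  inner_lower : ∀ l, 1 ≤ l → l < N → IsInner f (z l)
  inner_upper : ∀ l, 1 ≤ l → l < N → IsInner f (y l)
  lower_mono : ∀ l, 1 ≤ l → l + 1 < N → z l ≤ z (l + 1)
  upper : ∀ l, 1 ≤ l → l < N →
    (if l = 1 then cen f Set.univ else cen f (Set.Ici (y (l - 1)))) + cen f (Set.Ici (y l))
      ≤ 2 * y l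
  lower : ∀ l, 1 ≤ l → l < N →
    2 * z l ≤ (if l + 1 = N then cen f Set.univ else cen f (Set.Iio (z (l + 1))))
      + cen f (Set.Iio (z l))

/-- The upper bounds are built from left to right, each with the tail centroid of the previous one
as `K`, and the lower bounds from right to left. Each lower bound is also placed below the previous
one, which gives their monotonicity. -/
theorem exists_isBox {f : ℝ → ℝ} (hf : IsLogConcaveDensity f) (N : ℕ) {m M : ℝ}
    (hm : IsInner f m) (hM : IsInner f M) :
    ∃ z y, IsBox f N z y ∧ ∀ l, 1 ≤ l → l < N → z l ≤ m ∧ M ≤ y l := by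
  have hup : ∃ Y : ℕ → ℝ, (∀ n, IsInner f (Y n) ∧ M ≤ Y n) ∧
      cen f Set.univ + cen f (Set.Ici (Y 0)) ≤ 2 * Y 0 ∧
      ∀ n, cen f (Set.Ici (Y n)) + cen f (Set.Ici (Y (n + 1))) ≤ 2 * Y (n + 1) := by
    choose! φ h1 h2 h3 using fun K (hK : IsInner f K) => hf.exists_add_cen_Ici_le hM hK
    let Y : ℕ → ℝ := fun n => Nat.rec (φ (cen f Set.univ)) (fun _ r => φ (cen f (Set.Ici r))) n
    have hi : ∀ n, IsInner f (Y n) := by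
      intro n
      induction n with
      | zero => exact h1 _ hf.isInner_cen_univ
      | succ n ih => exact h1 _ (hf.isInner_cen measurableSet_Ici ih.2)
    refine ⟨Y, fun n => ⟨hi n, ?_⟩, h3 _ hf.isInner_cen_univ,
      fun n => h3 _ (hf.isInner_cen measurableSet_Ici (hi n).2)⟩
    cases n with
    | zero => exact h2 _ hf.isInner_cen_univ
    | succ n => exact h2 _ (hf.isInner_cen measurableSet_Ici (hi n).2)
  have hlo : ∃ Z : ℕ → ℝ, (∀ n, IsInner f (Z n) ∧ Z n ≤ m) ∧ (∀ n, Z (n + 1) ≤ Z n) ∧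
      2 * Z 0 ≤ cen f Set.univ + cen f (Set.Iio (Z 0)) ∧
      ∀ n, 2 * Z (n + 1) ≤ cen f (Set.Iio (Z n)) + cen f (Set.Iio (Z (n + 1))) := by
    choose! φ h1 h2 h3 using fun M' (hM' : IsInner f M') K (hK : IsInner f K) =>
      hf.exists_le_add_cen_Iio hM' hK
    let Z : ℕ → ℝ := fun n => Nat.rec (φ m (cen f Set.univ)) (fun _ r => φ r (cen f (Set.Iio r))) n
    have hi : ∀ n, IsInner f (Z n) := by
      intro n
      induction n with
      | zero => exact h1 _ hm _ hf.isInner_cen_univ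
      | succ n ih => exact h1 _ ih _ (hf.isInner_cen measurableSet_Iio ih.1)
    have hanti : ∀ n, Z (n + 1) ≤ Z n := fun n =>
      h2 _ (hi n) _ (hf.isInner_cen measurableSet_Iio (hi n).1)
    refine ⟨Z, fun n => ⟨hi n, ?_⟩, hanti, h3 _ hm _ hf.isInner_cen_univ,
      fun n => h3 _ (hi n) _ (hf.isInner_cen measurableSet_Iio (hi n).1)⟩
    induction n with
    | zero => exact h2 _ hm _ hf.isInner_cen_univ
    | succ n ih => exact (hanti n).trans ih
  obtain ⟨Y, hY, hY0, hYs⟩ := hup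
  obtain ⟨Z, hZ, hZa, hZ0, hZs⟩ := hlo
  -- The two recursions start at opposite ends: `Y 0` belongs to level `1` and `Z 0` to level `N -
  -- 1`.
  refine ⟨fun l => Z (N - 1 - l), fun l => Y (l - 1),
    ⟨fun l _ _ => (hZ _).1, fun l _ _ => (hY _).1, fun l h1 h2 => ?_, fun l h1 h2 => ?_,
      fun l h1 h2 => ?_⟩, fun l _ _ => ⟨(hZ _).2, (hY _).2⟩⟩
  · have := hZa (N - 1 - (l + 1))
    rwa [show N - 1 - (l + 1) + 1 = N - 1 - l by omega] at this
  · split_ifs with h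
    · simpa [h] using hY0
    · have := hYs (l - 1 - 1)
      rwa [show l - 1 - 1 + 1 = l - 1 by omega] at this
  · split_ifs with h
    · simpa [show N - 1 - l = 0 by omega] using hZ0
    · have := hZs (N - 1 - (l + 1))
      rwa [show N - 1 - (l + 1) + 1 = N - 1 - l by omega] at this

/-! ### The optimal levels -/

section Congr

variable {f : ℝ → ℝ} {R : ℕ → ℕ} {T : ℕ} {p p' : ℕ → ℝ} {g : ℕ → ℝ} {c c' : ℕ → ℕ → ℝ}

theorem slabCen_congr (hf : IsLogConcaveDensity f) {N : ℕ} (hp : IsWeakPartition f N p)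
    (h : ∀ l ∈ Finset.Icc 1 (N - 1), p l = p' l) {j k : ℕ} (hjk : j < k) (hk : k ≤ N) :
    slabCen f N p j k = slabCen f N p' j k := by
  have e := slab_congr h (show j < N by omega) hk (by omega)
  unfold slabCen
  rw [← e]
  split_ifs with h0
  · have : j ≠ 0 := fun hj => (hp.mass_slab_pos hf hjk hk (Or.inl hj)).ne' h0
    exact h j (Finset.mem_Icc.2 ⟨by omega, by omega⟩)
  · rfl

theorem cenBook_congr (hf : IsLogConcaveDensity f) (hp : IsWeakPartition f (numCells R T) p)
    (h : ∀ l ∈ Finset.Icc 1 (numCells R T - 1), p l = p' l) {t m : ℕ} (ht : t ∈ Finset.Icc 1 T)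
    (hm : m < 2 ^ cumRate R t) : cenBook f R T p t m = cenBook f R T p' t m := by
  refine slabCen_congr hf hp h
    (Nat.mul_lt_mul_of_pos_right (Nat.lt_succ_self m) (by positivity)) ?_
  rw [← pow_mul_pow_eq_numCells (Finset.mem_Icc.1 ht).2]
  exact Nat.mul_le_mul_right _ hm

theorem alphaSum_congr (hc : ∀ t ∈ Finset.Icc 1 T, ∀ m < 2 ^ cumRate R t, c t m = c' t m) {l : ℕ}
    (hl : l < numCells R T) : alphaSum R T g c l = alphaSum R T g c' l :=
  Finset.sum_congr rfl fun t ht => by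
    rw [hc t ht _ (parent_lt (Finset.mem_Icc.1 ht).2 hl)]

theorem betaSum_congr (hc : ∀ t ∈ Finset.Icc 1 T, ∀ m < 2 ^ cumRate R t, c t m = c' t m) {l : ℕ}
    (hl : l < numCells R T) : betaSum R T g c l = betaSum R T g c' l :=
  Finset.sum_congr rfl fun t ht => by
    rw [hc t ht _ (parent_lt (Finset.mem_Icc.1 ht).2 hl)]

theorem leafLine_congr (hc : ∀ t ∈ Finset.Icc 1 T, ∀ m < 2 ^ cumRate R t, c t m = c' t m) {l : ℕ}
    (hl : l < numCells R T) : leafLine R T g c l = leafLine R T g c' l := by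
  funext w
  rw [leafLine, leafLine, alphaSum_congr hc hl, betaSum_congr hc hl]

theorem levelCost_congr (h : ∀ l ∈ Finset.Icc 1 (numCells R T - 1), p l = p' l)
    (hc : ∀ t ∈ Finset.Icc 1 T, ∀ m < 2 ^ cumRate R t, c t m = c' t m) :
    levelCost f R T g p c = levelCost f R T g p' c' :=
  Finset.sum_congr rfl fun l hl => by
    have hl' := Finset.mem_range.1 hl
    rw [alphaSum_congr hc hl', betaSum_congr hc hl', slab_congr h hl' hl' (Nat.succ_pos l)]

theorem envelopeCost_congr (hc : ∀ t ∈ Finset.Icc 1 T, ∀ m < 2 ^ cumRate R t, c t m = c' t m) :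
    envelopeCost f R T g c = envelopeCost f R T g c' := by
  have : leafMin R T g c = leafMin R T g c' := by
    funext w
    exact Finset.inf'_congr _ rfl fun l hl => by rw [leafLine_congr hc (Finset.mem_range.1 hl)]
  rw [envelopeCost, envelopeCost, this]

end Congr

/-- Weakly ordered levels between `z` and `y`. -/
def boxSet (N : ℕ) (z y : ℕ → ℝ) : Set (ℕ → ℝ) :=
  (Set.univ.pi fun l => if 1 ≤ l ∧ l < N then Set.Icc (z l) (y l) else {0}) ∩
    {p | ∀ j k, 1 ≤ j → j ≤ k → k < N → p j ≤ p k}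

theorem isCompact_boxSet (N : ℕ) (z y : ℕ → ℝ) : IsCompact (boxSet N z y) := by
  refine IsCompact.inter_right (isCompact_univ_pi fun l => ?_) ?_
  · split_ifs
    · exact isCompact_Icc
    · exact isCompact_singleton
  · simp only [Set.ofPred_forall]
    refine isClosed_iInter fun j => isClosed_iInter fun k => isClosed_iInter fun _ =>
      isClosed_iInter fun _ => isClosed_iInter fun _ => ?_
    exact isClosed_le (continuous_apply j) (continuous_apply k)

theorem mem_boxSet {N : ℕ} {z y p : ℕ → ℝ} (h : p ∈ boxSet N z y) {l : ℕ} (h1 : 1 ≤ l)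
    (h2 : l < N) : z l ≤ p l ∧ p l ≤ y l := by
  have := h.1 l (Set.mem_univ l)
  simp only [if_pos (And.intro h1 h2)] at this
  exact this

/-- The levels of a partition, set to `0` outside the relevant range. -/
def clip (N : ℕ) (p : ℕ → ℝ) (l : ℕ) : ℝ := if 1 ≤ l ∧ l < N then p l else 0

theorem clip_eq {N : ℕ} (p : ℕ → ℝ) {l : ℕ} (h : l ∈ Finset.Icc 1 (N - 1)) : p l = clip N p l := by
  obtain ⟨h1, h2⟩ := Finset.mem_Icc.1 h
  rw [clip, if_pos ⟨h1, by omega⟩]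

theorem clip_mem_boxSet {N : ℕ} {z y p : ℕ → ℝ}
    (h : ∀ l, 1 ≤ l → l < N → z l ≤ p l ∧ p l ≤ y l)
    (hm : ∀ j k, 1 ≤ j → j ≤ k → k < N → p j ≤ p k) : clip N p ∈ boxSet N z y := by
  refine ⟨fun l _ => ?_, fun j k h1 h2 h3 => ?_⟩
  · by_cases h0 : 1 ≤ l ∧ l < N
    · simp only [clip, if_pos h0]
      exact h l h0.1 h0.2
    · simp [clip, if_neg h0]
  · rw [clip, clip, if_pos ⟨h1, by omega⟩, if_pos ⟨by omega, h3⟩]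
    exact hm j k h1 h2 h3

/-! ### Nearest neighbor levels in a box and minimizers there -/

section Box

variable {f : ℝ → ℝ} {N : ℕ} {z y p : ℕ → ℝ}

theorem IsBox.isWeakPartition (hf : IsLogConcaveDensity f) (hb : IsBox f N z y)
    (hp : p ∈ boxSet N z y) : IsWeakPartition f N p :=
  ⟨hp.2, fun l h1 h2 => hf.isInner_of_mem_Icc (hb.inner_lower l h1 h2) (hb.inner_upper l h1 h2)
    (mem_boxSet hp h1 h2)⟩

theorem slabCen_le_cen_Ici (hf : IsLogConcaveDensity f) (hp : IsWeakPartition f N p) {j k : ℕ}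
    (hjk : j < k) (hk : k ≤ N) {u : ℝ} (hu : IsInner f u) (h : j = 0 ∨ p j ≤ u) :
    slabCen f N p j k ≤ cen f (Set.Ici u) := by
  by_cases h0 : mass f (slab N p j k) = 0
  · have hj : j ≠ 0 := fun hj => (hp.mass_slab_pos hf hjk hk (Or.inl hj)).ne' h0
    rw [slabCen, if_pos h0]
    exact (h.resolve_left hj).trans
      (hf.lt_cen measurableSet_Ici (fun _ hx => hx) hu.2).le
  · have hpos := lt_of_le_of_ne (hf.mass_nonneg _) (Ne.symm h0)
    rw [slabCen_of_pos hpos]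
    refine hf.cen_mono measurableSet_Ici (measurableSet_slab _ _ _ _) ?_ hu.2 hpos
    intro x hx w hw hxw
    have hx' : u ≤ x := hx
    exact ⟨⟨h.imp_right fun h => h.trans hx', hw.2.imp_right fun h => hxw.trans_lt h⟩,
      hx'.trans hxw⟩

theorem cen_Iio_le_slabCen (hf : IsLogConcaveDensity f) (hp : IsWeakPartition f N p) {j k : ℕ}
    (hjk : j < k) (hk : k ≤ N) {u : ℝ} (hu : IsInner f u) (h : k = N ∨ u ≤ p k) :
    cen f (Set.Iio u) ≤ slabCen f N p j k := by
  by_cases h0 : mass f (slab N p j k) = 0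
  · have hj : j ≠ 0 := fun hj => (hp.mass_slab_pos hf hjk hk (Or.inl hj)).ne' h0
    have hkN : k ≠ N := fun hkN => (hp.mass_slab_pos hf hjk hk (Or.inr (Or.inl hkN))).ne' h0
    have hle : p k ≤ p j := not_lt.1 fun hlt =>
      (hp.mass_slab_pos hf hjk hk (Or.inr (Or.inr hlt))).ne' h0
    rw [slabCen, if_pos h0]
    exact (hf.cen_lt measurableSet_Iio (fun _ hx => le_of_lt hx) hu.1).le.trans
      ((h.resolve_left hkN).trans hle)
  · have hpos := lt_of_le_of_ne (hf.mass_nonneg _) (Ne.symm h0)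
    rw [slabCen_of_pos hpos]
    refine hf.cen_mono (measurableSet_slab _ _ _ _) measurableSet_Iio ?_ hpos hu.1
    intro x hx w hw hxw
    have hw' : w < u := hw
    exact ⟨hxw.trans_lt hw', hx.1.imp_right fun h => h.trans hxw,
      h.imp_right fun h => hw'.trans_le h⟩

theorem slabCen_zero_le (hf : IsLogConcaveDensity f) (hp : IsWeakPartition f N p) {k : ℕ}
    (hk0 : 0 < k) (hk : k ≤ N) : slabCen f N p 0 k ≤ cen f Set.univ := by
  have hpos := hp.mass_slab_pos hf hk0 hk (Or.inl rfl)
  rw [slabCen_of_pos hpos]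
  refine hf.cen_mono MeasurableSet.univ (measurableSet_slab _ _ _ _) ?_
    (by rw [hf.mass_univ]; exact one_pos) hpos
  exact fun x _ w hw hxw => ⟨⟨Or.inl rfl, hw.2.imp_right fun h => hxw.trans_lt h⟩, trivial⟩

theorem le_slabCen_last (hf : IsLogConcaveDensity f) (hp : IsWeakPartition f N p) {j : ℕ}
    (hj : j < N) : cen f Set.univ ≤ slabCen f N p j N := by
  have hpos := hp.mass_slab_pos hf hj le_rfl (Or.inr (Or.inl rfl))
  rw [slabCen_of_pos hpos]
  refine hf.cen_mono (measurableSet_slab _ _ _ _) MeasurableSet.univ ?_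
    hpos (by rw [hf.mass_univ]; exact one_pos)
  exact fun x hx w _ hxw => ⟨trivial, hx.1.imp_right fun h => h.trans hxw, Or.inl rfl⟩

variable {R : ℕ → ℕ} {T : ℕ} {g : ℕ → ℝ}

/-- In each stage that separates `i` from `l`, the two centroids are bounded by the tail centroids
in `IsBox.upper`, so their midpoint is at most `y l`. At `y l` the right leaf is therefore no worse,
and the crossing lies to the left. -/
theorem IsBox.leafLine_upper_le (hf : IsLogConcaveDensity f) (hg : IsWeight R T g)
    (hb : IsBox f (numCells R T) z y) (hp : IsWeakPartition f (numCells R T) p)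
    (hle : ∀ l, 1 ≤ l → l < numCells R T → p l ≤ y l) {i l : ℕ} (hil : i < l)
    (hl : l < numCells R T) :
    leafLine R T g (cenBook f R T p) l (y l) ≤ leafLine R T g (cenBook f R T p) i (y l) := by
  rw [← sub_nonneg, leafLine_sub]
  refine Finset.sum_nonneg fun t ht => mul_nonneg (hg.nonneg t ht) ?_
  have htT := (Finset.mem_Icc.1 ht).2
  by_cases hne : parent R T t i = parent R T t l
  · rw [hne]; simp
  refine mul_nonneg (sub_nonneg.2 (cenBook_mono hf hp t hil.le hl)) ?_
  have h1 := blockHi_le_blockLo hil.le hne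
  have h2 := blockLo_le (R := R) (T := T) t l
  have h3 := lt_blockHi (R := R) (T := T) t i
  have h4 := blockLo_le (R := R) (T := T) t i
  have a1 : cenBook f R T p t (parent R T t l) ≤ cen f (Set.Ici (y l)) :=
    slabCen_le_cen_Ici hf hp (blockLo_lt_blockHi t l) (blockHi_le htT hl)
      (hb.inner_upper l (by omega) hl)
      (Or.inr ((hp.mono _ _ (by omega) h2 hl).trans (hle l (by omega) hl)))
  have a2 := hb.upper l (by omega) hl
  have a3 : cenBook f R T p t (parent R T t i)
      ≤ if l = 1 then cen f Set.univ else cen f (Set.Ici (y (l - 1))) := by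
    rw [cenBook_parent]
    split_ifs with hl1
    · rw [show blockLo R T t i = 0 by omega]
      exact slabCen_zero_le hf hp (by omega) (by omega)
    · refine slabCen_le_cen_Ici hf hp (blockLo_lt_blockHi t i) (by omega)
        (hb.inner_upper (l - 1) (by omega) (by omega)) ?_
      by_cases h0 : blockLo R T t i = 0
      · exact Or.inl h0
      · exact Or.inr ((hp.mono _ (l - 1) (by omega) (by omega) (by omega)).trans
          (hle _ (by omega) (by omega)))
  linarith

theorem IsBox.leafLine_lower_le (hf : IsLogConcaveDensity f) (hg : IsWeight R T g)
    (hb : IsBox f (numCells R T) z y) (hp : IsWeakPartition f (numCells R T) p)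
    (hle : ∀ l, 1 ≤ l → l < numCells R T → z l ≤ p l) {i l : ℕ} (hl1 : 1 ≤ l) (hil : l ≤ i)
    (hi : i < numCells R T) :
    leafLine R T g (cenBook f R T p) (l - 1) (z l)
      ≤ leafLine R T g (cenBook f R T p) i (z l) := by
  rw [← sub_nonneg, leafLine_sub]
  refine Finset.sum_nonneg fun t ht => mul_nonneg (hg.nonneg t ht) ?_
  have htT := (Finset.mem_Icc.1 ht).2
  by_cases hne : parent R T t (l - 1) = parent R T t i
  · rw [hne]; simp
  refine mul_nonneg_of_nonpos_of_nonpos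
    (sub_nonpos.2 (cenBook_mono hf hp t (show l - 1 ≤ i by omega) hi)) ?_
  have h1 := blockHi_le_blockLo (show l - 1 ≤ i by omega) hne
  have h2 := blockLo_le (R := R) (T := T) t i
  have h3 := lt_blockHi (R := R) (T := T) t (l - 1)
  have h4 := lt_blockHi (R := R) (T := T) t i
  have h5 := blockHi_le (R := R) htT hi
  have a1 : cen f (Set.Iio (z l)) ≤ cenBook f R T p t (parent R T t (l - 1)) :=
    cen_Iio_le_slabCen hf hp (blockLo_lt_blockHi t (l - 1)) (by omega)
      (hb.inner_lower l hl1 (by omega))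
      (Or.inr ((hle l hl1 (by omega)).trans (hp.mono l _ hl1 (by omega) (by omega))))
  have a2 := hb.lower l hl1 (by omega)
  have a3 : (if l + 1 = numCells R T then cen f Set.univ else cen f (Set.Iio (z (l + 1))))
      ≤ cenBook f R T p t (parent R T t i) := by
    rw [cenBook_parent]
    split_ifs with hlN
    · rw [show blockHi R T t i = numCells R T by omega]
      exact le_slabCen_last hf hp (by omega)
    · refine cen_Iio_le_slabCen hf hp (blockLo_lt_blockHi t i) h5
        (hb.inner_lower (l + 1) (by omega) (by omega)) ?_
      by_cases h0 : blockHi R T t i = numCells R T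
      · exact Or.inl h0
      · exact Or.inr ((hle _ (by omega) (by omega)).trans
          (hp.mono (l + 1) _ (by omega) (by omega) (by omega)))
  linarith

/-- The weighted nearest neighbor levels of the centroids of levels in a box lie in the box. -/
theorem IsBox.exists_nearest (hf : IsLogConcaveDensity f) (hg : IsWeight R T g)
    (hb : IsBox f (numCells R T) z y) (hp : p ∈ boxSet (numCells R T) z y) :
    ∃ q ∈ boxSet (numCells R T) z y,
      levelCost f R T g q (cenBook f R T p) = envelopeCost f R T g (cenBook f R T p) := by
  have hw := hb.isWeakPartition hf hp
  set N := numCells R T with hN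
  set c := cenBook f R T p with hc
  -- `A l` consists of the points above `z l` at which some leaf from `l` on is no worse than all
  -- earlier leaves. Its infimum is the new level. As the slopes are only weakly ordered here,
  -- crossings of neighboring leaves need not be defined.
  let A : ℕ → Set ℝ := fun l =>
    {w | z l ≤ w ∧ ∃ i, l ≤ i ∧ i < N ∧ ∀ i' < l, leafLine R T g c i w ≤ leafLine R T g c i' w}
  -- Later leaves have steeper descending lines, so an advantage of a later leaf persists to the
  -- right.
  have hline : ∀ {i i' : ℕ} {w w' : ℝ}, i' ≤ i → i < N → w ≤ w' →
      leafLine R T g c i w ≤ leafLine R T g c i' w →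
      leafLine R T g c i w' ≤ leafLine R T g c i' w' := by
    intro i i' w w' h1 h2 h3 h4
    have h5 := alphaSum_mono hf hw hg h1 h2
    simp only [leafLine] at *
    nlinarith [mul_nonneg (sub_nonneg.2 h5) (sub_nonneg.2 h3)]
  have hup : ∀ l w w', w ∈ A l → w ≤ w' → w' ∈ A l := by
    rintro l w w' ⟨h1, i, h2, h3, h4⟩ h5
    exact ⟨h1.trans h5, i, h2, h3, fun i' hi' => hline (by omega) h3 h5 (h4 i' hi')⟩
  have hyA : ∀ l, 1 ≤ l → l < N → y l ∈ A l := fun l h1 h2 =>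
    ⟨(mem_boxSet hp h1 h2).1.trans (mem_boxSet hp h1 h2).2, l, le_rfl, h2, fun i' hi' =>
      hb.leafLine_upper_le hf hg hw (fun l h1 h2 => (mem_boxSet hp h1 h2).2) hi' h2⟩
  have hbdd : ∀ l, BddBelow (A l) := fun l => ⟨z l, fun w hw => hw.1⟩
  let q₀ : ℕ → ℝ := fun l => sInf (A l)
  have hq0 : ∀ l, 1 ≤ l → l < N → z l ≤ q₀ l ∧ q₀ l ≤ y l := fun l h1 h2 =>
    ⟨le_csInf ⟨_, hyA l h1 h2⟩ fun w hw => hw.1, csInf_le (hbdd l) (hyA l h1 h2)⟩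
  have hzmono : ∀ j k, 1 ≤ j → j ≤ k → k < N → z j ≤ z k := by
    intro j k h1 h2
    induction k, h2 using Nat.le_induction with
    | base => exact fun _ => le_rfl
    | succ k hk ih => exact fun h3 => (ih (by omega)).trans (hb.lower_mono k (by omega) h3)
  have hmono : ∀ j k, 1 ≤ j → j ≤ k → k < N → q₀ j ≤ q₀ k := by
    intro j k h1 h2 h3
    refine csInf_le_csInf (hbdd j) ⟨_, hyA k (by omega) h3⟩ ?_
    rintro w ⟨h4, i, h5, h6, h7⟩
    exact ⟨(hzmono j k h1 h2 h3).trans h4, i, by omega, h6, fun i' hi' => h7 i' (by omega)⟩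
  refine ⟨clip N q₀, clip_mem_boxSet hq0 hmono, ?_⟩
  have hqw := hb.isWeakPartition hf (clip_mem_boxSet hq0 hmono)
  refine levelCost_eq_envelopeCost hf hqw fun l hl w hlw hwl i hi => ?_
  have hA : ∃ i, l ≤ i ∧ i < N ∧ ∀ i' < l, leafLine R T g c i w ≤ leafLine R T g c i' w := by
    rcases hlw with h0 | h0
    · exact ⟨l, le_rfl, hl, fun i' hi' => by omega⟩
    · by_cases h00 : l = 0
      · exact ⟨l, le_rfl, hl, fun i' hi' => by omega⟩
      rw [clip, if_pos ⟨by omega, hl⟩] at h0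
      obtain ⟨a, ha, haw⟩ := exists_lt_of_csInf_lt ⟨_, hyA l (by omega) hl⟩ h0
      exact (hup l a w ha haw.le).2
  -- Below the next level there are two cases. Either `w` is below the barrier `z (l + 1)`, and leaf
  -- `l` is no worse than any later leaf, or `w` is not in `A (l + 1)`, and each later leaf is
  -- strictly worse than some leaf up to `l`.
  have hB : (∀ i, l < i → i < N → leafLine R T g c l w ≤ leafLine R T g c i w) ∨
      ∀ i, l < i → i < N → ∃ i' ≤ l, leafLine R T g c i' w < leafLine R T g c i w := by
    by_cases h0 : l + 1 = N
    · exact Or.inl fun i h1 h2 => by omega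
    rcases hwl with h1 | h1
    · exact absurd h1 h0
    rw [clip, if_pos ⟨by omega, by omega⟩] at h1
    rcases lt_or_ge w (z (l + 1)) with h2 | h2
    · refine Or.inl fun i h3 h4 => ?_
      have := hb.leafLine_lower_le hf hg hw (fun l h1 h2 => (mem_boxSet hp h1 h2).1)
        (show 1 ≤ l + 1 by omega) (show l + 1 ≤ i from h3) h4
      rw [Nat.add_sub_cancel] at this
      by_contra hcon
      have h5 := hline h3.le h4 h2.le (not_le.1 hcon).le
      have h6 := alphaSum_mono hf hw hg h3.le h4
      have h7 := le_antisymm this h5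
      simp only [leafLine] at h7 hcon
      rw [← hc] at h6
      nlinarith [mul_nonneg (sub_nonneg.2 h6) (sub_nonneg.2 h2.le)]
    · refine Or.inr fun i h3 h4 => ?_
      by_contra! hcon
      exact absurd (csInf_le (hbdd (l + 1)) ⟨h2, i, h3, h4, fun i' hi' => hcon i' (by omega)⟩)
        (not_le.2 h1)
  obtain ⟨m, hm, hmin⟩ := Finset.exists_min_image (Finset.range N)
    (fun i => leafLine R T g c i w) ⟨0, Finset.mem_range.2 (by omega)⟩
  have hm' := Finset.mem_range.1 hm
  obtain ⟨a, ha1, ha2, ha3⟩ := hA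
  suffices h : leafLine R T g c l w ≤ leafLine R T g c m w from
    h.trans (hmin i (Finset.mem_range.2 hi))
  rcases hB with hB | hB
  · rcases lt_trichotomy m l with h1 | h1 | h1
    · refine le_trans ?_ (ha3 m h1)
      rcases eq_or_lt_of_le ha1 with h2 | h2
      · rw [h2]
      · exact hB a h2 ha2
    · rw [h1]
    · exact hB m h1 hm'
  -- A leaf as good as the minimizer `m` cannot come after `l`. This applies to `m` itself and, if
  -- `m < l`, to the leaf `a`, which is then `l`.
  · have hle : ∀ i, i < N → leafLine R T g c i w ≤ leafLine R T g c m w → i ≤ l := by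
      intro i h1 h2
      by_contra hcon
      obtain ⟨i', h3, h4⟩ := hB i (by omega) h1
      have := hmin i' (Finset.mem_range.2 (by omega))
      linarith
    rcases lt_or_ge m l with h1 | h1
    · have h2 := ha3 m h1
      have h3 := hle a ha2 h2
      rwa [show a = l by omega] at h2
    · rw [show m = l from le_antisymm (hle m hm' le_rfl) h1]

/-- A nearest neighbor step leads to the envelope cost inside the box, and new centroids only
improve on it. A minimizer in the box therefore has gap zero. -/
theorem IsBox.exists_isMinOn (hf : IsLogConcaveDensity f) (hg : IsWeight R T g)
    (hb : IsBox f (numCells R T) z y) (hne : (boxSet (numCells R T) z y).Nonempty) :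
    ∃ p ∈ boxSet (numCells R T) z y,
      levelCost f R T g p (cenBook f R T p) = envelopeCost f R T g (cenBook f R T p) ∧
      ∀ q ∈ boxSet (numCells R T) z y,
        levelCost f R T g p (cenBook f R T p) ≤ levelCost f R T g q (cenBook f R T q) := by
  obtain ⟨p, hp, hmin⟩ := (isCompact_boxSet (numCells R T) z y).exists_isMinOn hne
    ((continuousOn_levelCost (g := g) hf).mono fun q hq => hb.isWeakPartition hf hq)
  refine ⟨p, hp, le_antisymm ?_ (envelopeCost_le hf (hb.isWeakPartition hf hp)),
    fun q hq => hmin hq⟩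
  obtain ⟨q, hq, hqe⟩ := hb.exists_nearest hf hg hp
  rw [← hqe]
  exact (hmin hq).trans (levelCost_cenBook_le hf hg (hb.isWeakPartition hf hq) _)

end Box

/-- Optimal levels: strictly ordered, balanced and of minimal distortion. -/
structure IsOptimal (f : ℝ → ℝ) (R : ℕ → ℕ) (T : ℕ) (g : ℕ → ℝ) (p : ℕ → ℝ) : Prop where
  strict : IsStrictPartition f (numCells R T) p
  balanced : IsBalanced R T g (cenBook f R T p) p
  envelope : levelCost f R T g p (cenBook f R T p) = envelopeCost f R T g (cenBook f R T p)
  le : ∀ q, IsWeakPartition f (numCells R T) q →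
    levelCost f R T g p (cenBook f R T p) ≤ levelCost f R T g q (cenBook f R T q)

/-! ### Existence and isolation of the optimal levels -/

section Optimal

variable {f : ℝ → ℝ} {R : ℕ → ℕ} {T : ℕ} {g : ℕ → ℝ} {p : ℕ → ℝ}

theorem exists_isBox_of_isWeakPartition (hf : IsLogConcaveDensity f) {N : ℕ} {p q : ℕ → ℝ}
    (hp : IsWeakPartition f N p) (hq : IsWeakPartition f N q) :
    ∃ z y, IsBox f N z y ∧ ∀ l, 1 ≤ l → l < N →
      (z l ≤ p l ∧ p l ≤ y l) ∧ z l ≤ q l ∧ q l ≤ y l := by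
  by_cases hN : 1 < N
  · have hm : IsInner f (min (p 1) (q 1)) := by
      rcases min_choice (p 1) (q 1) with h | h <;> rw [h]
      · exact hp.inner 1 le_rfl hN
      · exact hq.inner 1 le_rfl hN
    have hM : IsInner f (max (p (N - 1)) (q (N - 1))) := by
      rcases max_choice (p (N - 1)) (q (N - 1)) with h | h <;> rw [h]
      · exact hp.inner _ (by omega) (by omega)
      · exact hq.inner _ (by omega) (by omega)
    obtain ⟨z, y, hb, h⟩ := exists_isBox hf N hm hM
    refine ⟨z, y, hb, fun l h1 h2 => ?_⟩
    obtain ⟨h3, h4⟩ := h l h1 h2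
    have a1 := hp.mono 1 l le_rfl h1 h2
    have a2 := hq.mono 1 l le_rfl h1 h2
    have a3 := hp.mono l (N - 1) h1 (by omega) (by omega)
    have a4 := hq.mono l (N - 1) h1 (by omega) (by omega)
    exact ⟨⟨h3.trans ((min_le_left _ _).trans a1), a3.trans ((le_max_left _ _).trans h4)⟩,
      h3.trans ((min_le_right _ _).trans a2), a4.trans ((le_max_right _ _).trans h4)⟩
  · obtain ⟨z, y, hb, -⟩ := exists_isBox hf N hf.isInner_cen_univ hf.isInner_cen_univ
    exact ⟨z, y, hb, fun l h1 h2 => by omega⟩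

theorem levelCost_cenBook_congr (hf : IsLogConcaveDensity f)
    (hp : IsWeakPartition f (numCells R T) p) {p' : ℕ → ℝ}
    (h : ∀ l ∈ Finset.Icc 1 (numCells R T - 1), p l = p' l) :
    levelCost f R T g p (cenBook f R T p) = levelCost f R T g p' (cenBook f R T p') :=
  levelCost_congr h fun _ ht _ hm => cenBook_congr hf hp h ht hm

/-- A minimizer in one box is balanced. Any competitor shares a box with it, the minimizer of that
box is balanced too, and by uniqueness the two minimizers coincide. So the minimizer is global. -/
theorem exists_isOptimal (hf : IsLogConcaveDensity f) (hg : IsWeight R T g) :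
    ∃ p, IsOptimal f R T g p := by
  have key : ∀ z y, IsBox f (numCells R T) z y → (boxSet (numCells R T) z y).Nonempty →
      ∃ p ∈ boxSet (numCells R T) z y, IsStrictPartition f (numCells R T) p ∧
        IsBalanced R T g (cenBook f R T p) p ∧
        levelCost f R T g p (cenBook f R T p) = envelopeCost f R T g (cenBook f R T p) ∧
        ∀ q ∈ boxSet (numCells R T) z y,
          levelCost f R T g p (cenBook f R T p) ≤ levelCost f R T g q (cenBook f R T q) := by
    intro z y hb hne
    obtain ⟨p, hp, he, hle⟩ := hb.exists_isMinOn hf hg hne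
    have hs := isStrictPartition_of_levelCost_eq hf hg (hb.isWeakPartition hf hp) he
    exact ⟨p, hp, hs, isBalanced_of_levelCost_eq hf hs he, he, hle⟩
  obtain ⟨z, y, hb, h⟩ := exists_isBox hf (numCells R T) hf.isInner_cen_univ hf.isInner_cen_univ
  obtain ⟨p, hp, hs, hbal, he, -⟩ := key z y hb ⟨_, clip_mem_boxSet (p := fun _ => cen f Set.univ)
    h fun _ _ _ _ _ => le_rfl⟩
  refine ⟨p, hs, hbal, he, fun q hq => ?_⟩
  obtain ⟨z', y', hb', h'⟩ := exists_isBox_of_isWeakPartition hf hs.toIsWeakPartition hq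
  have hqm : clip (numCells R T) q ∈ boxSet (numCells R T) z' y' :=
    clip_mem_boxSet (fun l h1 h2 => (h' l h1 h2).2) hq.mono
  obtain ⟨p₂, hp₂, hs₂, hbal₂, -, hle₂⟩ := key z' y' hb' ⟨_, hqm⟩
  have he₂ : ∀ l ∈ Finset.Icc 1 (numCells R T - 1), p l = p₂ l := fun l hl => by
    obtain ⟨h1, h2⟩ := Finset.mem_Icc.1 hl
    exact IsBalanced.unique hf hg hs₂ hs hbal₂ hbal h1 (by omega)
  rw [levelCost_cenBook_congr hf hs.toIsWeakPartition he₂,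
    levelCost_cenBook_congr hf hq fun l hl => clip_eq q hl]
  exact hle₂ _ hqm

/-- Levels in a box whose distortion is close to the envelope are close to the optimal ones. -/
theorem IsOptimal.exists_gap (hf : IsLogConcaveDensity f) (hg : IsWeight R T g)
    (hp : IsOptimal f R T g p) {z y : ℕ → ℝ} (hb : IsBox f (numCells R T) z y) {ε : ℝ}
    (hε : 0 < ε) :
    ∃ η > 0, ∀ q, IsWeakPartition f (numCells R T) q →
      (∀ l, 1 ≤ l → l < numCells R T → z l ≤ q l ∧ q l ≤ y l) →
      levelCost f R T g q (cenBook f R T q) - envelopeCost f R T g (cenBook f R T q) < η →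
      (∀ l ∈ Finset.Icc 1 (numCells R T - 1), |q l - p l| < ε) ∧
      (∀ t ∈ Finset.Icc 1 T, ∀ m < 2 ^ cumRate R t,
        |cenBook f R T q t m - cenBook f R T p t m| < ε) ∧
      levelCost f R T g q (cenBook f R T q) < levelCost f R T g p (cenBook f R T p) + ε := by
  set N := numCells R T with hN
  -- One continuous function controls all three distances, so the points of the box that are not
  -- close form a compact set.
  set h : (ℕ → ℝ) → ℝ := fun q => (∑ l ∈ Finset.Icc 1 (N - 1), |q l - p l|) +
    (∑ t ∈ Finset.Icc 1 T, ∑ m ∈ Finset.range (2 ^ cumRate R t),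
      |cenBook f R T q t m - cenBook f R T p t m|) +
    |levelCost f R T g q (cenBook f R T q) - levelCost f R T g p (cenBook f R T p)| with hh
  have hS := isCompact_boxSet N z y
  have hSw : boxSet N z y ⊆ {q | IsWeakPartition f N q} := fun q hq => hb.isWeakPartition hf hq
  have hcont : ContinuousOn h (boxSet N z y) := by
    refine ContinuousOn.add (ContinuousOn.add ?_ ?_) ?_
    · exact Continuous.continuousOn (by fun_prop)
    · refine continuousOn_finsetSum _ fun t ht => continuousOn_finsetSum _ fun m hm => ?_
      exact (((continuousOn_cenBook hf (Finset.mem_Icc.1 ht).2 (Finset.mem_range.1 hm)).mono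
        hSw).sub continuousOn_const).abs
    · exact (((continuousOn_levelCost hf).mono hSw).sub continuousOn_const).abs
  have hS' : IsCompact (boxSet N z y ∩ h ⁻¹' Set.Ici ε) :=
    hS.of_isClosed_subset (hcont.preimage_isClosed_of_isClosed hS.isClosed isClosed_Ici)
      Set.inter_subset_left
  have hgap : ContinuousOn (fun q => levelCost f R T g q (cenBook f R T q)
      - envelopeCost f R T g (cenBook f R T q)) (boxSet N z y ∩ h ⁻¹' Set.Ici ε) :=
    (((continuousOn_levelCost hf).mono hSw).sub (continuousOn_envelopeCost hf hS hSw)).mono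
      Set.inter_subset_left
  -- The gap attains its minimum on this set. A zero minimum would be attained at balanced levels,
  -- which are the optimal ones, where `h` vanishes.
  obtain ⟨η, hη, hηle⟩ : ∃ η > 0, ∀ q ∈ boxSet N z y ∩ h ⁻¹' Set.Ici ε,
      η ≤ levelCost f R T g q (cenBook f R T q) - envelopeCost f R T g (cenBook f R T q) := by
    rcases (boxSet N z y ∩ h ⁻¹' Set.Ici ε).eq_empty_or_nonempty with he | hne
    · exact ⟨1, one_pos, fun q hq => by rw [he] at hq; exact hq.elim⟩
    obtain ⟨q, hq, hmin⟩ := hS'.exists_isMinOn hne hgap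
    refine ⟨_, ?_, fun q' hq' => hmin hq'⟩
    have hqw := hb.isWeakPartition hf hq.1
    refine lt_of_le_of_ne (sub_nonneg.2 (envelopeCost_le hf hqw)) fun h0 => ?_
    have h1 := sub_eq_zero.1 h0.symm
    have hs := isStrictPartition_of_levelCost_eq hf hg hqw h1
    have heq : ∀ l ∈ Finset.Icc 1 (N - 1), q l = p l := fun l hl => by
      obtain ⟨h1, h2⟩ := Finset.mem_Icc.1 hl
      exact IsBalanced.unique hf hg hp.strict hs hp.balanced
        (isBalanced_of_levelCost_eq hf hs ‹_›) h1 (by omega)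
    have h2 : h q = 0 := by
      have e1 : ∑ l ∈ Finset.Icc 1 (N - 1), |q l - p l| = 0 :=
        Finset.sum_eq_zero fun l hl => by rw [heq l hl, sub_self, abs_zero]
      have e2 : ∑ t ∈ Finset.Icc 1 T, ∑ m ∈ Finset.range (2 ^ cumRate R t),
          |cenBook f R T q t m - cenBook f R T p t m| = 0 :=
        Finset.sum_eq_zero fun t ht => Finset.sum_eq_zero fun m hm => by
          rw [cenBook_congr hf hqw heq ht (Finset.mem_range.1 hm), sub_self, abs_zero]
      simp only [hh]
      rw [e1, e2, levelCost_cenBook_congr hf hqw heq, sub_self, abs_zero]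
      norm_num
    have h3 : ε ≤ h q := hq.2
    linarith
  refine ⟨η, hη, fun q hq hqb hlt => ?_⟩
  have hce : ∀ l ∈ Finset.Icc 1 (N - 1), q l = clip N q l := fun l hl => clip_eq q hl
  have hcb : ∀ t ∈ Finset.Icc 1 T, ∀ m < 2 ^ cumRate R t,
      cenBook f R T q t m = cenBook f R T (clip N q) t m := fun t ht m hm =>
    cenBook_congr hf hq hce ht hm
  have hmem : clip N q ∈ boxSet N z y := clip_mem_boxSet hqb hq.mono
  have hlc := levelCost_cenBook_congr (g := g) hf hq hce
  have hhlt : h (clip N q) < ε := by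
    by_contra hcon
    have := hηle _ ⟨hmem, not_lt.1 hcon⟩
    rw [← hlc, ← envelopeCost_congr hcb] at this
    linarith
  have n1 : 0 ≤ ∑ l ∈ Finset.Icc 1 (N - 1), |clip N q l - p l| :=
    Finset.sum_nonneg fun _ _ => abs_nonneg _
  have n2 : 0 ≤ ∑ t ∈ Finset.Icc 1 T, ∑ m ∈ Finset.range (2 ^ cumRate R t),
      |cenBook f R T (clip N q) t m - cenBook f R T p t m| :=
    Finset.sum_nonneg fun _ _ => Finset.sum_nonneg fun _ _ => abs_nonneg _
  have n3 := abs_nonneg (levelCost f R T g (clip N q) (cenBook f R T (clip N q))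
    - levelCost f R T g p (cenBook f R T p))
  simp only [hh] at hhlt
  refine ⟨fun l hl => ?_, fun t ht m hm => ?_, ?_⟩
  · have := Finset.single_le_sum (f := fun l => |clip N q l - p l|)
      (fun _ _ => abs_nonneg _) hl
    rw [hce l hl]
    linarith
  · have a1 := Finset.single_le_sum (f := fun t => ∑ m ∈ Finset.range (2 ^ cumRate R t),
      |cenBook f R T (clip N q) t m - cenBook f R T p t m|)
      (fun _ _ => Finset.sum_nonneg fun _ _ => abs_nonneg _) ht
    have a2 := Finset.single_le_sum
      (f := fun m => |cenBook f R T (clip N q) t m - cenBook f R T p t m|)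
      (fun _ _ => abs_nonneg _) (Finset.mem_range.2 hm)
    rw [hcb t ht m hm]
    linarith
  · rw [hlc]
    have := le_abs_self (levelCost f R T g (clip N q) (cenBook f R T (clip N q))
      - levelCost f R T g p (cenBook f R T p))
    linarith

end Optimal

/-! ### Partitions, centroids and weighted nearest neighbor levels -/

section Lloyd

variable {f : ℝ → ℝ} {R : ℕ → ℕ} {T : ℕ} {g : ℕ → ℝ} {p : ℕ → ℝ} {c : ℕ → ℕ → ℝ}

theorem IsPartition.isStrictPartition (hf : IsLogConcaveDensity f) (hp : IsPartition f R T p) :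
    IsStrictPartition f (numCells R T) p := by
  set N := numCells R T with hN
  have hpos : ∀ l < N, 0 < mass f (slab N p l (l + 1)) := fun l hl => by
    have := hp l hl
    rwa [cell_leaf_eq_slab] at this
  have hlt : ∀ j, 1 ≤ j → j + 1 < N → p j < p (j + 1) := by
    intro j h1 h2
    by_contra hcon
    exact (hpos j (by omega)).ne' (mass_slab_of_eq (by omega) (by omega) (not_lt.1 hcon))
  have hmono : ∀ j k, 1 ≤ j → j ≤ k → k < N → p j ≤ p k := by
    intro j k h1 h2
    induction k, h2 using Nat.le_induction with
    | base => exact fun _ => le_rfl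
    | succ k hk ih => exact fun h3 => (ih (by omega)).trans (hlt k (by omega) h3).le
  refine ⟨⟨hmono, fun j h1 h2 => ⟨?_, ?_⟩⟩, hlt⟩
  · refine (hpos 0 (by omega)).trans_le (hf.mass_mono fun w hw => ?_)
    exact (hw.2.resolve_left (by omega)).trans_le (hmono 1 j le_rfl h1 h2)
  · refine (hpos (N - 1) (by omega)).trans_le (hf.mass_mono fun w hw => ?_)
    exact (hmono j (N - 1) h1 (by omega) (by omega)).trans (hw.1.resolve_left (by omega))

theorem IsStrictPartition.isPartition (hf : IsLogConcaveDensity f)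
    (hp : IsStrictPartition f (numCells R T) p) : IsPartition f R T p := fun l hl => by
  rw [cell_leaf_eq_slab]
  exact hp.mass_pos hf (Nat.lt_succ_self l) hl

theorem cenBook_eq_div (hf : IsLogConcaveDensity f) (hp : IsStrictPartition f (numCells R T) p)
    {t m : ℕ} (ht : t ∈ Finset.Icc 1 T) (hm : m < 2 ^ cumRate R t) :
    cenBook f R T p t m
      = (∫ x in cell R T p t m, x * f x) / ∫ x in cell R T p t m, f x := by
  have htT := (Finset.mem_Icc.1 ht).2
  have hle : (m + 1) * 2 ^ tailRate R T t ≤ numCells R T := by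
    rw [← pow_mul_pow_eq_numCells htT]; exact Nat.mul_le_mul_right _ hm
  rw [cell_eq_slab htT, cenBook, slabCen_of_pos (hp.mass_pos hf
    (Nat.mul_lt_mul_of_pos_right (Nat.lt_succ_self m) (by positivity)) hle)]
  rfl

theorem IsCentroid.eq_cenBook (hf : IsLogConcaveDensity f)
    (hp : IsStrictPartition f (numCells R T) p) (hc : IsCentroid f R T p c) :
    ∀ t ∈ Finset.Icc 1 T, ∀ m < 2 ^ cumRate R t, c t m = cenBook f R T p t m :=
  fun t ht m hm => by rw [hc t ht m hm, cenBook_eq_div hf hp ht hm]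

theorem crossing_le_iff {l i : ℕ} (h : alphaSum R T g c i < alphaSum R T g c l) (w : ℝ) :
    crossing R T g c l i ≤ w ↔ leafLine R T g c l w ≤ leafLine R T g c i w := by
  rw [crossing, div_le_iff₀ (by linarith)]
  unfold leafLine
  constructor <;> intro h' <;> linarith

theorem le_crossing_iff {l i : ℕ} (h : alphaSum R T g c i < alphaSum R T g c l) (w : ℝ) :
    w ≤ crossing R T g c l i ↔ leafLine R T g c i w ≤ leafLine R T g c l w := by
  rw [crossing, le_div_iff₀ (by linarith)]
  unfold leafLine
  constructor <;> intro h' <;> linarith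

theorem crossing_comm (l i : ℕ) : crossing R T g c l i = crossing R T g c i l := by
  rw [crossing, crossing, ← neg_sub, ← neg_sub (alphaSum R T g c i), mul_neg, neg_div_neg_eq]

theorem crossing_congr {c' : ℕ → ℕ → ℝ}
    (hc : ∀ t ∈ Finset.Icc 1 T, ∀ m < 2 ^ cumRate R t, c t m = c' t m) {l i : ℕ}
    (hl : l < numCells R T) (hi : i < numCells R T) :
    crossing R T g c l i = crossing R T g c' l i := by
  rw [crossing, crossing, alphaSum_congr hc hl, alphaSum_congr hc hi, betaSum_congr hc hl,
    betaSum_congr hc hi]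

/-- The distortions of the leaves are separated by their weighted nearest neighbor levels. -/
theorem IsWeightedNN.leafLine_le (h : IsWeightedNN R T g c p)
    (hα : ∀ i l, i < l → l < numCells R T → alphaSum R T g c i < alphaSum R T g c l)
    {l : ℕ} (hl : l < numCells R T) {w : ℝ} (h1 : l = 0 ∨ p l ≤ w)
    (h2 : l + 1 = numCells R T ∨ w ≤ p (l + 1)) {i : ℕ} (hi : i < numCells R T) :
    leafLine R T g c l w ≤ leafLine R T g c i w := by
  rcases lt_trichotomy i l with hil | hil | hil
  · have ha := hα i l hil hl
    rw [← crossing_le_iff ha]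
    exact ((h.1 l hl (by omega)).2 ⟨i, hi, ha, rfl⟩).trans (h1.resolve_left (by omega))
  · rw [hil]
  · have ha := hα l i hil hi
    rw [← le_crossing_iff ha, crossing_comm]
    exact (h2.resolve_left (by omega)).trans ((h.2 l (by omega)).2 ⟨i, hi, ha, rfl⟩)

theorem IsWeightedNN.levelCost_eq (hf : IsLogConcaveDensity f) (h : IsWeightedNN R T g c p)
    (hα : ∀ i l, i < l → l < numCells R T → alphaSum R T g c i < alphaSum R T g c l)
    (hp : IsWeakPartition f (numCells R T) p) :
    levelCost f R T g p c = envelopeCost f R T g c :=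
  levelCost_eq_envelopeCost hf hp fun _ hl _ h1 h2 _ hi =>
    h.leafLine_le hα hl (h1.imp_right le_of_lt) (h2.imp_right le_of_lt) hi

/-- The same level is the maximum defining the lower end of `l` and the minimum defining the upper
end of `l - 1`. The crossing of these two leaves takes part in both. -/
theorem IsWeightedNN.eq_crossing (h : IsWeightedNN R T g c p)
    (hα : ∀ i l, i < l → l < numCells R T → alphaSum R T g c i < alphaSum R T g c l)
    {l : ℕ} (hl1 : 1 ≤ l) (hl : l < numCells R T) : p l = crossing R T g c l (l - 1) := by
  have ha := hα (l - 1) l (by omega) hl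
  refine le_antisymm ?_ ((h.1 l hl hl1).2 ⟨l - 1, by omega, ha, rfl⟩)
  have := (h.2 (l - 1) (by omega)).2 ⟨l, hl, ha, rfl⟩
  rwa [show l - 1 + 1 = l by omega, crossing_comm] at this

theorem IsWeightedNN.isBalanced (h : IsWeightedNN R T g c p)
    (hα : ∀ i l, i < l → l < numCells R T → alphaSum R T g c i < alphaSum R T g c l) :
    IsBalanced R T g c p := fun l hl1 hl => by
  have e := h.eq_crossing hα hl1 hl
  have ha := hα (l - 1) l (by omega) hl
  exact le_antisymm ((le_crossing_iff ha _).1 e.le) ((crossing_le_iff ha _).1 e.ge)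

theorem IsWeightedNN.congr {c' : ℕ → ℕ → ℝ} (h : IsWeightedNN R T g c p)
    (hc : ∀ t ∈ Finset.Icc 1 T, ∀ m < 2 ^ cumRate R t, c t m = c' t m) :
    IsWeightedNN R T g c' p := by
  refine ⟨fun l hl hl1 => ?_, fun l hl => ?_⟩
  · convert h.1 l hl hl1 using 1
    ext b
    refine exists_congr fun i => and_congr_right fun hi => ?_
    rw [alphaSum_congr hc hi, alphaSum_congr hc hl, crossing_congr hc hl hi]
  · have hl' : l < numCells R T := by omega
    convert h.2 l hl using 1
    ext b
    refine exists_congr fun i => and_congr_right fun hi => ?_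
    rw [alphaSum_congr hc hi, alphaSum_congr hc hl', crossing_congr hc hl' hi]

theorem IsOptimal.isWeightedNN (hf : IsLogConcaveDensity f) (hg : IsWeight R T g)
    (hp : IsOptimal f R T g p) : IsWeightedNN R T g (cenBook f R T p) p := by
  have hα : ∀ i l, i < l → l < numCells R T →
      alphaSum R T g (cenBook f R T p) i < alphaSum R T g (cenBook f R T p) l :=
    fun i l h1 h2 => alphaSum_strictMono hf hp.strict hg h1 h2
  have hw := hp.strict.toIsWeakPartition
  refine ⟨fun l hl hl1 => ⟨⟨l - 1, by omega, hα _ _ (by omega) hl, ?_⟩, ?_⟩,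
    fun l hl => ⟨⟨l + 1, hl, hα _ _ (by omega) hl, ?_⟩, ?_⟩⟩
  · have ha := hα (l - 1) l (by omega) hl
    have hb := hp.balanced l hl1 hl
    exact le_antisymm ((le_crossing_iff ha _).2 hb.le) ((crossing_le_iff ha _).2 hb.ge)
  · rintro b ⟨i, hi, ha, rfl⟩
    rw [crossing_le_iff ha]
    refine leafLine_level_left_le hf hw hp.envelope hl1 hl ?_ hi
    by_cases h0 : l + 1 = numCells R T
    · exact Or.inl h0
    · exact Or.inr (hp.strict.lt_succ _ hl1 (by omega))
  · have ha := hα l (l + 1) (by omega) hl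
    have hb := hp.balanced (l + 1) (by omega) hl
    rw [Nat.add_sub_cancel] at hb
    rw [crossing_comm]
    exact le_antisymm ((le_crossing_iff ha _).2 hb.le) ((crossing_le_iff ha _).2 hb.ge)
  · rintro b ⟨i, hi, ha, rfl⟩
    rw [crossing_comm, le_crossing_iff ha]
    refine leafLine_level_right_le hf hw hp.envelope hl ?_ hi
    by_cases h0 : l = 0
    · exact Or.inl h0
    · exact Or.inr (hp.strict.lt_succ _ (by omega) hl)

/-- One iteration of the algorithm stays inside a box. -/
theorem IsWeightedNN.mem_box (hf : IsLogConcaveDensity f) (hg : IsWeight R T g) {z y q : ℕ → ℝ}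
    (hb : IsBox f (numCells R T) z y) (hp : IsStrictPartition f (numCells R T) p)
    (hle : ∀ l, 1 ≤ l → l < numCells R T → z l ≤ p l ∧ p l ≤ y l)
    (h : IsWeightedNN R T g (cenBook f R T p) q) {l : ℕ} (hl1 : 1 ≤ l) (hl : l < numCells R T) :
    z l ≤ q l ∧ q l ≤ y l := by
  have hα : ∀ i l, i < l → l < numCells R T →
      alphaSum R T g (cenBook f R T p) i < alphaSum R T g (cenBook f R T p) l :=
    fun i l h1 h2 => alphaSum_strictMono hf hp hg h1 h2
  have ha := hα (l - 1) l (by omega) hl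
  rw [h.eq_crossing hα hl1 hl]
  exact ⟨(le_crossing_iff ha _).2 (hb.leafLine_lower_le hf hg hp.toIsWeakPartition
      (fun l h1 h2 => (hle l h1 h2).1) hl1 le_rfl hl),
    (crossing_le_iff ha _).2 (hb.leafLine_upper_le hf hg hp.toIsWeakPartition
      (fun l h1 h2 => (hle l h1 h2).2) (by omega) hl)⟩

end Lloyd

/-! ### Convergence of the algorithm -/

section Run

variable {f : ℝ → ℝ} {R : ℕ → ℕ} {T : ℕ} {g : ℕ → ℝ} {p : ℕ → ℝ} {pn : ℕ → ℕ → ℝ}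
  {cn : ℕ → ℕ → ℕ → ℝ}

theorem IsGLMRun.strict (hf : IsLogConcaveDensity f) (h : IsGLMRun f R T g pn cn) (n : ℕ) :
    IsStrictPartition f (numCells R T) (pn n) := (h n).1.isStrictPartition hf

theorem IsGLMRun.cn_eq (hf : IsLogConcaveDensity f) (h : IsGLMRun f R T g pn cn) (n : ℕ) :
    ∀ t ∈ Finset.Icc 1 T, ∀ m < 2 ^ cumRate R t, cn n t m = cenBook f R T (pn n) t m :=
  (h n).2.1.eq_cenBook hf (h.strict hf n)

theorem IsGLMRun.nearest (hf : IsLogConcaveDensity f) (h : IsGLMRun f R T g pn cn) (n : ℕ) :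
    IsWeightedNN R T g (cenBook f R T (pn n)) (pn (n + 1)) := (h n).2.2.congr (h.cn_eq hf n)

theorem IsGLMRun.levelCost_eq (hf : IsLogConcaveDensity f) (hg : IsWeight R T g)
    (h : IsGLMRun f R T g pn cn) (n : ℕ) :
    levelCost f R T g (pn (n + 1)) (cn n) = envelopeCost f R T g (cenBook f R T (pn n)) := by
  rw [levelCost_congr (fun _ _ => rfl) (h.cn_eq hf n)]
  exact (h.nearest hf n).levelCost_eq hf
    (fun i l h1 h2 => alphaSum_strictMono hf (h.strict hf n) hg h1 h2)
    (h.strict hf (n + 1)).toIsWeakPartition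

theorem IsGLMRun.levelCost_succ_le (hf : IsLogConcaveDensity f) (hg : IsWeight R T g)
    (h : IsGLMRun f R T g pn cn) (n : ℕ) :
    levelCost f R T g (pn (n + 1)) (cenBook f R T (pn (n + 1)))
      ≤ envelopeCost f R T g (cenBook f R T (pn n)) := by
  rw [← h.levelCost_eq hf hg n]
  exact levelCost_cenBook_le hf hg (h.strict hf (n + 1)).toIsWeakPartition _

theorem IsGLMRun.envelopeCost_le (hf : IsLogConcaveDensity f) (h : IsGLMRun f R T g pn cn)
    (n : ℕ) : envelopeCost f R T g (cenBook f R T (pn n))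
      ≤ levelCost f R T g (pn n) (cenBook f R T (pn n)) :=
  LQR.envelopeCost_le hf (h.strict hf n).toIsWeakPartition

theorem IsGLMRun.exists_isBox (hf : IsLogConcaveDensity f) (hg : IsWeight R T g)
    (h : IsGLMRun f R T g pn cn) :
    ∃ z y, IsBox f (numCells R T) z y ∧
      ∀ n l, 1 ≤ l → l < numCells R T → z l ≤ pn n l ∧ pn n l ≤ y l := by
  have h0 := (h.strict hf 0).toIsWeakPartition
  obtain ⟨z, y, hb, hzy⟩ := exists_isBox_of_isWeakPartition hf h0 h0
  refine ⟨z, y, hb, fun n => ?_⟩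
  induction n with
  | zero => exact fun l h1 h2 => (hzy l h1 h2).1
  | succ n ih => exact fun l h1 h2 =>
      (h.nearest hf n).mem_box hf hg hb (h.strict hf n) ih h1 h2

theorem IsGLMRun.tendsto_sub (hf : IsLogConcaveDensity f) (hg : IsWeight R T g)
    (hp : IsOptimal f R T g p) (h : IsGLMRun f R T g pn cn) :
    Tendsto (fun n => levelCost f R T g (pn n) (cenBook f R T (pn n))
      - levelCost f R T g (pn (n + 1)) (cenBook f R T (pn (n + 1)))) atTop (𝓝 0) := by
  have hanti : Antitone fun n => levelCost f R T g (pn n) (cenBook f R T (pn n)) :=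
    antitone_nat_of_succ_le fun n =>
      (h.levelCost_succ_le hf hg n).trans (h.envelopeCost_le hf n)
  have hbdd : BddBelow (Set.range fun n => levelCost f R T g (pn n) (cenBook f R T (pn n))) :=
    ⟨levelCost f R T g p (cenBook f R T p), by
      rintro _ ⟨n, rfl⟩
      exact hp.le _ (h.strict hf n).toIsWeakPartition⟩
  have ht := tendsto_atTop_ciInf hanti hbdd
  simpa using ht.sub (ht.comp (tendsto_add_atTop_nat 1))

/-- One iteration lowers the distortion at the centroids to at most the envelope cost, so the gap is
at most a decrement of a convergent sequence. -/
theorem IsGLMRun.tendsto_gap (hf : IsLogConcaveDensity f) (hg : IsWeight R T g)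
    (hp : IsOptimal f R T g p) (h : IsGLMRun f R T g pn cn) :
    Tendsto (fun n => levelCost f R T g (pn n) (cenBook f R T (pn n))
      - envelopeCost f R T g (cenBook f R T (pn n))) atTop (𝓝 0) :=
  squeeze_zero (fun n => sub_nonneg.2 (h.envelopeCost_le hf n))
    (fun n => sub_le_sub_left (h.levelCost_succ_le hf hg n) _) (h.tendsto_sub hf hg hp)

theorem IsGLMRun.eventually_close (hf : IsLogConcaveDensity f) (hg : IsWeight R T g)
    (hp : IsOptimal f R T g p) (h : IsGLMRun f R T g pn cn) {ε : ℝ} (hε : 0 < ε) :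
    ∀ᶠ n in atTop, (∀ l ∈ Finset.Icc 1 (numCells R T - 1), |pn n l - p l| < ε) ∧
      (∀ t ∈ Finset.Icc 1 T, ∀ m < 2 ^ cumRate R t,
        |cenBook f R T (pn n) t m - cenBook f R T p t m| < ε) ∧
      levelCost f R T g (pn n) (cenBook f R T (pn n))
        < levelCost f R T g p (cenBook f R T p) + ε := by
  obtain ⟨z, y, hb, hzy⟩ := h.exists_isBox hf hg
  obtain ⟨η, hη, hgap⟩ := hp.exists_gap hf hg hb hε
  filter_upwards [(h.tendsto_gap hf hg hp).eventually (eventually_lt_nhds hη)] with n hn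
  exact hgap _ (h.strict hf n).toIsWeakPartition (hzy n) hn

theorem IsGLMRun.tendsto_levels (hf : IsLogConcaveDensity f) (hg : IsWeight R T g)
    (hp : IsOptimal f R T g p) (h : IsGLMRun f R T g pn cn) :
    ∀ l ∈ Finset.Icc 1 (numCells R T - 1), Tendsto (fun n => pn n l) atTop (𝓝 (p l)) :=
  fun l hl => Metric.tendsto_nhds.2 fun _ hε => (h.eventually_close hf hg hp hε).mono
    fun _ hn => hn.1 l hl

theorem IsGLMRun.tendsto_points (hf : IsLogConcaveDensity f) (hg : IsWeight R T g)
    (hp : IsOptimal f R T g p) (h : IsGLMRun f R T g pn cn) :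
    ∀ t ∈ Finset.Icc 1 T, ∀ m < 2 ^ cumRate R t,
      Tendsto (fun n => cn n t m) atTop (𝓝 (cenBook f R T p t m)) :=
  fun t ht m hm => Metric.tendsto_nhds.2 fun _ hε => (h.eventually_close hf hg hp hε).mono
    fun n hn => by
      rw [h.cn_eq hf n t ht m hm]
      exact hn.2.1 t ht m hm

theorem IsGLMRun.tendsto_levelCost (hf : IsLogConcaveDensity f) (hg : IsWeight R T g)
    (hp : IsOptimal f R T g p) (h : IsGLMRun f R T g pn cn) :
    Tendsto (fun n => levelCost f R T g (pn (n + 1)) (cn n)) atTop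
      (𝓝 (levelCost f R T g p (cenBook f R T p))) := by
  have h1 : Tendsto (fun n => levelCost f R T g (pn n) (cenBook f R T (pn n))) atTop
      (𝓝 (levelCost f R T g p (cenBook f R T p))) := by
    refine Metric.tendsto_nhds.2 fun ε hε => (h.eventually_close hf hg hp hε).mono fun n hn => ?_
    have := hp.le _ (h.strict hf n).toIsWeakPartition
    rw [Real.dist_eq, abs_of_nonneg (sub_nonneg.2 this)]
    linarith [hn.2.2]
  refine tendsto_of_tendsto_of_tendsto_of_le_of_le tendsto_const_nhds h1 (fun n => ?_)
    fun n => ?_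
  · exact (hp.le _ (h.strict hf (n + 1)).toIsWeakPartition).trans
      (levelCost_cenBook_le hf hg (h.strict hf (n + 1)).toIsWeakPartition _)
  · simp only
    rw [h.levelCost_eq hf hg n]
    exact h.envelopeCost_le hf n

/-- Stopping at the first small decrease of the distortion. -/
theorem IsGLMRun.exists_stop (hf : IsLogConcaveDensity f) (hg : IsWeight R T g)
    (hp : IsOptimal f R T g p) (h : IsGLMRun f R T g pn cn) {ε : ℝ} (hε : 0 < ε) :
    ∃ η₀ > 0, ∀ η, 0 < η → η ≤ η₀ → ∃ n,
      levelCost f R T g (pn (n + 1)) (cn n) - levelCost f R T g (pn (n + 2)) (cn (n + 1)) < η ∧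
      (∀ m < n, η ≤ levelCost f R T g (pn (m + 1)) (cn m)
        - levelCost f R T g (pn (m + 2)) (cn (m + 1))) ∧
      levelCost f R T g (pn (n + 2)) (cn (n + 1))
        ≤ levelCost f R T g p (cenBook f R T p) + ε := by
  obtain ⟨z, y, hb, hzy⟩ := h.exists_isBox hf hg
  obtain ⟨η₀, hη₀, hgap⟩ := hp.exists_gap hf hg hb hε
  refine ⟨η₀, hη₀, fun η hη hle => ?_⟩
  have ht := h.tendsto_levelCost hf hg hp
  have ht' := ht.sub (ht.comp (tendsto_add_atTop_nat 1))
  rw [sub_self] at ht'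
  have hex : ∃ n, levelCost f R T g (pn (n + 1)) (cn n)
      - levelCost f R T g (pn (n + 2)) (cn (n + 1)) < η :=
    (ht'.eventually (eventually_lt_nhds hη)).exists
  classical
  refine ⟨Nat.find hex, Nat.find_spec hex, fun m hm => not_lt.1 (Nat.find_min hex hm), ?_⟩
  have h1 := Nat.find_spec hex
  generalize Nat.find hex = n at h1
  -- The observed decrease is the difference of two successive envelope costs. The distortion of `pn
  -- (n + 1)` with its own centroids lies between them, so the decrease bounds the gap at `pn (n +
  -- 1)`.
  rw [h.levelCost_eq hf hg n, h.levelCost_eq hf hg (n + 1)] at h1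
  rw [h.levelCost_eq hf hg (n + 1)]
  have h2 := h.levelCost_succ_le hf hg n
  have h3 := hgap _ (h.strict hf (n + 1)).toIsWeakPartition (hzy (n + 1)) (by linarith)
  exact (h.envelopeCost_le hf (n + 1)).trans h3.2.2.le

end Run

/-! ### Monotone labelings -/

section LeafIndex

variable {f : ℝ → ℝ} {R : ℕ → ℕ} {T : ℕ} {p : ℕ → ℝ}

theorem leafIndex_lt (p : ℕ → ℝ) (w : ℝ) : leafIndex R T p w < numCells R T := by
  have h := Finset.card_filter_le (Finset.Icc 1 (numCells R T - 1)) fun k => p k ≤ w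
  have h' := numCells_pos (R := R) (T := T)
  rw [Nat.card_Icc] at h
  unfold leafIndex
  omega

theorem leafIndex_mono (p : ℕ → ℝ) : Monotone (leafIndex R T p) := fun _ _ h =>
  Finset.card_le_card (Finset.monotone_filter_right _ fun _ _ hk => le_trans hk h)

theorem IsWeakPartition.le_leafIndex_iff (hp : IsWeakPartition f (numCells R T) p) {k : ℕ}
    (h1 : 1 ≤ k) (hk : k < numCells R T) (w : ℝ) : k ≤ leafIndex R T p w ↔ p k ≤ w := by
  constructor
  · intro h
    by_contra hw
    have hs : (Finset.Icc 1 (numCells R T - 1)).filter (fun k => p k ≤ w)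
        ⊆ Finset.Icc 1 (k - 1) := fun j hj => by
      obtain ⟨hj1, hj2⟩ := Finset.mem_filter.1 hj
      rw [Finset.mem_Icc] at hj1 ⊢
      refine ⟨hj1.1, ?_⟩
      by_contra hkj
      exact hw ((hp.mono k j h1 (by omega) (by omega)).trans hj2)
    have := Finset.card_le_card hs
    rw [Nat.card_Icc] at this
    unfold leafIndex at h
    omega
  · intro h
    have hs : Finset.Icc 1 k ⊆ (Finset.Icc 1 (numCells R T - 1)).filter (fun k => p k ≤ w) :=
      fun j hj => by
        rw [Finset.mem_Icc] at hj
        rw [Finset.mem_filter, Finset.mem_Icc]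
        exact ⟨⟨hj.1, by omega⟩, (hp.mono j k hj.1 hj.2 hk).trans h⟩
    have := Finset.card_le_card hs
    rw [Nat.card_Icc] at this
    unfold leafIndex
    omega

theorem IsWeakPartition.leafIndex_eq_iff (hp : IsWeakPartition f (numCells R T) p) {l : ℕ}
    (hl : l < numCells R T) (w : ℝ) :
    leafIndex R T p w = l ↔ w ∈ slab (numCells R T) p l (l + 1) := by
  have hlt := leafIndex_lt (R := R) (T := T) p w
  have h1 : l ≤ leafIndex R T p w ↔ (l = 0 ∨ p l ≤ w) := by
    rcases Nat.eq_zero_or_pos l with h | h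
    · simp [h]
    · rw [hp.le_leafIndex_iff h hl, or_iff_right h.ne']
  have h2 : leafIndex R T p w < l + 1 ↔ (l + 1 = numCells R T ∨ w < p (l + 1)) := by
    rcases eq_or_ne (l + 1) (numCells R T) with h | h
    · simp [h, hlt]
    · rw [← not_le, hp.le_leafIndex_iff (by omega) (by omega), or_iff_right h, not_le]
  rw [slab, Set.mem_ofPred_eq, ← h1, ← h2]
  omega

end LeafIndex

theorem label_eq_sum {N : ℕ} {L : ℝ → ℕ} (hlt : ∀ w, L w < N) (φ : ℕ → ℝ → ℝ) :
    (fun w => φ (L w) w) = fun w => ∑ l ∈ Finset.range N, (L ⁻¹' {l}).indicator (φ l) w := by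
  funext w
  rw [Finset.sum_eq_single_of_mem (L w) (Finset.mem_range.2 (hlt w)),
    Set.indicator_of_mem (by simp)]
  intro l _ hl
  exact Set.indicator_of_notMem (by simpa using hl.symm) _

theorem integrable_label {N : ℕ} {L : ℝ → ℕ} (hL : Measurable L) (hlt : ∀ w, L w < N)
    {φ : ℕ → ℝ → ℝ} (hφ : ∀ l, Integrable (φ l)) : Integrable fun w => φ (L w) w := by
  rw [label_eq_sum hlt]
  exact integrable_finsetSum _ fun l _ => (hφ l).indicator (hL (measurableSet_singleton l))

theorem integral_label {N : ℕ} {L : ℝ → ℕ} (hL : Measurable L) (hlt : ∀ w, L w < N)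
    {φ : ℕ → ℝ → ℝ} (hφ : ∀ l, Integrable (φ l)) :
    ∫ w, φ (L w) w = ∑ l ∈ Finset.range N, ∫ w in L ⁻¹' {l}, φ l w := by
  rw [label_eq_sum hlt, integral_finsetSum _ fun l _ =>
    (hφ l).indicator (hL (measurableSet_singleton l))]
  exact Finset.sum_congr rfl fun l _ => integral_indicator (hL (measurableSet_singleton l))

/-- The weighted distortion of a labeling, without the part that all labelings share. -/
noncomputable def labelCost (f : ℝ → ℝ) (R : ℕ → ℕ) (T : ℕ) (g : ℕ → ℝ) (c : ℕ → ℕ → ℝ)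
    (L : ℝ → ℕ) : ℝ := ∫ w, leafLine R T g c (L w) w * f w

section LabelCost

variable {f : ℝ → ℝ} {R : ℕ → ℕ} {T : ℕ} {p : ℕ → ℝ} {g : ℕ → ℝ} {c : ℕ → ℕ → ℝ} {L : ℝ → ℕ}

theorem labelCost_leafIndex (hf : IsLogConcaveDensity f)
    (hp : IsWeakPartition f (numCells R T) p) :
    labelCost f R T g c (leafIndex R T p) = levelCost f R T g p c := by
  rw [labelCost, integral_label (leafIndex_mono p).measurable (leafIndex_lt p)
    (φ := fun l w => leafLine R T g c l w * f w) (integrable_leafLine_mul hf), levelCost]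
  refine Finset.sum_congr rfl fun l hl => ?_
  rw [← setIntegral_leafLine hf]
  congr 2
  ext w
  exact hp.leafIndex_eq_iff (Finset.mem_range.1 hl) w

theorem integrable_sq_sub_mul (hf : IsLogConcaveDensity f) (x : ℝ) :
    Integrable fun w => (w - x) ^ 2 * f w := by
  refine ((hf.integrable_sq_mul.sub (hf.integrable_mul.const_mul (2 * x))).add
    (hf.integrable.const_mul (x ^ 2))).congr (ae_of_all _ fun w => ?_)
  simp only [Pi.add_apply, Pi.sub_apply]; ring

/-- Expanding the squares, the second moment is common to all labelings, and the rest is the leaf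
line. -/
theorem integral_sum_sq_eq (hf : IsLogConcaveDensity f) (hL : Measurable L)
    (hlt : ∀ w, L w < numCells R T) :
    ∑ t ∈ Finset.Icc 1 T, g t * ∫ w, (w - c t (parent R T t (L w))) ^ 2 * f w
      = (∑ t ∈ Finset.Icc 1 T, g t) * (∫ w, w ^ 2 * f w) + labelCost f R T g c L := by
  have hi : ∀ t, Integrable fun w => (w - c t (parent R T t (L w))) ^ 2 * f w := fun t =>
    integrable_label hL hlt (φ := fun l w => (w - c t (parent R T t l)) ^ 2 * f w)
      fun l => integrable_sq_sub_mul hf _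
  simp only [← integral_const_mul]
  rw [← integral_finsetSum _ fun t _ => (hi t).const_mul (g t), labelCost, ← integral_add
    (hf.integrable_sq_mul.const_mul _) (integrable_label hL hlt
      (φ := fun l w => leafLine R T g c l w * f w) (integrable_leafLine_mul hf))]
  congr 1
  funext w
  simp only [leafLine, alphaSum, betaSum, Finset.mul_sum, Finset.sum_mul, sub_mul]
  rw [← Finset.sum_sub_distrib, ← Finset.sum_add_distrib]
  exact Finset.sum_congr rfl fun t _ => by ring

end LabelCost

/-! ### Monotone labelings are no better than partitions -/

theorem tendsto_setIntegral_Iio_atBot {h : ℝ → ℝ} (hh : Integrable h) :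
    Tendsto (fun x => ∫ w in Set.Iio x, h w) atBot (𝓝 0) := by
  simp only [← integral_indicator measurableSet_Iio]
  rw [← integral_zero ℝ ℝ (μ := volume)]
  refine tendsto_integral_filter_of_dominated_convergence (fun w => ‖h w‖)
    (Eventually.of_forall fun x => hh.aestronglyMeasurable.indicator measurableSet_Iio)
    (Eventually.of_forall fun x => ae_of_all _ fun w => norm_indicator_le_norm_self _ _)
    hh.norm (ae_of_all _ fun w => tendsto_const_nhds.congr' ?_)
  filter_upwards [eventually_le_atBot w] with x hx
  rw [Set.indicator_of_notMem (by simpa using hx)]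

theorem tendsto_setIntegral_Ici_atTop {h : ℝ → ℝ} (hh : Integrable h) :
    Tendsto (fun x => ∫ w in Set.Ici x, h w) atTop (𝓝 0) := by
  simp only [← integral_indicator measurableSet_Ici]
  rw [← integral_zero ℝ ℝ (μ := volume)]
  refine tendsto_integral_filter_of_dominated_convergence (fun w => ‖h w‖)
    (Eventually.of_forall fun x => hh.aestronglyMeasurable.indicator measurableSet_Ici)
    (Eventually.of_forall fun x => ae_of_all _ fun w => norm_indicator_le_norm_self _ _)
    hh.norm (ae_of_all _ fun w => tendsto_const_nhds.congr' ?_)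
  filter_upwards [eventually_gt_atTop w] with x hx
  rw [Set.indicator_of_notMem (by simpa using hx)]

namespace IsLogConcaveDensity

variable {f h : ℝ → ℝ}

theorem setIntegral_mul_eq_zero (hf : IsLogConcaveDensity f) {A : Set ℝ} (hA : mass f A = 0)
    (h : ℝ → ℝ) : ∫ w in A, h w * f w = 0 := by
  have h0 : ∀ᵐ x ∂(volume.restrict A), f x = 0 :=
    (integral_eq_zero_iff_of_nonneg hf.nonneg hf.integrable.integrableOn).1 hA
  rw [integral_congr_ae (g := fun _ => (0 : ℝ)) (by filter_upwards [h0] with x hx; simp [hx])]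
  simp

theorem exists_setIntegral_Iio_lt (hf : IsLogConcaveDensity f)
    (hh : Integrable fun w => h w * f w) {m : ℝ} (hm : IsInner f m) {ε : ℝ} (hε : 0 < ε) :
    ∃ z ≤ m, IsInner f z ∧ ∫ w in Set.Iio z, h w * f w < ε := by
  by_cases h0 : ∫ w in Set.Iio m, h w * f w < ε
  · exact ⟨m, le_rfl, hm, h0⟩
  obtain ⟨x, hx, hxm⟩ := (((tendsto_setIntegral_Iio_atBot hh).eventually_lt_const
    (half_pos hε)).and (eventually_le_atBot m)).exists
  -- A tail integral of exactly `ε / 2` is small, and being nonzero it shows that there is mass to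
  -- the left of `z`.
  obtain ⟨z, hz, hez⟩ := intermediate_value_Icc hxm
    (continuous_setIntegral_Iio hh).continuousOn ⟨hx.le, by linarith⟩
  refine ⟨z, hz.2, ⟨?_, hm.2.trans_le (hf.mass_mono (Set.Ici_subset_Ici.2 hz.2))⟩,
    by simp only at hez; linarith⟩
  refine lt_of_le_of_ne (hf.mass_nonneg _) fun hne => ?_
  have := hf.setIntegral_mul_eq_zero hne.symm h
  simp only at hez
  linarith

theorem exists_setIntegral_Ici_lt (hf : IsLogConcaveDensity f)
    (hh : Integrable fun w => h w * f w) {m : ℝ} (hm : IsInner f m) {ε : ℝ} (hε : 0 < ε) :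
    ∃ y ≥ m, IsInner f y ∧ ∫ w in Set.Ici y, h w * f w < ε := by
  by_cases h0 : ∫ w in Set.Ici m, h w * f w < ε
  · exact ⟨m, le_rfl, hm, h0⟩
  have hc : Continuous fun x => ∫ w in Set.Ici x, h w * f w := by
    have e : (fun x => ∫ w in Set.Ici x, h w * f w)
        = fun x => (∫ w, h w * f w) - ∫ w in Set.Iio x, h w * f w := by
      funext x
      rw [← Set.compl_Iio, setIntegral_compl measurableSet_Iio hh]
    rw [e]
    exact continuous_const.sub (continuous_setIntegral_Iio hh)
  obtain ⟨x, hx, hxm⟩ := (((tendsto_setIntegral_Ici_atTop hh).eventually_lt_const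
    (half_pos hε)).and (eventually_ge_atTop m)).exists
  obtain ⟨y, hy, hey⟩ := intermediate_value_Icc' hxm hc.continuousOn ⟨hx.le, by linarith⟩
  refine ⟨y, hy.1, ⟨hm.1.trans_le (hf.mass_mono (Set.Iio_subset_Iio hy.1)), ?_⟩,
    by simp only at hey; linarith⟩
  refine lt_of_le_of_ne (hf.mass_nonneg _) fun hne => ?_
  have := hf.setIntegral_mul_eq_zero hne.symm h
  simp only at hey
  linarith

end IsLogConcaveDensity

/-- The levels of a monotone labeling, forced into `[z, y]`. -/
noncomputable def labelLevel (L : ℝ → ℕ) (z y : ℝ) (l : ℕ) : ℝ :=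
  sInf ({w | z ≤ w ∧ w ≤ y ∧ l ≤ L w} ∪ {y})

section LabelLevel

variable {L : ℝ → ℕ} {z y : ℝ}

theorem bddBelow_labelLevel (hzy : z ≤ y) (l : ℕ) :
    BddBelow ({w | z ≤ w ∧ w ≤ y ∧ l ≤ L w} ∪ {y}) :=
  ⟨z, by rintro w (hw | rfl); exacts [hw.1, hzy]⟩

theorem labelLevel_mem_Icc (hzy : z ≤ y) (l : ℕ) : labelLevel L z y l ∈ Set.Icc z y :=
  ⟨le_csInf ⟨y, Or.inr rfl⟩ (by rintro w (hw | rfl); exacts [hw.1, hzy]),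
    csInf_le (bddBelow_labelLevel hzy l) (Or.inr rfl)⟩

theorem labelLevel_mono (hzy : z ≤ y) : Monotone (labelLevel L z y) := fun l _ h =>
  csInf_le_csInf (bddBelow_labelLevel hzy l) ⟨y, Or.inr rfl⟩
    (Set.union_subset_union_left _ fun _ hw => ⟨hw.1, hw.2.1, h.trans hw.2.2⟩)

theorem labelLevel_le_iff (hL : Monotone L) (hzy : z ≤ y) {l : ℕ} {w : ℝ}
    (hw : w ∈ Set.Ioo z y) (hne : w ≠ labelLevel L z y l) : labelLevel L z y l ≤ w ↔ l ≤ L w := by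
  constructor
  · intro h
    obtain ⟨w', hw', hlt⟩ := exists_lt_of_csInf_lt ⟨y, Or.inr rfl⟩ (lt_of_le_of_ne h hne.symm)
    rcases hw' with hw' | rfl
    · exact hw'.2.2.trans (hL hlt.le)
    · exact absurd hlt (not_lt.2 hw.2.le)
  · exact fun h => csInf_le (bddBelow_labelLevel hzy l) (Or.inl ⟨hw.1.le, hw.2.le, h⟩)

end LabelLevel

/-- A monotone labeling may skip labels, even the outermost ones, and thus have no inner levels.
Forcing its levels into `[z, y]` gives a weak partition that changes labels only in the two tails,
up to a null set, at a cost below `ε`. -/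
theorem IsOptimal.le_labelCost {f : ℝ → ℝ} {R : ℕ → ℕ} {T : ℕ} {g p : ℕ → ℝ} {L : ℝ → ℕ}
    (hf : IsLogConcaveDensity f) (hg : IsWeight R T g) (h : IsOptimal f R T g p)
    (hL : Monotone L) (hlt : ∀ w, L w < numCells R T) (c : ℕ → ℕ → ℝ) :
    levelCost f R T g p (cenBook f R T p) ≤ labelCost f R T g c L := by
  refine le_of_forall_pos_le_add fun ε hε => ?_
  -- `H` bounds the change of the pointwise distortion under any change of label.
  set H : ℝ → ℝ := fun w => 2 * ∑ l ∈ Finset.range (numCells R T), |leafLine R T g c l w| with hH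
  have hHnn : ∀ w, 0 ≤ H w := fun w =>
    mul_nonneg zero_le_two (Finset.sum_nonneg fun _ _ => abs_nonneg _)
  have hHi : Integrable fun w => H w * f w := by
    refine ((integrable_finsetSum (Finset.range (numCells R T)) fun l _ =>
      (integrable_leafLine_mul (R := R) (T := T) (g := g) (c := c) hf l).norm).const_mul 2).congr
      (ae_of_all _ fun w => ?_)
    simp only [hH, norm_mul, Real.norm_eq_abs, abs_of_nonneg (hf.nonneg w), ← Finset.sum_mul]
    ring
  have hm := hf.isInner_cen_univ
  obtain ⟨z, hzm, hz, hzε⟩ := hf.exists_setIntegral_Iio_lt hHi hm (half_pos hε)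
  obtain ⟨y, hmy, hy, hyε⟩ := hf.exists_setIntegral_Ici_lt hHi hm (half_pos hε)
  have hzy : z ≤ y := hzm.trans hmy
  set q := labelLevel L z y with hq
  have hqw : IsWeakPartition f (numCells R T) q :=
    ⟨fun j k _ hjk _ => labelLevel_mono hzy hjk,
      fun j _ _ => hf.isInner_of_mem_Icc hz hy (labelLevel_mem_Icc hzy j)⟩
  have h1 := (h.le q hqw).trans (levelCost_cenBook_le hf hg hqw c)
  rw [← labelCost_leafIndex (c := c) hf hqw] at h1
  refine h1.trans ?_
  have hi : ∀ {L' : ℝ → ℕ}, Monotone L' → (∀ w, L' w < numCells R T) →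
      Integrable fun w => leafLine R T g c (L' w) w * f w := fun hL' hlt' =>
    integrable_label hL'.measurable hlt' (φ := fun l w => leafLine R T g c l w * f w)
      (integrable_leafLine_mul hf)
  have hA := hHi.indicator (measurableSet_Iio (a := z))
  have hB := hHi.indicator (measurableSet_Ici (a := y))
  have hAB : Integrable fun w => (Set.Iio z).indicator (fun w => H w * f w) w
      + (Set.Ici y).indicator (fun w => H w * f w) w := hA.add hB
  have h2 : labelCost f R T g c (leafIndex R T q) ≤ ∫ w, (leafLine R T g c (L w) w * f w
      + ((Set.Iio z).indicator (fun w => H w * f w) w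
        + (Set.Ici y).indicator (fun w => H w * f w) w)) := by
    refine integral_mono_ae (hi (leafIndex_mono q) (leafIndex_lt q))
      ((hi hL hlt).add hAB) ?_
    have hne : ∀ᵐ w, w ≠ z ∧ ∀ l, w ≠ q l :=
      (Measure.ae_ne volume z).and (ae_all_iff.2 fun l => Measure.ae_ne volume (q l))
    filter_upwards [hne] with w hw
    have hnn := mul_nonneg (hHnn w) (hf.nonneg w)
    have hAnn : 0 ≤ (Set.Iio z).indicator (fun w => H w * f w) w :=
      Set.indicator_nonneg (fun w _ => mul_nonneg (hHnn w) (hf.nonneg w)) w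
    have hBnn : 0 ≤ (Set.Ici y).indicator (fun w => H w * f w) w :=
      Set.indicator_nonneg (fun w _ => mul_nonneg (hHnn w) (hf.nonneg w)) w
    by_cases hmem : w ∈ Set.Ioo z y
    · have e : leafIndex R T q w = L w := by
        have ha := leafIndex_lt (R := R) (T := T) q w
        have hb := hlt w
        have hk : ∀ k, 1 ≤ k → k < numCells R T → (k ≤ leafIndex R T q w ↔ k ≤ L w) :=
          fun k hk1 hk2 => (hqw.le_leafIndex_iff hk1 hk2 w).trans
            (labelLevel_le_iff hL hzy hmem (hw.2 k))
        rcases lt_trichotomy (leafIndex R T q w) (L w) with hlt' | heq | hlt'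
        · exact absurd ((hk _ (by omega) hb).2 le_rfl) (not_le.2 hlt')
        · exact heq
        · exact absurd ((hk _ (by omega) ha).1 le_rfl) (not_le.2 hlt')
      rw [e]
      linarith
    · have hbound : leafLine R T g c (leafIndex R T q w) w - leafLine R T g c (L w) w ≤ H w := by
        have hs : ∀ l < numCells R T, |leafLine R T g c l w|
            ≤ ∑ l ∈ Finset.range (numCells R T), |leafLine R T g c l w| := fun l hl =>
          Finset.single_le_sum (f := fun l => |leafLine R T g c l w|) (fun _ _ => abs_nonneg _)
            (Finset.mem_range.2 hl)
        have ha := hs _ (leafIndex_lt q w)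
        have hb := hs _ (hlt w)
        have ha' := le_abs_self (leafLine R T g c (leafIndex R T q w) w)
        have hb' := neg_abs_le (leafLine R T g c (L w) w)
        simp only [hH]
        linarith
      have hbf := mul_le_mul_of_nonneg_right hbound (hf.nonneg w)
      rw [sub_mul] at hbf
      have hcase : H w * f w ≤ (Set.Iio z).indicator (fun w => H w * f w) w
          + (Set.Ici y).indicator (fun w => H w * f w) w := by
        rcases lt_or_ge w z with hwz | hwz
        · rw [Set.indicator_of_mem (show w ∈ Set.Iio z from hwz)]
          linarith
        · have hwy : w ∈ Set.Ici y := by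
            by_contra hwy
            exact hmem ⟨lt_of_le_of_ne hwz hw.1.symm, not_le.1 hwy⟩
          rw [Set.indicator_of_mem hwy]
          linarith
      linarith
  rw [integral_add (hi hL hlt) hAB, integral_add hA hB,
    integral_indicator measurableSet_Iio, integral_indicator measurableSet_Ici] at h2
  simp only [labelCost] at h2 ⊢
  linarith

/-! ### Digits of a leaf -/

section Digits

variable {R : ℕ → ℕ} {T : ℕ}

theorem joinIndex_congr {l l' : ℕ → ℕ} {t : ℕ} (h : ∀ i < t, l i = l' i) :
    joinIndex R l t = joinIndex R l' t := by
  induction t with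
  | zero => rfl
  | succ t ih =>
    rw [joinIndex, joinIndex, ih fun i hi => h i (by omega), h t (Nat.lt_succ_self t)]

theorem cumRate_succ (t : ℕ) : cumRate R (t + 1) = cumRate R t + R (t + 1) :=
  Finset.sum_Icc_succ_top (by omega) _

theorem joinIndex_lt {l : ℕ → ℕ} (h : ∀ i, l i < 2 ^ R (i + 1)) (t : ℕ) :
    joinIndex R l t < 2 ^ cumRate R t := by
  induction t with
  | zero => simp [joinIndex, cumRate]
  | succ t ih =>
    rw [joinIndex, cumRate_succ, pow_add]
    calc joinIndex R l t * 2 ^ R (t + 1) + l t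
        < joinIndex R l t * 2 ^ R (t + 1) + 2 ^ R (t + 1) := Nat.add_lt_add_left (h t) _
      _ = (joinIndex R l t + 1) * 2 ^ R (t + 1) := by ring
      _ ≤ 2 ^ cumRate R t * 2 ^ R (t + 1) := Nat.mul_le_mul_right _ ih

theorem tailRate_eq_add {t : ℕ} (ht : t < T) :
    tailRate R T t = tailRate R T (t + 1) + R (t + 1) := by
  have h1 := cumRate_add_tailRate (R := R) ht.le
  have h2 := cumRate_add_tailRate (R := R) (T := T) (t := t + 1) ht
  have h3 := cumRate_succ (R := R) t
  omega

theorem parent_eq_div {t : ℕ} (ht : t < T) (l : ℕ) :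
    parent R T t l = parent R T (t + 1) l / 2 ^ R (t + 1) := by
  rw [parent_parent (Nat.le_succ t), tailRate_eq_add ht, Nat.add_sub_cancel_left]

/-- The transmitted bits are the mixed-radix digits of the leaf, and the digits up to stage `t`
recover its stage-`t` cell. -/
theorem joinIndex_parent {l t : ℕ} (hl : l < numCells R T) (ht : t ≤ T) :
    joinIndex R (fun i => parent R T (i + 1) l % 2 ^ R (i + 1)) t = parent R T t l := by
  induction t with
  | zero =>
    have := parent_lt (R := R) ht hl
    simp only [cumRate, Finset.Icc_eq_empty_of_lt (zero_lt_one : (0 : ℕ) < 1), Finset.sum_empty,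
      pow_zero, Nat.lt_one_iff] at this
    rw [this]; rfl
  | succ t ih =>
    rw [joinIndex, ih (by omega), parent_eq_div ht, mul_comm]
    exact Nat.div_add_mod _ _

theorem parent_joinIndex {l : ℕ → ℕ} (h : ∀ i, l i < 2 ^ R (i + 1)) {t : ℕ} (ht : t ≤ T) :
    parent R T t (joinIndex R l T) = joinIndex R l t := by
  induction ht using Nat.decreasingInduction with
  | self => rw [parent_of_tailRate_eq_zero tailRate_self]
  | of_succ t ht ih =>
    rw [parent_eq_div ht, ih, joinIndex, mul_comm, Nat.mul_add_div (by positivity),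
      Nat.div_eq_of_lt (h t), add_zero]

theorem quantize_eq {p : ℕ → ℝ} {c : ℕ → ℕ → ℝ} {t : ℕ} (ht1 : 1 ≤ t) (ht : t ≤ T) (w : ℝ) :
    quantize R T p c t w = c t (parent R T t (leafIndex R T p w)) := by
  obtain ⟨t, rfl⟩ := Nat.exists_eq_add_of_le' ht1
  rw [quantize, mrsqDec, ← joinIndex_parent (leafIndex_lt p w) ht]
  rfl

end Digits

/-! ### Integrals under the law of the disturbance -/

section Law

variable {Ω : Type*} [MeasurableSpace Ω] {P : Measure Ω} {W : Ω → ℝ} {f : ℝ → ℝ}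

/-- `φ` need not be measurable and is only known on the support. This matters because policies are
arbitrary functions and their cells are intervals only within the support. -/
theorem integral_comp_eq (hf : IsLogConcaveDensity f) (hWmeas : Measurable W)
    (hW : P.map W = volume.withDensity fun x => ENNReal.ofReal (f x)) {φ ψ : ℝ → ℝ}
    (hψ : Measurable ψ) (h : ∀ w, f w ≠ 0 → φ w = ψ w) :
    ∫ ω, φ (W ω) ∂P = ∫ w, ψ w * f w := by
  have hfm := hf.logConcave.measurable.ennreal_ofReal
  have hae : ∀ᵐ w ∂(P.map W), f w ≠ 0 := by
    rw [hW, ae_withDensity_iff hfm]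
    exact ae_of_all _ fun w hw h0 => hw (by simp [h0])
  have h1 : ∫ ω, φ (W ω) ∂P = ∫ ω, ψ (W ω) ∂P :=
    integral_congr_ae ((ae_of_ae_map hWmeas.aemeasurable hae).mono fun ω hω => h _ hω)
  rw [h1, ← integral_map hWmeas.aemeasurable hψ.aestronglyMeasurable, hW,
    integral_withDensity_eq_integral_toReal_smul hfm (ae_of_all _ fun _ => ENNReal.ofReal_lt_top)]
  refine integral_congr_ae (ae_of_all _ fun w => ?_)
  simp only [ENNReal.toReal_ofReal (hf.nonneg w), smul_eq_mul, mul_comm]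

variable {R : ℕ → ℕ} {T : ℕ} {g : ℕ → ℝ} {c : ℕ → ℕ → ℝ} {L : ℝ → ℕ}

theorem measurable_sq_sub_label (hL : Measurable L) (t : ℕ) :
    Measurable fun w => (w - c t (parent R T t (L w))) ^ 2 :=
  (measurable_id.sub ((measurable_from_nat (f := fun l => c t (parent R T t l))).comp hL)).pow_const
    2

theorem distortion_eq (hf : IsLogConcaveDensity f) (hWmeas : Measurable W)
    (hW : P.map W = volume.withDensity fun x => ENNReal.ofReal (f x)) {p : ℕ → ℝ}
    (hp : IsWeakPartition f (numCells R T) p) :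
    distortion P W R T g p c
      = (∑ t ∈ Finset.Icc 1 T, g t) * (∫ w, w ^ 2 * f w) + levelCost f R T g p c := by
  rw [← labelCost_leafIndex hf hp,
    ← integral_sum_sq_eq hf (leafIndex_mono p).measurable (leafIndex_lt p), distortion]
  refine Finset.sum_congr rfl fun t ht => ?_
  obtain ⟨ht1, ht2⟩ := Finset.mem_Icc.1 ht
  congr 1
  exact integral_comp_eq hf hWmeas hW (φ := fun w => (w - quantize R T p c t w) ^ 2)
    (measurable_sq_sub_label (leafIndex_mono p).measurable t) fun w _ => by
      rw [quantize_eq ht1 ht2]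

end Law

/-! ### Completion of squares -/

section Riccati

variable {a : ℝ} {q r : ℕ → ℝ} {T : ℕ}

theorem riccati_self : riccati a q r T T = q T := by simp [riccati, riccatiBack]

theorem riccati_eq {t : ℕ} (ht : t < T) : riccati a q r T t = q t +
    riccati a q r T (t + 1) * r t / (riccati a q r T (t + 1) + r t) * a ^ 2 := by
  rw [riccati, riccati, if_pos ht.le, if_pos (show t + 1 ≤ T from ht),
    show T - t = T - (t + 1) + 1 by omega, riccatiBack,
    show T - (T - (t + 1) + 1) = t by omega]

theorem riccati_nonneg (hq : ∀ t ∈ Finset.Icc 1 T, 0 ≤ q t)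
    (hr : ∀ t ∈ Finset.Icc 1 (T - 1), 0 ≤ r t) {t : ℕ} (ht1 : 1 ≤ t) (ht : t ≤ T) :
    0 ≤ riccati a q r T t := by
  induction ht using Nat.decreasingInduction with
  | self => rw [riccati_self]; exact hq T (Finset.mem_Icc.2 ⟨ht1, le_rfl⟩)
  | of_succ t ht ih =>
    have h1 := ih (by omega)
    have h2 := hr t (Finset.mem_Icc.2 ⟨ht1, by omega⟩)
    have h3 := hq t (Finset.mem_Icc.2 ⟨ht1, ht.le⟩)
    rw [riccati_eq ht]
    positivity

theorem mrsqWeight_self : mrsqWeight a q r T T = 0 := by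
  rw [mrsqWeight, gWeight, riccati_self, riccati, if_neg (by omega)]; simp

/-- The positive weight excludes a zero denominator and a zero factor k_t a^{t-1}. The latter allows
every action to be read as an estimate of the disturbance. -/
theorem mrsqWeight_eq (hq : ∀ t ∈ Finset.Icc 1 T, 0 ≤ q t)
    (hr : ∀ t ∈ Finset.Icc 1 (T - 1), 0 ≤ r t) {t : ℕ} (ht : t ∈ Finset.Icc 1 (T - 1))
    (hg : 0 < mrsqWeight a q r T t) :
    riccati a q r T (t + 1) + r t ≠ 0 ∧ gain a q r T t * a ^ (t - 1) ≠ 0 ∧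
      mrsqWeight a q r T t
        = (riccati a q r T (t + 1) + r t) * (gain a q r T t * a ^ (t - 1)) ^ 2 := by
  obtain ⟨ht1, ht2⟩ := Finset.mem_Icc.1 ht
  have h1 : 0 ≤ riccati a q r T (t + 1) := riccati_nonneg hq hr (by omega) (by omega)
  have h2 := hr t ht
  have hne : riccati a q r T (t + 1) + r t ≠ 0 := fun h0 => by
    have h3 : riccati a q r T (t + 1) = 0 := by linarith
    have h4 : r t = 0 := by linarith
    rw [mrsqWeight, gWeight, riccati_eq (t := t) (by omega), h3, h4] at hg
    simp at hg
  have he : mrsqWeight a q r T t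
      = (riccati a q r T (t + 1) + r t) * (gain a q r T t * a ^ (t - 1)) ^ 2 := by
    rw [mrsqWeight, gWeight, riccati_eq (t := t) (by omega), gain, mul_comm 2, pow_mul]
    field_simp
    ring
  refine ⟨hne, fun h0 => ?_, he⟩
  rw [he, h0] at hg
  simp at hg

/-- Stage `T` has weight zero, but it carries no bits either, so stage `T - 1` already resolves all
leaves. -/
theorem isWeight_mrsqWeight {R : ℕ → ℕ} (hT : 1 ≤ T) (hR : R T = 0)
    (hg : ∀ t ∈ Finset.Icc 1 (T - 1), 0 < mrsqWeight a q r T t) :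
    IsWeight R T (mrsqWeight a q r T) := by
  refine ⟨fun t ht => ?_, fun hN => ?_⟩
  · rcases eq_or_ne t T with rfl | hne
    · rw [mrsqWeight_self]
    · have := Finset.mem_Icc.1 ht
      exact (hg t (Finset.mem_Icc.2 ⟨this.1, by omega⟩)).le
  · have hT2 : T ≠ 1 := by
      rintro rfl
      simp [numCells, cumRate, hR] at hN
    have := tailRate_eq_add (R := R) (t := T - 1) (T := T) (by omega)
    rw [show T - 1 + 1 = T by omega, tailRate_self, hR] at this
    exact ⟨T - 1, Finset.mem_Icc.2 ⟨by omega, by omega⟩,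
      hg _ (Finset.mem_Icc.2 ⟨by omega, le_rfl⟩), this⟩

/-- Completion of squares: the Riccati recursion makes the terms s_t x_t² telescope. -/
theorem sum_cost_eq (hT : 1 ≤ T)
    (h : ∀ t ∈ Finset.Icc 1 (T - 1), riccati a q r T (t + 1) + r t ≠ 0) {x u : ℕ → ℝ}
    (hx : ∀ t, 1 ≤ t → x (t + 1) = a * x t + u t) :
    q T * x T ^ 2 + ∑ t ∈ Finset.Icc 1 (T - 1), (q t * x t ^ 2 + r t * u t ^ 2)
      = riccati a q r T 1 * x 1 ^ 2 + ∑ t ∈ Finset.Icc 1 (T - 1),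
        (riccati a q r T (t + 1) + r t) * (u t + gain a q r T t * x t) ^ 2 := by
  have key : ∀ n, n ≤ T - 1 → riccati a q r T (n + 1) * x (n + 1) ^ 2
      + ∑ t ∈ Finset.Icc 1 n, (q t * x t ^ 2 + r t * u t ^ 2)
      = riccati a q r T 1 * x 1 ^ 2 + ∑ t ∈ Finset.Icc 1 n,
        (riccati a q r T (t + 1) + r t) * (u t + gain a q r T t * x t) ^ 2 := by
    intro n hn
    induction n with
    | zero => simp
    | succ n ih =>
      have hne := h (n + 1) (Finset.mem_Icc.2 ⟨by omega, hn⟩)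
      have ih' := ih (by omega)
      have hs := riccati_eq (a := a) (q := q) (r := r) (T := T) (t := n + 1) (by omega)
      have hsq : riccati a q r T (n + 1 + 1) * (a * x (n + 1) + u (n + 1)) ^ 2
          + (q (n + 1) * x (n + 1) ^ 2 + r (n + 1) * u (n + 1) ^ 2)
          = riccati a q r T (n + 1) * x (n + 1) ^ 2 + (riccati a q r T (n + 1 + 1) + r (n + 1))
            * (u (n + 1) + gain a q r T (n + 1) * x (n + 1)) ^ 2 := by
        rw [hs, gain]
        field_simp
        ring
      rw [Finset.sum_Icc_succ_top (by omega), Finset.sum_Icc_succ_top (by omega),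
        hx (n + 1) (by omega)]
      linarith
  have := key (T - 1) le_rfl
  rwa [show T - 1 + 1 = T by omega, riccati_self] at this

end Riccati

/-! ### The closed loop -/

namespace Policy

variable {R : ℕ → ℕ} (π : Policy R) (a : ℝ)

theorem state_one (w : ℝ) : π.state a w 1 = w := rfl

theorem hist_eq_state (w : ℝ) : ∀ (t : ℕ) (j : Fin t), π.hist a w t j = π.state a w (j + 1)
  | 0, j => j.elim0
  | 1, j => by rw [Fin.fin_one_eq_zero j]; rfl
  | t + 2, j => by
    refine Fin.lastCases ?_ (fun i => ?_) j
    · rfl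
    · rw [hist, Fin.snoc_castSucc, hist_eq_state w (t + 1) i]
      rfl

theorem state_succ (w : ℝ) {t : ℕ} (ht : 1 ≤ t) :
    π.state a w (t + 1) = a * π.state a w t + π.control a w t := by
  obtain ⟨t, rfl⟩ := Nat.exists_eq_add_of_le' ht
  rw [state, hist, Fin.snoc_last]
  rfl

theorem control_eq (w : ℝ) (t : ℕ) :
    π.control a w t = π.dec t fun i => π.msg a w ((i : ℕ) + 1) := by
  unfold control act msg
  congr 1
  funext i
  congr 1
  funext j
  rw [hist_eq_state, hist_eq_state]
  rfl

variable {π a}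

theorem control_congr {w w' : ℝ} {t : ℕ}
    (h : ∀ i ∈ Finset.Icc 1 t, π.msg a w i = π.msg a w' i) :
    π.control a w t = π.control a w' t := by
  rw [control_eq, control_eq]
  congr 1
  funext i
  exact h _ (Finset.mem_Icc.2 ⟨by omega, i.isLt⟩)

/-- The plant is linear, so the indices determine the state up to the propagated disturbance a^{t-1}
w. -/
theorem state_sub_congr {w w' : ℝ} {t : ℕ} (ht : 1 ≤ t)
    (h : ∀ i ∈ Finset.Icc 1 t, π.msg a w i = π.msg a w' i) :
    π.state a w t - a ^ (t - 1) * w = π.state a w' t - a ^ (t - 1) * w' := by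
  induction t, ht using Nat.le_induction with
  | base => simp [state_one]
  | succ t ht ih =>
    have h' : ∀ i ∈ Finset.Icc 1 t, π.msg a w i = π.msg a w' i := fun i hi =>
      h i (Finset.Icc_subset_Icc_right (Nat.le_succ t) hi)
    have e : a ^ (t + 1 - 1) = a * a ^ (t - 1) := by
      rw [← pow_succ']; congr 1; omega
    rw [state_succ _ _ _ ht, state_succ _ _ _ ht, control_congr h', e]
    linear_combination a * ih h'

/-- The cost of a policy whose actions estimate `w` by the reproduction points `c` of a monotone
labeling `L`. -/
theorem cost_eq {Ω : Type*} [MeasurableSpace Ω] {P : Measure Ω} {W : Ω → ℝ} {f : ℝ → ℝ}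
    (hf : IsLogConcaveDensity f) (hWmeas : Measurable W)
    (hW : P.map W = volume.withDensity fun x => ENNReal.ofReal (f x)) {q r : ℕ → ℝ} {T : ℕ}
    (hT : 1 ≤ T) (hq : ∀ t ∈ Finset.Icc 1 T, 0 ≤ q t) (hr : ∀ t ∈ Finset.Icc 1 (T - 1), 0 ≤ r t)
    (hg : ∀ t ∈ Finset.Icc 1 (T - 1), 0 < mrsqWeight a q r T t) {c : ℕ → ℕ → ℝ} {L : ℝ → ℕ}
    (hL : Measurable L) (hlt : ∀ w, L w < numCells R T)
    (hc : ∀ w, f w ≠ 0 → ∀ t ∈ Finset.Icc 1 (T - 1),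
      π.control a w t + gain a q r T t * π.state a w t
        = gain a q r T t * a ^ (t - 1) * (w - c t (parent R T t (L w)))) :
    π.cost P W a q r T = 1 / (T : ℝ) * ((riccati a q r T 1
      + ∑ t ∈ Finset.Icc 1 T, mrsqWeight a q r T t) * (∫ w, w ^ 2 * f w)
      + labelCost f R T (mrsqWeight a q r T) c L) := by
  rw [add_mul, add_assoc, ← integral_sum_sq_eq hf hL hlt, cost]
  congr 1
  have hm : ∀ t, Measurable fun w => (w - c t (parent R T t (L w))) ^ 2 :=
    measurable_sq_sub_label hL
  have hi : ∀ t, Integrable fun w => (w - c t (parent R T t (L w))) ^ 2 * f w := fun t =>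
    integrable_label hL hlt (φ := fun l w => (w - c t (parent R T t l)) ^ 2 * f w)
      fun l => integrable_sq_sub_mul hf _
  rw [integral_comp_eq hf hWmeas hW (ψ := fun w => riccati a q r T 1 * w ^ 2
      + ∑ t ∈ Finset.Icc 1 T, mrsqWeight a q r T t * (w - c t (parent R T t (L w))) ^ 2)
    (φ := fun w => q T * π.state a w T ^ 2 + ∑ t ∈ Finset.Icc 1 (T - 1),
      (q t * π.state a w t ^ 2 + r t * π.control a w t ^ 2))]
  · simp only [add_mul, Finset.sum_mul, mul_assoc]
    rw [integral_add (hf.integrable_sq_mul.const_mul _)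
      (integrable_finsetSum _ fun t _ => (hi t).const_mul _), integral_const_mul,
      integral_finsetSum _ fun t _ => (hi t).const_mul _]
    simp only [integral_const_mul]
  · exact ((measurable_id.pow_const 2).const_mul _).add
      (Finset.measurable_sum _ fun t _ => (hm t).const_mul _)
  · intro w hw
    rw [sum_cost_eq hT (fun t ht => (mrsqWeight_eq hq hr ht (hg t ht)).1)
      fun t ht => π.state_succ a w ht, state_one]
    congr 1
    obtain ⟨n, rfl⟩ := Nat.exists_eq_add_of_le' hT
    -- The last stage has weight zero, so the distortion has the same terms as the sum over the
    -- action times.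
    rw [Finset.sum_Icc_succ_top (by omega), mrsqWeight_self, zero_mul, add_zero]
    refine Finset.sum_congr rfl fun t ht => ?_
    rw [hc w hw t ht, mul_pow, ← mul_assoc, ← (mrsqWeight_eq hq hr ht (hg t ht)).2.2]

end Policy

/-! ### The policy built on a quantizer -/

section LqrPolicy

variable {a : ℝ} {q r : ℕ → ℝ} {T : ℕ} {R : ℕ → ℕ} {p : ℕ → ℝ} {c : ℕ → ℕ → ℝ}

theorem estimate_congr {k y y' : ℕ → ℝ} {t : ℕ} (h : ∀ s ≤ t, y s = y' s) :
    estimate a k y t = estimate a k y' t := by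
  induction t with
  | zero => rfl
  | succ t ih =>
    rw [estimate, estimate, ih fun s hs => h s (by omega), h (t + 1) le_rfl, h t (by omega)]

theorem mrsqDec_congr {l l' : ℕ → ℕ} {t : ℕ} (h : ∀ i < t, l i = l' i) :
    mrsqDec R c l t = mrsqDec R c l' t := by
  cases t with
  | zero => rfl
  | succ t => rw [mrsqDec, mrsqDec, joinIndex_congr h]

theorem lqrPolicy_msg (w : ℝ) {t : ℕ} (ht : 1 ≤ t) :
    (lqrPolicy a q r T R p c).msg a w t = mrsqEnc R T p t w := by
  simp only [Policy.msg, lqrPolicy, dif_pos (show 0 < t from ht)]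
  rw [Policy.hist_eq_state]
  rfl

theorem lqrPolicy_control (w : ℝ) (t : ℕ) : (lqrPolicy a q r T R p c).control a w t
    = -gain a q r T t * estimate a (gain a q r T) (fun s => quantize R T p c s w) t := by
  rw [Policy.control_eq]
  have : (fun i : Fin t => (lqrPolicy a q r T R p c).msg a w ((i : ℕ) + 1))
      = fun i : Fin t => mrsqEnc R T p ((i : ℕ) + 1) w := by
    funext i; exact lqrPolicy_msg w (by omega)
  rw [this]
  simp only [lqrPolicy]
  congr 1
  refine estimate_congr fun s hs => ?_
  rw [quantize]
  refine mrsqDec_congr fun i hi => ?_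
  rw [dif_pos (by omega)]

/-- The action enters the state and its estimate alike, so it cancels from the error, which is the
propagated quantization error. -/
theorem lqrPolicy_state_sub (w : ℝ) {t : ℕ} (ht : 1 ≤ t) :
    (lqrPolicy a q r T R p c).state a w t
      - estimate a (gain a q r T) (fun s => quantize R T p c s w) t
      = a ^ (t - 1) * (w - quantize R T p c t w) := by
  induction t, ht using Nat.le_induction with
  | base =>
    rw [Policy.state_one, estimate, estimate]
    simp [quantize, mrsqDec]
  | succ t ht ih =>
    have e : a ^ t = a * a ^ (t - 1) := by
      rw [← pow_succ']; congr 1; omega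
    rw [Policy.state_succ _ _ _ ht, lqrPolicy_control, estimate, Nat.add_sub_cancel, e]
    linear_combination a * ih

theorem lqrPolicy_cost {Ω : Type*} [MeasurableSpace Ω] {P : Measure Ω} {W : Ω → ℝ} {f : ℝ → ℝ}
    (hf : IsLogConcaveDensity f) (hWmeas : Measurable W)
    (hW : P.map W = volume.withDensity fun x => ENNReal.ofReal (f x))
    (hT : 1 ≤ T) (hq : ∀ t ∈ Finset.Icc 1 T, 0 ≤ q t) (hr : ∀ t ∈ Finset.Icc 1 (T - 1), 0 ≤ r t)
    (hg : ∀ t ∈ Finset.Icc 1 (T - 1), 0 < mrsqWeight a q r T t)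
    (hp : IsWeakPartition f (numCells R T) p) :
    (lqrPolicy a q r T R p c).cost P W a q r T = 1 / (T : ℝ) * ((riccati a q r T 1
      + ∑ t ∈ Finset.Icc 1 T, mrsqWeight a q r T t) * (∫ w, w ^ 2 * f w)
      + levelCost f R T (mrsqWeight a q r T) p c) := by
  rw [← labelCost_leafIndex hf hp]
  refine Policy.cost_eq hf hWmeas hW hT hq hr hg (leafIndex_mono p).measurable (leafIndex_lt p)
    fun w _ t ht => ?_
  obtain ⟨ht1, ht2⟩ := Finset.mem_Icc.1 ht
  rw [lqrPolicy_control, ← quantize_eq (p := p) (c := c) (w := w) ht1 (by omega)]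
  linear_combination gain a q r T t * lqrPolicy_state_sub (a := a) (q := q) (r := r) (T := T)
    (R := R) (p := p) (c := c) w ht1

theorem IsLogConcaveDensity.ordConnected_support {f : ℝ → ℝ} (hf : IsLogConcaveDensity f) :
    (Function.support f).OrdConnected :=
  ⟨fun _ hx _ hy _ hz => (hf.logConcave.pos_of_mem_Icc (lt_of_le_of_ne (hf.nonneg _) (Ne.symm hx))
    (lt_of_le_of_ne (hf.nonneg _) (Ne.symm hy)) hz).ne'⟩

/-- Equal indices up to `t` mean equal stage-`t` cells, and the number of the cell is monotone in
`w`. -/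
theorem lqrPolicy_contiguous {f : ℝ → ℝ} (hf : IsLogConcaveDensity f) :
    (lqrPolicy a q r T R p c).Contiguous f a T := by
  refine fun t ht σ => ⟨fun x hx y hy z hz => ⟨hf.ordConnected_support.out hx.1 hy.1 hz, ?_⟩⟩
  obtain ⟨ht1, ht2⟩ := Finset.mem_Icc.1 ht
  have hxy : parent R T t (leafIndex R T p x) = parent R T t (leafIndex R T p y) := by
    rw [← joinIndex_parent (leafIndex_lt p x) (show t ≤ T by omega),
      ← joinIndex_parent (leafIndex_lt p y) (show t ≤ T by omega)]
    refine joinIndex_congr fun i hi => ?_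
    have hi' : i + 1 ∈ Finset.Icc 1 t := Finset.mem_Icc.2 ⟨by omega, hi⟩
    have := (hx.2 _ hi').trans (hy.2 _ hi').symm
    rw [lqrPolicy_msg x (by omega), lqrPolicy_msg y (by omega)] at this
    exact congrArg Fin.val this
  have h1 := parent_mono (R := R) (T := T) t (leafIndex_mono (R := R) (T := T) p hz.1)
  have h2 := parent_mono (R := R) (T := T) t (leafIndex_mono (R := R) (T := T) p hz.2)
  have hxz : parent R T t (leafIndex R T p z) = parent R T t (leafIndex R T p x) := by omega
  intro i hi
  rw [← hx.2 i hi]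
  obtain ⟨hi1, hi2⟩ := Finset.mem_Icc.1 hi
  rw [lqrPolicy_msg z hi1, lqrPolicy_msg x hi1, mrsqEnc, mrsqEnc]
  simp only [parent_eq_of_le hi2 hxz]

end LqrPolicy

/-! ### Policies with contiguous cells -/

/-- A bounded monotone labeling of a set extends to the line. -/
theorem exists_monotone_label {S : Set ℝ} {M : ℝ → ℕ} {N : ℕ} (hN : 0 < N)
    (hM : MonotoneOn M S) (hlt : ∀ w, M w < N) :
    ∃ L : ℝ → ℕ, Monotone L ∧ (∀ w, L w < N) ∧ Set.EqOn L M S := by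
  obtain ⟨L, hL, he⟩ := hM.exists_monotone_extension (OrderBot.bddBelow _)
    ⟨N, by rintro _ ⟨w, _, rfl⟩; exact (hlt w).le⟩
  refine ⟨fun w => min (L w) (N - 1), fun x y h => min_le_min_right _ (hL h),
    fun w => ?_, fun w hw => ?_⟩
  · have := min_le_right (L w) (N - 1)
    simp only
    omega
  · have := hlt w
    simp only [← he hw]
    omega

namespace Policy

variable {R : ℕ → ℕ}

/-- The indices up to time `t` agree. -/
def Agree (π : Policy R) (a : ℝ) (t : ℕ) (w w' : ℝ) : Prop :=
  ∀ i ∈ Finset.Icc 1 t, π.msg a w i = π.msg a w' i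

open Classical in
/-- The rank of the cell of `w` at time `t` among the cells with the same earlier indices, ordered
along the line. -/
noncomputable def cellRank (π : Policy R) (a : ℝ) (S : Set ℝ) (w : ℝ) (t : ℕ) : ℕ :=
  (Finset.univ.filter fun σ : Fin (2 ^ R (t + 1)) => σ ≠ π.msg a w (t + 1) ∧
    ∃ u ∈ S, u < w ∧ π.Agree a t u w ∧ π.msg a u (t + 1) = σ).card

variable {π : Policy R} {a : ℝ} {S : Set ℝ} {w w' : ℝ} {t T : ℕ}

theorem Agree.symm (h : π.Agree a t w w') : π.Agree a t w' w := fun i hi => (h i hi).symm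

theorem Agree.trans {w'' : ℝ} (h : π.Agree a t w w') (h' : π.Agree a t w' w'') :
    π.Agree a t w w'' := fun i hi => (h i hi).trans (h' i hi)

theorem agree_succ_iff : π.Agree a (t + 1) w w' ↔
    π.Agree a t w w' ∧ π.msg a w (t + 1) = π.msg a w' (t + 1) := by
  refine ⟨fun h => ⟨fun i hi => h i (Finset.Icc_subset_Icc_right (Nat.le_succ t) hi),
    h _ (Finset.mem_Icc.2 ⟨by omega, le_rfl⟩)⟩, fun h i hi => ?_⟩
  obtain ⟨hi1, hi2⟩ := Finset.mem_Icc.1 hi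
  rcases Nat.lt_or_ge t i with hlt | hle
  · obtain rfl : i = t + 1 := by omega
    exact h.2
  · exact h.1 i (Finset.mem_Icc.2 ⟨hi1, hle⟩)

theorem cellRank_lt : π.cellRank a S w t < 2 ^ R (t + 1) := by
  classical
  have h := Finset.card_lt_univ_of_notMem
    (s := Finset.univ.filter fun σ : Fin (2 ^ R (t + 1)) => σ ≠ π.msg a w (t + 1) ∧
      ∃ u ∈ S, u < w ∧ π.Agree a t u w ∧ π.msg a u (t + 1) = σ)
    (x := π.msg a w (t + 1)) (by simp)
  rw [Fintype.card_fin] at h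
  rw [cellRank]
  convert h

theorem Contiguous.agree_of_mem_Icc {f : ℝ → ℝ} (h : π.Contiguous f a T)
    (ht : t ∈ Finset.Icc 1 (T - 1)) {u : ℝ} (hw : w ∈ Function.support f)
    (hw' : w' ∈ Function.support f) (hA : π.Agree a t w w') (hu : u ∈ Set.Icc w w') :
    π.Agree a t u w :=
  ((h t ht fun i => π.msg a w i).out ⟨hw, fun _ _ => rfl⟩ ⟨hw', hA.symm⟩ hu).2

/-- A different cell seen to the left of `w'` but not of `w` would have a point between `w` and
`w'`. By contiguity that point belongs to their common cell. -/
theorem Contiguous.cellRank_eq {f : ℝ → ℝ} (h : π.Contiguous f a T)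
    (ht : t + 1 ∈ Finset.Icc 1 (T - 1)) (hw : w ∈ Function.support f)
    (hw' : w' ∈ Function.support f) (hlt : w < w') (hA : π.Agree a (t + 1) w w') :
    π.cellRank a (Function.support f) w t = π.cellRank a (Function.support f) w' t := by
  obtain ⟨hA1, hA2⟩ := agree_succ_iff.1 hA
  unfold cellRank
  congr 1
  ext σ
  simp only [Finset.mem_filter, Finset.mem_univ, true_and]
  rw [hA2]
  refine and_congr_right fun hσ => ⟨?_, ?_⟩
  · rintro ⟨u, hu, huw, huA, rfl⟩
    exact ⟨u, hu, huw.trans hlt, huA.trans hA1, rfl⟩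
  · rintro ⟨u, hu, huw, huA, rfl⟩
    refine ⟨u, hu, ?_, huA.trans hA1.symm, rfl⟩
    by_contra hwu
    have := (agree_succ_iff.1
      (h.agree_of_mem_Icc ht hw hw' hA ⟨not_lt.1 hwu, huw.le⟩)).2
    exact hσ (this.trans hA2)

/-- Cells counted for `w` are also counted for `w'`, since an interval that was left before `w`
cannot contain `w'`. The cell of `w` itself is counted only for `w'`. -/
theorem Contiguous.cellRank_lt_cellRank {f : ℝ → ℝ} (h : π.Contiguous f a T)
    (ht : t + 1 ∈ Finset.Icc 1 (T - 1)) (hw : w ∈ Function.support f)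
    (hw' : w' ∈ Function.support f) (hlt : w < w') (hA : π.Agree a t w w')
    (hne : π.msg a w (t + 1) ≠ π.msg a w' (t + 1)) :
    π.cellRank a (Function.support f) w t < π.cellRank a (Function.support f) w' t := by
  unfold cellRank
  refine Finset.card_lt_card (Finset.ssubset_iff_of_subset ?_ |>.2 ⟨π.msg a w (t + 1), ?_, ?_⟩)
  · intro σ
    simp only [Finset.mem_filter, Finset.mem_univ, true_and]
    rintro ⟨hσ, u, hu, huw, huA, rfl⟩
    refine ⟨fun heq => hσ ?_, u, hu, huw.trans hlt, huA.trans hA, rfl⟩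
    exact (agree_succ_iff.1 (h.agree_of_mem_Icc ht hu hw'
      (agree_succ_iff.2 ⟨huA.trans hA, heq⟩) ⟨huw.le, hlt.le⟩)).2.symm
  · simp only [Finset.mem_filter, Finset.mem_univ, true_and]
    exact ⟨hne, w, hw, hlt, hA, rfl⟩
  · simp

/-- The cells at time `t`, numbered along the line and consistently with the tree. -/
noncomputable def cellLabel (π : Policy R) (a : ℝ) (S : Set ℝ) (t : ℕ) (w : ℝ) : ℕ :=
  joinIndex R (π.cellRank a S w) t

/-- Ranks are digits, so labels compare lexicographically: the first time at which the indices
differ decides, and later digits cannot overturn it. -/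
theorem Contiguous.cellLabel_compare {f : ℝ → ℝ} (h : π.Contiguous f a T)
    (ht : t ≤ T - 1) (hw : w ∈ Function.support f) (hw' : w' ∈ Function.support f)
    (hlt : w < w') :
    (π.Agree a t w w' → π.cellLabel a (Function.support f) t w
      = π.cellLabel a (Function.support f) t w') ∧
    (¬ π.Agree a t w w' → π.cellLabel a (Function.support f) t w
      < π.cellLabel a (Function.support f) t w') := by
  induction t with
  | zero => exact ⟨fun _ => rfl, fun hn => absurd (fun i hi => by simp at hi) hn⟩
  | succ t ih =>
    have ht' : t + 1 ∈ Finset.Icc 1 (T - 1) := Finset.mem_Icc.2 ⟨by omega, ht⟩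
    obtain ⟨ih1, ih2⟩ := ih (by omega)
    unfold cellLabel at ih1 ih2 ⊢
    rw [joinIndex, joinIndex]
    refine ⟨fun hA => ?_, fun hA => ?_⟩
    · rw [ih1 (agree_succ_iff.1 hA).1, h.cellRank_eq ht' hw hw' hlt hA]
    · by_cases hA' : π.Agree a t w w'
      · rw [ih1 hA']
        exact Nat.add_lt_add_left (h.cellRank_lt_cellRank ht' hw hw' hlt hA'
          fun he => hA (agree_succ_iff.2 ⟨hA', he⟩)) _
      · have h1 := Nat.mul_le_mul_right (2 ^ R (t + 1)) (Nat.succ_le_of_lt (ih2 hA'))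
        have h2 : π.cellRank a (Function.support f) w t < 2 ^ R (t + 1) := cellRank_lt
        rw [Nat.succ_mul] at h1
        omega

theorem Contiguous.monotoneOn_cellLabel {f : ℝ → ℝ} (h : π.Contiguous f a T) (ht : t ≤ T - 1) :
    MonotoneOn (π.cellLabel a (Function.support f) t) (Function.support f) := by
  intro w hw w' hw' hle
  rcases hle.eq_or_lt with rfl | hlt
  · exact le_rfl
  · obtain ⟨h1, h2⟩ := h.cellLabel_compare ht hw hw' hlt
    by_cases hA : π.Agree a t w w'
    · exact (h1 hA).le
    · exact (h2 hA).le

theorem Contiguous.agree_of_cellLabel_eq {f : ℝ → ℝ} (h : π.Contiguous f a T) (ht : t ≤ T - 1)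
    (hw : w ∈ Function.support f) (hw' : w' ∈ Function.support f)
    (he : π.cellLabel a (Function.support f) t w = π.cellLabel a (Function.support f) t w') :
    π.Agree a t w w' := by
  rcases lt_trichotomy w w' with hlt | rfl | hlt
  · by_contra hA
    exact ((h.cellLabel_compare ht hw hw' hlt).2 hA).ne he
  · exact fun _ _ => rfl
  · by_contra hA
    exact ((h.cellLabel_compare ht hw' hw hlt).2 fun hA' => hA hA'.symm).ne he.symm

/-- The estimate of `w` that underlies the action at time `t`. -/
noncomputable def impliedEstimate (π : Policy R) (a : ℝ) (k : ℕ → ℝ) (t : ℕ) (w : ℝ) : ℝ :=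
  -(π.control a w t + k t * (π.state a w t - a ^ (t - 1) * w)) / (k t * a ^ (t - 1))

theorem impliedEstimate_congr (k : ℕ → ℝ) (ht : 1 ≤ t) (h : π.Agree a t w w') :
    π.impliedEstimate a k t w = π.impliedEstimate a k t w' := by
  rw [impliedEstimate, impliedEstimate, control_congr h, state_sub_congr ht h]

/-- A policy with contiguous cells estimates `w` by the reproduction points of a monotone
labeling. -/
theorem Contiguous.exists_label {f : ℝ → ℝ} (h : π.Contiguous f a T) (hT : 1 ≤ T) (hR : R T = 0)
    {k : ℕ → ℝ} (hk : ∀ t ∈ Finset.Icc 1 (T - 1), k t * a ^ (t - 1) ≠ 0) :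
    ∃ (c : ℕ → ℕ → ℝ) (L : ℝ → ℕ), Monotone L ∧ (∀ w, L w < numCells R T) ∧
      ∀ w, f w ≠ 0 → ∀ t ∈ Finset.Icc 1 (T - 1),
        π.control a w t + k t * π.state a w t
          = k t * a ^ (t - 1) * (w - c t (parent R T t (L w))) := by
  classical
  set S := Function.support f with hS
  -- Contiguity is known only up to time `T - 1`. No bits are sent at time `T`, so the last digit is
  -- zero.
  have hlast : ∀ w, π.cellLabel a S T w = π.cellLabel a S (T - 1) w := fun w => by
    obtain ⟨n, rfl⟩ := Nat.exists_eq_add_of_le' hT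
    have := cellRank_lt (π := π) (a := a) (S := S) (w := w) (t := n)
    rw [hR, pow_zero, Nat.lt_one_iff] at this
    rw [cellLabel, joinIndex, hR, this]
    simp [cellLabel]
  have hmono : MonotoneOn (π.cellLabel a S T) S := fun w hw w' hw' hle => by
    rw [hlast, hlast]
    exact h.monotoneOn_cellLabel le_rfl hw hw' hle
  obtain ⟨L, hL, hlt, hLS⟩ := exists_monotone_label numCells_pos hmono
    fun w => joinIndex_lt (fun i => cellRank_lt) T
  -- The reproduction point of a cell is the estimate implied by the action at any of its points in
  -- the support; equal labels give equal indices and hence equal estimates. Unoccupied labels get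
  -- the irrelevant value 0.
  refine ⟨fun t m => if hm : ∃ u ∈ S, π.cellLabel a S t u = m then
    π.impliedEstimate a k t hm.choose else 0, L, hL, hlt, fun w hw t ht => ?_⟩
  obtain ⟨ht1, ht2⟩ := Finset.mem_Icc.1 ht
  have hpar : parent R T t (L w) = π.cellLabel a S t w := by
    rw [hLS hw]
    exact parent_joinIndex (fun i => cellRank_lt) (by omega)
  have hm : ∃ u ∈ S, π.cellLabel a S t u = parent R T t (L w) := ⟨w, hw, hpar.symm⟩
  beta_reduce
  rw [dif_pos hm, impliedEstimate_congr k ht1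
    (h.agree_of_cellLabel_eq ht2 hm.choose_spec.1 hw (hm.choose_spec.2.trans hpar)),
    impliedEstimate]
  rw [mul_sub, mul_div_cancel₀ _ (hk t ht)]
  ring

end Policy

end LQR

open LQR in
theorem mainTheorem3 {Ω : Type*} [MeasurableSpace Ω] (P : Measure Ω) [IsProbabilityMeasure P]
    (W : Ω → ℝ) (hWmeas : Measurable W)
    (f : ℝ → ℝ) (hf : IsLogConcave f)
    (hW : P.map W = volume.withDensity fun x => ENNReal.ofReal (f x))
    (T : ℕ) (hT : 1 ≤ T) (a : ℝ) (q r : ℕ → ℝ)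
    (hq : ∀ t ∈ Finset.Icc 1 T, 0 ≤ q t) (hr : ∀ t ∈ Finset.Icc 1 (T - 1), 0 ≤ r t)
    (hg : ∀ t ∈ Finset.Icc 1 (T - 1), 0 < mrsqWeight a q r T t)
    (R : ℕ → ℕ) (hR : R T = 0) :
    ∃ (p : ℕ → ℝ) (c : ℕ → ℕ → ℝ),
      -- `(p, c)` is a stationary point of the generalized Lloyd–Max algorithm ...
      (IsPartition f R T p ∧ IsCentroid f R T p c ∧ IsWeightedNN R T (mrsqWeight a q r T) c p) ∧
      -- ... and the only one
      (∀ (p' : ℕ → ℝ) (c' : ℕ → ℕ → ℝ),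
        IsPartition f R T p' → IsCentroid f R T p' c' →
        IsWeightedNN R T (mrsqWeight a q r T) c' p' →
          (∀ l ∈ Finset.Icc 1 (numCells R T - 1), p' l = p l) ∧
          (∀ t ∈ Finset.Icc 1 T, ∀ m < 2 ^ cumRate R t, c' t m = c t m)) ∧
      -- its LQR policy attains the minimal cost
      IsLeast {J : ℝ | ∃ π : Policy R, π.Contiguous f a T ∧ J = π.cost P W a q r T}
        ((lqrPolicy a q r T R p c).cost P W a q r T) ∧
      -- every run of the algorithm leads to it
      (∀ (pn : ℕ → ℕ → ℝ) (cn : ℕ → ℕ → ℕ → ℝ),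
        IsGLMRun f R T (mrsqWeight a q r T) pn cn →
          (∀ l ∈ Finset.Icc 1 (numCells R T - 1),
            Tendsto (fun n => pn n l) atTop (𝓝 (p l))) ∧
          (∀ t ∈ Finset.Icc 1 T, ∀ m < 2 ^ cumRate R t,
            Tendsto (fun n => cn n t m) atTop (𝓝 (c t m))) ∧
          Tendsto (fun n => (lqrPolicy a q r T R (pn (n + 1)) (cn n)).cost P W a q r T) atTop
            (𝓝 ((lqrPolicy a q r T R p c).cost P W a q r T)) ∧
          -- stopping at the first decrease below the accuracy threshold `η`
          (∀ ε > 0, ∃ η₀ > 0, ∀ η, 0 < η → η ≤ η₀ →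
            ∃ n,
              distortion P W R T (mrsqWeight a q r T) (pn (n + 1)) (cn n) -
                distortion P W R T (mrsqWeight a q r T) (pn (n + 2)) (cn (n + 1)) < η ∧
              (∀ m < n, η ≤
                distortion P W R T (mrsqWeight a q r T) (pn (m + 1)) (cn m) -
                  distortion P W R T (mrsqWeight a q r T) (pn (m + 2)) (cn (m + 1))) ∧
              (lqrPolicy a q r T R (pn (n + 2)) (cn (n + 1))).cost P W a q r T ≤
                (lqrPolicy a q r T R p c).cost P W a q r T + ε)) := by
  have hfd := IsLogConcaveDensity.of_map_eq P hWmeas hf hW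
  have hw := isWeight_mrsqWeight hT hR hg
  obtain ⟨p, hp⟩ := exists_isOptimal hfd hw
  have hpw := hp.strict.toIsWeakPartition
  have hT0 : (0 : ℝ) < T := by exact_mod_cast hT
  have hcost : ∀ {p' : ℕ → ℝ} {c' : ℕ → ℕ → ℝ}, IsWeakPartition f (numCells R T) p' →
      (lqrPolicy a q r T R p' c').cost P W a q r T = 1 / (T : ℝ) * ((riccati a q r T 1
        + ∑ t ∈ Finset.Icc 1 T, mrsqWeight a q r T t) * (∫ w, w ^ 2 * f w)
        + levelCost f R T (mrsqWeight a q r T) p' c') :=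
    fun hp' => lqrPolicy_cost hfd hWmeas hW hT hq hr hg hp'
  refine ⟨p, cenBook f R T p, ⟨hp.strict.isPartition hfd,
    fun t ht m hm => cenBook_eq_div hfd hp.strict ht hm, hp.isWeightedNN hfd hw⟩,
    fun p' c' hp' hc' hn' => ?_, ⟨⟨_, lqrPolicy_contiguous hfd, rfl⟩, ?_⟩,
    fun pn cn hrun => ⟨hrun.tendsto_levels hfd hw hp, hrun.tendsto_points hfd hw hp, ?_, ?_⟩⟩
  · have hs' := hp'.isStrictPartition hfd
    have hce := hc'.eq_cenBook hfd hs'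
    have hb := (hn'.congr hce).isBalanced
      fun i l h1 h2 => alphaSum_strictMono hfd hs' hw h1 h2
    have hlev : ∀ l ∈ Finset.Icc 1 (numCells R T - 1), p' l = p l := fun l hl => by
      obtain ⟨h1, h2⟩ := Finset.mem_Icc.1 hl
      exact IsBalanced.unique hfd hw hp.strict hs' hp.balanced hb h1 (by omega)
    exact ⟨hlev, fun t ht m hm => (hce t ht m hm).trans
      (cenBook_congr hfd hs'.toIsWeakPartition hlev ht hm)⟩
  · rintro _ ⟨π, hπ, rfl⟩
    obtain ⟨c, L, hL, hlt, hc⟩ := hπ.exists_label hT hR (k := gain a q r T)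
      fun t ht => (mrsqWeight_eq hq hr ht (hg t ht)).2.1
    -- Both costs are the same increasing affine function, applied to `levelCost` and to
    -- `labelCost`.
    rw [hcost hpw, Policy.cost_eq hfd hWmeas hW hT hq hr hg hL.measurable hlt hc]
    have := hp.le_labelCost hfd hw hL hlt c
    gcongr
  · simp only [hcost (hrun.strict hfd _).toIsWeakPartition, hcost hpw]
    exact ((hrun.tendsto_levelCost hfd hw hp).const_add _).const_mul _
  · intro ε hε
    -- The control cost carries the factor 1/T, so a tolerance of `T * ε` in the distortion
    -- suffices.
    obtain ⟨η₀, hη₀, hη⟩ := hrun.exists_stop hfd hw hp (mul_pos hT0 hε)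
    refine ⟨η₀, hη₀, fun η h1 h2 => ?_⟩
    obtain ⟨n, hn1, hn2, hn3⟩ := hη η h1 h2
    have hd : ∀ m, distortion P W R T (mrsqWeight a q r T) (pn (m + 1)) (cn m) =
        (∑ t ∈ Finset.Icc 1 T, mrsqWeight a q r T t) * (∫ w, w ^ 2 * f w)
          + levelCost f R T (mrsqWeight a q r T) (pn (m + 1)) (cn m) := fun m =>
      distortion_eq hfd hWmeas hW (hrun.strict hfd (m + 1)).toIsWeakPartition
    refine ⟨n, ?_, fun m hm => ?_, ?_⟩
    · rw [hd, hd (n + 1)]; linarith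
    · rw [hd, hd (m + 1)]; linarith [hn2 m hm]
    · rw [hcost (hrun.strict hfd _).toIsWeakPartition, hcost hpw, ← sub_nonneg]
      rw [← sub_nonneg] at hn3
      have := mul_nonneg (one_div_pos.2 hT0).le hn3
      have e : 1 / (T : ℝ) * (T * ε) = ε := by field_simp
      rw [mul_sub, mul_add, e] at this
      linarith
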